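/- **Setting.** Let $\mathbb T^2=(\mathbb R/2\pi\mathbb Z)^2$ with its Haar probability measure $dx$, $e_n(x)=e^{in\cdot x}$ and $\widehat u(n)=\int u\,\overline{e_n}\,dx$ for $n\in\mathbb Z^2$, and write $\langle k\rangle=1+|k|$. Fix a smooth radial dyadic partition of unity $(\rho_j)_{j\ge -1}$ of $\mathbb R^2$: $\rho_{-1}$ is supported in a ball, $\rho_j=\rho(2^{-j}\cdot)$ for $j\ge0$ with $\rho$ supported in an annulus, $\sum_{j\geq -1}\rho_j=1$, and $\rho_i\rho_j=0$ if $|i-j|>1$. Set $\Delta_ju=\mathcal F^{-1}(\rho_j\widehat u)$, $\|u\|_{\mathcal C^\gamma}=\sup_{j\ge-1}2^{j\gamma}\|\Delta_ju\|_{L^\infty}$ (so $\mathcal C^\gamma(\mathbb T^2)=B^\gamma_{\infty,\infty}(\mathbb T^2)$), and $\mathsf\Pi(u,v)=\sum_{|i-j|\le1}(\Delta_iu)(\Delta_jv)$. For $s\in\mathbb R$, let $\Sigma^s_0$ be the class of functions $a:\mathbb T^2\times\mathbb Z^2\to\mathbb C$ such that for all multi-indices $i,j\in\mathbb N^2$ there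 is a constant $C_{i,j}$ with $\|\partial_x^i\mathbf D^ja(\cdot,k)\|_{\mathcal C^0}\le C_{i,j}\langle k\rangle^{s-|j|}$ for all $k\in\mathbb Z^2$, where $\mathbf D=(D_1,D_2)$ are the forward difference operators in $k$, and such that for some $0<\mu<1$ the $n$-th Fourier coefficient of $a(\cdot,k)$ vanishes whenever $|n|>\mu\langle k\rangle$. The operator with symbol $a$ is $(Av)(x)=\sum_{k}a(x,k)\,\widehat v(k)\,e_k(x)$. Let $\xi$ be a space white noise on $\mathbb T^2$, that is, a random real distribution such that $\xi(\varphi)$ is a centred Gaussian variable of variance $\|\varphi\|_{L^2(dx)}^2$ for every smooth real $\varphi$. Let $X=-\Delta^{-1}\xi$ with null mean, so that $\widehat X(k)=|k|^{-2}\widehat\xi(k)$ for $k\ne0$ and $\widehat X(0)=0$. Let $\chi:[0,\infty)\to[0,1]$ be smooth, equal to $1$ on $[0,1]$ and to $0$ on $[2,\infty)$, and set $\xi^\varepsilon=\mathcal F^{-1}(\chi(\varepsilon|\cdot|)\widehat\xi)$ and $X^\varepsilon=\mathcal F^{-1}(\chi(\varepsilon|\cdot|)\widehat X)$. **Theorem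 2.** Let $2/3<\alpha<1$, $s\le0$ and $a\in\Sigma^s_0$ with associated operator $A$. There is a deterministic function $c:\varepsilon\in(0,1]\mapsto c^\varepsilon\in C^\infty(\mathbb T^2)$ such that $$\mathsf\Pi\big(A(X^\varepsilon),\xi^\varepsilon\big)-c^\varepsilon$$ converges as $\varepsilon\to0$, in $L^r\big(\Omega;\mathcal C^{2\alpha-2-s}(\mathbb T^2)\big)$ for every $1\le r<\infty$, to a limit that does not depend on $r$ and is denoted $:\!\mathsf\Pi(AX,\xi)\!:$. Moreover, $c$ is diverging as soon as the real part of $a$ is bounded below by a positive constant at high frequency: if there are $\kappa>0$ and $R$ with $\operatorname{Re}a(x,k)\ge\kappa$ for all $x$ and all $|k|\ge R$, then $\|c^\varepsilon\|_{L^\infty}\to\infty$ as $\varepsilon\to0$. -/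

import Mathlib

open MeasureTheory ProbabilityTheory Filter Topology UnitAddTorus
open scoped ENNReal ComplexConjugate

noncomputable section

/-! ### The torus and its distributions

The torus `𝕋² = (ℝ/2πℤ)²` is parametrised by `UnitAddTorus (Fin 2) = (ℝ/ℤ)²` through `x = 2π y`,
so that the character `e_n(x) = exp (i n·x)` is `mFourier n`. The reference measure `dx` is the
Haar probability measure, so that `û(n) = ∫ u(x) exp (-i n·x) dx` and `u = ∑ û(n) e_n`. -/

/-- The two-dimensional torus. -/
abbrev Torus2 : Type := UnitAddTorus (Fin 2)

/-- The Haar probability measure of the torus. -/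
def torusMeasure : Measure Torus2 := Measure.pi fun _ => AddCircle.haarAddCircle

/-- The supremum norm of a function on the torus, possibly infinite. -/
def supENorm (f : Torus2 → ℂ) : ℝ≥0∞ := ⨆ x, ‖f x‖ₑ

/-- The frequency lattice `ℤ²`. -/
abbrev Freq : Type := Fin 2 → ℤ

/-- A frequency seen as a vector of the Euclidean plane. -/
def Freq.vec (k : Freq) : EuclideanSpace ℝ (Fin 2) := WithLp.toLp 2 (fun i => (k i : ℝ))

/-- The Euclidean length `|k|`. -/
def Freq.len (k : Freq) : ℝ := ‖k.vec‖

/-- The bracket `⟨k⟩ = 1 + |k|`. -/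
def Freq.bracket (k : Freq) : ℝ := 1 + k.len

theorem Freq.len_nonneg (k : Freq) : 0 ≤ k.len := norm_nonneg _

theorem Freq.one_le_bracket (k : Freq) : 1 ≤ k.bracket := by
  have := k.len_nonneg
  unfold Freq.bracket
  linarith

theorem Freq.abs_coord_le (k : Freq) (i : Fin 2) : |(k i : ℝ)| ≤ k.len := by
  have h := PiLp.norm_apply_le (p := 2) k.vec i
  simpa [Freq.vec, Freq.len] using h

/-- A function on the torus is smooth if its periodic lift to the plane is. -/
def SmoothOnTorus {E : Type*} [NormedAddCommGroup E] [NormedSpace ℝ E] (f : Torus2 → E) : Prop :=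
  ContDiff ℝ (⊤ : ℕ∞) (fun y : Fin 2 → ℝ => f (fun i => (y i : UnitAddCircle)))

/-- Families on `ℤ²` of at most polynomial growth. -/
def SlowGrowth (u : Freq → ℂ) : Prop :=
  ∃ (C : ℝ) (N : ℕ), ∀ k, ‖u k‖ ≤ C * k.bracket ^ N

theorem SlowGrowth.zero : SlowGrowth 0 := ⟨0, 0, fun k => by simp⟩

theorem SlowGrowth.mul {u v : Freq → ℂ} (hu : SlowGrowth u) (hv : SlowGrowth v) :
    SlowGrowth (fun k => u k * v k) := by
  obtain ⟨C, N, hu⟩ := hu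
  obtain ⟨C', N', hv⟩ := hv
  refine ⟨C * C', N + N', fun k => ?_⟩
  have h0 : 0 ≤ C * k.bracket ^ N := (norm_nonneg _).trans (hu k)
  calc ‖u k * v k‖ = ‖u k‖ * ‖v k‖ := norm_mul _ _
    _ ≤ (C * k.bracket ^ N) * (C' * k.bracket ^ N') :=
        mul_le_mul (hu k) (hv k) (norm_nonneg _) h0
    _ = C * C' * k.bracket ^ (N + N') := by ring

theorem SlowGrowth.of_bounded {u : Freq → ℂ} (C : ℝ) (h : ∀ k, ‖u k‖ ≤ C) : SlowGrowth u :=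
  ⟨C, 0, fun k => by simpa using h k⟩

theorem SlowGrowth.add {u v : Freq → ℂ} (hu : SlowGrowth u) (hv : SlowGrowth v) :
    SlowGrowth (u + v) := by
  obtain ⟨C, N, hu⟩ := hu
  obtain ⟨C', N', hv⟩ := hv
  refine ⟨|C| + |C'|, N + N', fun k => ?_⟩
  have hb := k.one_le_bracket
  have h1 : k.bracket ^ N ≤ k.bracket ^ (N + N') := pow_le_pow_right₀ hb (by omega)
  have h2 : k.bracket ^ N' ≤ k.bracket ^ (N + N') := pow_le_pow_right₀ hb (by omega)
  have h3 : C * k.bracket ^ N ≤ |C| * k.bracket ^ (N + N') :=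
    mul_le_mul (le_abs_self C) h1 (by positivity) (abs_nonneg _)
  have h4 : C' * k.bracket ^ N' ≤ |C'| * k.bracket ^ (N + N') :=
    mul_le_mul (le_abs_self C') h2 (by positivity) (abs_nonneg _)
  calc ‖(u + v) k‖ ≤ ‖u k‖ + ‖v k‖ := norm_add_le _ _
    _ ≤ (|C| + |C'|) * k.bracket ^ (N + N') := by
        have := hu k
        have := hv k
        linarith

/-- The space of slowly growing families on `ℤ²`. -/
def slowlyGrowing : Submodule ℂ (Freq → ℂ) where
  carrier := {u | SlowGrowth u}
  zero_mem' := SlowGrowth.zero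
  add_mem' := SlowGrowth.add
  smul_mem' c _ hu := (SlowGrowth.of_bounded (u := fun _ => c) ‖c‖ (fun _ => le_rfl)).mul hu

/-- Distributions on the torus, each identified with the slowly growing family of its Fourier
coefficients. -/
def TorusDistribution : Type := slowlyGrowing

instance : AddCommGroup TorusDistribution := inferInstanceAs (AddCommGroup slowlyGrowing)

instance : Module ℂ TorusDistribution := inferInstanceAs (Module ℂ slowlyGrowing)

namespace TorusDistribution

/-- The Fourier coefficients of a distribution. -/
def coeff (u : TorusDistribution) : Freq → ℂ := Subtype.val u

theorem slowGrowth_coeff (u : TorusDistribution) : SlowGrowth u.coeff := Subtype.property u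

theorem coeff_zero : (0 : TorusDistribution).coeff = 0 := rfl

theorem coeff_add (u v : TorusDistribution) : (u + v).coeff = u.coeff + v.coeff := rfl

theorem coeff_smul (c : ℂ) (u : TorusDistribution) : (c • u).coeff = c • u.coeff := rfl

theorem coeff_injective : Function.Injective coeff := Subtype.val_injective

/-- The distribution associated with an integrable function. -/
def ofFun (f : Torus2 → ℂ) : TorusDistribution :=
  ⟨mFourierCoeff f, SlowGrowth.of_bounded (∫ x, ‖f x‖ ∂torusMeasure) (fun k => by
    unfold mFourierCoeff
    refine (norm_integral_le_integral_norm _).trans (le_of_eq ?_)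
    change _ = ∫ x, ‖f x‖ ∂(Measure.pi fun _ => AddCircle.haarAddCircle)
    refine integral_congr_ae (Eventually.of_forall fun x => ?_)
    have h : ‖mFourier (-k) x‖ = 1 := by simp [mFourier, Circle.norm_coe]
    simp only [norm_smul, h, one_mul])⟩

/-- The Fourier multiplier with a slowly growing symbol `m`. -/
def multiplier (m : Freq → ℂ) (hm : SlowGrowth m) (u : TorusDistribution) : TorusDistribution :=
  ⟨fun k => m k * u.coeff k, hm.mul u.slowGrowth_coeff⟩

/-- The partial derivative in the direction `l`: `∂_l e_n = i n_l e_n`. -/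
def partialDeriv (l : Fin 2) (u : TorusDistribution) : TorusDistribution :=
  multiplier (fun n => Complex.I * (n l : ℂ)) ⟨1, 1, fun k => by
    have h := k.abs_coord_le l
    have h' : ‖Complex.I * (k l : ℂ)‖ = |(k l : ℝ)| := by simp
    rw [h', one_mul, pow_one, Freq.bracket]
    linarith⟩ u

/-- The derivative `∂^i` for a multi-index `i`. -/
def iteratedPartial (i : Fin 2 → ℕ) (u : TorusDistribution) : TorusDistribution :=
  (partialDeriv 0)^[i 0] ((partialDeriv 1)^[i 1] u)

/-- `-Δ⁻¹ u`, the solution `X` with null mean of `-Δ X = u - û(0)`. -/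
def negInvLaplacian (u : TorusDistribution) : TorusDistribution :=
  multiplier (fun k => if k = 0 then 0 else ((1 / k.len ^ 2 : ℝ) : ℂ))
    (SlowGrowth.of_bounded 1 (fun k => by
      by_cases hk : k = 0
      · simp [hk]
      · obtain ⟨l, hl⟩ : ∃ l, k l ≠ 0 := by
          by_contra! h
          exact hk (funext h)
        have h1 : (1 : ℝ) ≤ |(k l : ℝ)| := by exact_mod_cast Int.one_le_abs hl
        have h2 : 1 ≤ k.len := h1.trans (k.abs_coord_le l)
        have h3 : (1 : ℝ) ≤ k.len ^ 2 := one_le_pow₀ h2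
        rw [if_neg hk, Complex.norm_real, Real.norm_eq_abs, abs_of_nonneg (by positivity)]
        exact (div_le_one (by positivity)).2 h3)) u

/-- Real distributions. -/
def IsReal (u : TorusDistribution) : Prop := ∀ k, u.coeff (-k) = conj (u.coeff k)

/-- The duality pairing of a distribution with a smooth real function. -/
def pairing (u : TorusDistribution) (φ : Torus2 → ℝ) : ℂ :=
  ∑' k, u.coeff k * mFourierCoeff (fun x => (φ x : ℂ)) (-k)

end TorusDistribution

open TorusDistribution

/-! ### Littlewood-Paley blocks, Besov spaces, resonant product -/

/-- A radial smooth dyadic partition of unity of the plane: `ρ_{-1} = chi` is supported in a ball,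
`ρ_j = rho (2^{-j} ·)` for `j ≥ 0` with `rho` supported in an annulus, the `ρ_j` sum to one and
`ρ_i ρ_j = 0` if `|i - j| > 1`. -/
structure DyadicPartition where
  /-- The low frequency function. -/
  chi : EuclideanSpace ℝ (Fin 2) → ℝ
  /-- The annular function. -/
  rho : EuclideanSpace ℝ (Fin 2) → ℝ
  chi_smooth : ContDiff ℝ (⊤ : ℕ∞) chi
  rho_smooth : ContDiff ℝ (⊤ : ℕ∞) rho
  chi_radial : ∀ x y, ‖x‖ = ‖y‖ → chi x = chi y
  rho_radial : ∀ x y, ‖x‖ = ‖y‖ → rho x = rho y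
  chi_support : ∃ R : ℝ, ∀ x, chi x ≠ 0 → ‖x‖ ≤ R
  rho_support : ∃ R₁ R₂ : ℝ, 0 < R₁ ∧ ∀ x, rho x ≠ 0 → R₁ ≤ ‖x‖ ∧ ‖x‖ ≤ R₂
  sum_eq_one : ∀ x, HasSum (fun j : ℕ => rho ((2 : ℝ)⁻¹ ^ j • x)) (1 - chi x)
  chi_mul_rho : ∀ j : ℕ, 1 ≤ j → ∀ x, chi x * rho ((2 : ℝ)⁻¹ ^ j • x) = 0
  rho_mul_rho : ∀ i j : ℕ, i + 2 ≤ j → ∀ x,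
    rho ((2 : ℝ)⁻¹ ^ i • x) * rho ((2 : ℝ)⁻¹ ^ j • x) = 0

namespace DyadicPartition

/-- The family `ρ_{-1}, ρ_0, ρ_1, …`; the index is shifted by one: `D.weight q` is `ρ_{q-1}`. -/
def weight (D : DyadicPartition) : ℕ → EuclideanSpace ℝ (Fin 2) → ℝ
  | 0 => D.chi
  | j + 1 => fun x => D.rho ((2 : ℝ)⁻¹ ^ j • x)

/-- The Littlewood-Paley block `Δ_{q-1} u`, a trigonometric polynomial. -/
def block (D : DyadicPartition) (q : ℕ) (u : TorusDistribution) : Torus2 → ℂ := fun x =>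
  ∑' n : Freq, (D.weight q n.vec : ℂ) * u.coeff n * mFourier n x

/-- The norm of `u` in the Besov space `C^γ = B^γ_{∞,∞}`, possibly infinite:
`sup_{j ≥ -1} 2^{jγ} ‖Δ_j u‖_{L^∞}`. -/
def besovENorm (D : DyadicPartition) (γ : ℝ) (u : TorusDistribution) : ℝ≥0∞ :=
  ⨆ q : ℕ, ENNReal.ofReal ((2 : ℝ) ^ (γ * ((q : ℝ) - 1))) * supENorm (D.block q u)

theorem finite_freq_len_le (R : ℝ) : {n : Freq | n.len ≤ R}.Finite := by
  refine (Set.finite_Icc (fun _ => -⌈R⌉ : Freq) (fun _ => ⌈R⌉)).subset fun n hn => ?_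
  have hn' : ∀ i, |n i| ≤ ⌈R⌉ := fun i => by
    have h : |(n i : ℝ)| ≤ (⌈R⌉ : ℝ) := ((Freq.abs_coord_le n i).trans hn).trans (Int.le_ceil R)
    exact_mod_cast h
  exact ⟨fun i => (abs_le.1 (hn' i)).1, fun i => (abs_le.1 (hn' i)).2⟩

theorem finite_weight (D : DyadicPartition) (q : ℕ) :
    {n : Freq | D.weight q n.vec ≠ 0}.Finite := by
  cases q with
  | zero =>
    obtain ⟨R, hR⟩ := D.chi_support
    exact (finite_freq_len_le R).subset fun n hn => hR _ hn
  | succ j =>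
    obtain ⟨R₁, R₂, -, hR⟩ := D.rho_support
    refine (finite_freq_len_le (2 ^ j * R₂)).subset fun n hn => ?_
    have h := (hR _ hn).2
    rw [norm_smul, norm_pow, norm_inv, Real.norm_ofNat, inv_pow] at h
    have h2 : (0 : ℝ) < 2 ^ j := by positivity
    have h3 := (inv_mul_le_iff₀ h2).1 h
    exact h3

theorem block_eq_sum (D : DyadicPartition) (q : ℕ) (u : TorusDistribution) (x : Torus2) :
    D.block q u x = ∑ n ∈ (D.finite_weight q).toFinset,
      (D.weight q n.vec : ℂ) * u.coeff n * mFourier n x := by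
  refine tsum_eq_sum fun n hn => ?_
  have h : D.weight q n.vec = 0 := by simpa using hn
  simp [h]

theorem block_zero (D : DyadicPartition) (q : ℕ) : D.block q 0 = 0 := by
  funext x
  simp [block_eq_sum, coeff_zero]

theorem block_add (D : DyadicPartition) (q : ℕ) (u v : TorusDistribution) :
    D.block q (u + v) = D.block q u + D.block q v := by
  funext x
  simp only [block_eq_sum, coeff_add, ← Finset.sum_add_distrib, Pi.add_apply, mul_add, add_mul]

theorem block_smul (D : DyadicPartition) (q : ℕ) (c : ℂ) (u : TorusDistribution) :
    D.block q (c • u) = c • D.block q u := by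
  funext x
  simp only [block_eq_sum, coeff_smul, Finset.mul_sum, Pi.smul_apply, smul_eq_mul]
  exact Finset.sum_congr rfl fun n _ => by ring

theorem linearIndependent_mFourier :
    LinearIndependent ℂ (fun n : Freq => (mFourier n : C(Torus2, ℂ))) := by
  have h := (orthonormal_mFourier (d := Fin 2)).linearIndependent
  have : IsFiniteMeasure torusMeasure := by
    unfold torusMeasure
    infer_instance
  exact LinearIndependent.of_comp (ContinuousMap.toLp (E := ℂ) 2 torusMeasure ℂ).toLinearMap h

/-- A distribution is determined by its blocks. -/
theorem eq_zero_of_block (D : DyadicPartition) (u : TorusDistribution)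
    (h : ∀ q, D.block q u = 0) : u = 0 := by
  refine coeff_injective (funext fun n => ?_)
  have key : ∀ q, D.weight q n.vec = 0 ∨ u.coeff n = 0 := fun q => by
    by_cases hn : D.weight q n.vec = 0
    · exact Or.inl hn
    · have h0 : ∑ n ∈ (D.finite_weight q).toFinset,
          ((D.weight q n.vec : ℂ) * u.coeff n) • (mFourier n : C(Torus2, ℂ)) = 0 := by
        ext x
        have hx := congrFun (h q) x
        rw [block_eq_sum] at hx
        simpa [ContinuousMap.sum_apply] using hx
      have h1 := linearIndependent_iff'.1 linearIndependent_mFourier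
        (D.finite_weight q).toFinset (fun n => (D.weight q n.vec : ℂ) * u.coeff n) h0 n
        (by simpa using hn)
      simpa using h1
  by_contra hne
  have hne' : ¬ u.coeff n = 0 := hne
  have hw : ∀ q, D.weight q n.vec = 0 := fun q => (key q).resolve_right hne'
  have hs := D.sum_eq_one n.vec
  have h0 : D.chi n.vec = 0 := hw 0
  have h1 : (fun j : ℕ => D.rho ((2 : ℝ)⁻¹ ^ j • n.vec)) = fun _ => 0 := funext fun j => hw (j + 1)
  rw [h0, h1] at hs
  have := hs.unique hasSum_zero
  norm_num at this

theorem supENorm_zero : supENorm 0 = 0 := by simp [supENorm]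

theorem supENorm_add_le (f g : Torus2 → ℂ) : supENorm (f + g) ≤ supENorm f + supENorm g :=
  iSup_le fun x => (enorm_add_le (f x) (g x)).trans
    (add_le_add (le_iSup (fun x => ‖f x‖ₑ) x) (le_iSup (fun x => ‖g x‖ₑ) x))

theorem supENorm_smul (c : ℂ) (f : Torus2 → ℂ) : supENorm (c • f) = ‖c‖ₑ * supENorm f := by
  simp only [supENorm, Pi.smul_apply, enorm_smul, ENNReal.mul_iSup]

theorem eq_zero_of_supENorm (f : Torus2 → ℂ) (h : supENorm f = 0) : f = 0 := by
  funext x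
  simpa using ENNReal.iSup_eq_zero.1 h x

theorem besovENorm_zero (D : DyadicPartition) (γ : ℝ) : D.besovENorm γ 0 = 0 := by
  simp [besovENorm, block_zero, supENorm_zero]

theorem besovENorm_add_le (D : DyadicPartition) (γ : ℝ) (u v : TorusDistribution) :
    D.besovENorm γ (u + v) ≤ D.besovENorm γ u + D.besovENorm γ v := by
  refine iSup_le fun q => ?_
  rw [block_add]
  refine (mul_le_mul_right (supENorm_add_le _ _) _).trans ?_
  rw [mul_add]
  exact add_le_add
    (le_iSup (fun q : ℕ => ENNReal.ofReal ((2 : ℝ) ^ (γ * ((q : ℝ) - 1))) * supENorm (D.block q u)) q)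
    (le_iSup (fun q : ℕ => ENNReal.ofReal ((2 : ℝ) ^ (γ * ((q : ℝ) - 1))) * supENorm (D.block q v)) q)

theorem besovENorm_smul (D : DyadicPartition) (γ : ℝ) (c : ℂ) (u : TorusDistribution) :
    D.besovENorm γ (c • u) = ‖c‖ₑ * D.besovENorm γ u := by
  simp only [besovENorm, block_smul, supENorm_smul, ENNReal.mul_iSup, mul_left_comm]

theorem eq_zero_of_besovENorm (D : DyadicPartition) (γ : ℝ) (u : TorusDistribution)
    (h : D.besovENorm γ u = 0) : u = 0 := by
  refine D.eq_zero_of_block u fun q => ?_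
  have h1 := ENNReal.iSup_eq_zero.1 h q
  have h2 : (0 : ℝ) < (2 : ℝ) ^ (γ * ((q : ℝ) - 1)) := by positivity
  refine eq_zero_of_supENorm _ ?_
  simpa [not_le.2 h2] using h1

/-- The distributions of finite `C^γ` norm. -/
def besovSubmodule (D : DyadicPartition) (γ : ℝ) : Submodule ℂ TorusDistribution where
  carrier := {u | D.besovENorm γ u < ∞}
  zero_mem' := by simp [besovENorm_zero]
  add_mem' hu hv := (D.besovENorm_add_le γ _ _).trans_lt (ENNReal.add_lt_top.2 ⟨hu, hv⟩)
  smul_mem' c u hu := by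
    have hu' : D.besovENorm γ u < ∞ := hu
    change D.besovENorm γ (c • u) < ∞
    rw [besovENorm_smul]
    exact ENNReal.mul_lt_top enorm_lt_top hu'

/-- The space `C^γ(𝕋²) = B^γ_{∞,∞}(𝕋²)`. -/
def BesovSpace (D : DyadicPartition) (γ : ℝ) : Type := D.besovSubmodule γ

instance (D : DyadicPartition) (γ : ℝ) : AddCommGroup (D.BesovSpace γ) :=
  inferInstanceAs (AddCommGroup (D.besovSubmodule γ))

instance (D : DyadicPartition) (γ : ℝ) : Module ℂ (D.BesovSpace γ) :=
  inferInstanceAs (Module ℂ (D.besovSubmodule γ))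

/-- An element of `C^γ` as a distribution. -/
def BesovSpace.toDistribution {D : DyadicPartition} {γ : ℝ} (u : D.BesovSpace γ) :
    TorusDistribution := Subtype.val u

instance (D : DyadicPartition) (γ : ℝ) : Norm (D.BesovSpace γ) :=
  ⟨fun u => (D.besovENorm γ u.toDistribution).toReal⟩

theorem besovSpace_core (D : DyadicPartition) (γ : ℝ) :
    NormedSpace.Core ℂ (D.BesovSpace γ) where
  norm_nonneg _ := ENNReal.toReal_nonneg
  norm_smul c u := by
    change (D.besovENorm γ (c • u.toDistribution)).toReal = _
    rw [besovENorm_smul, ENNReal.toReal_mul, toReal_enorm]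
    rfl
  norm_triangle u v := by
    have hu : D.besovENorm γ u.toDistribution < ∞ := Subtype.property u
    have hv : D.besovENorm γ v.toDistribution < ∞ := Subtype.property v
    change (D.besovENorm γ (u.toDistribution + v.toDistribution)).toReal
      ≤ (D.besovENorm γ u.toDistribution).toReal + (D.besovENorm γ v.toDistribution).toReal
    rw [← ENNReal.toReal_add hu.ne hv.ne]
    exact ENNReal.toReal_mono (ENNReal.add_lt_top.2 ⟨hu, hv⟩).ne (D.besovENorm_add_le γ _ _)
  norm_eq_zero_iff u := by
    have hu : D.besovENorm γ u.toDistribution < ∞ := Subtype.property u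
    change (D.besovENorm γ u.toDistribution).toReal = 0 ↔ u = 0
    constructor
    · intro h
      have h' := (ENNReal.toReal_eq_zero_iff _).1 h
      exact Subtype.ext (D.eq_zero_of_besovENorm γ _ (h'.resolve_right hu.ne))
    · rintro rfl
      change (D.besovENorm γ 0).toReal = 0
      simp [besovENorm_zero]

instance (D : DyadicPartition) (γ : ℝ) : NormedAddCommGroup (D.BesovSpace γ) :=
  NormedAddCommGroup.ofCore (D.besovSpace_core γ)

instance (D : DyadicPartition) (γ : ℝ) : NormedSpace ℂ (D.BesovSpace γ) :=
  NormedSpace.ofCore (D.besovSpace_core γ)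

/-- The resonant product `Π(u, v) = ∑_{|i - j| ≤ 1} (Δ_i u) (Δ_j v)`, a finite sum if `u` is a
trigonometric polynomial. -/
def resonant (D : DyadicPartition) (u v : TorusDistribution) : Torus2 → ℂ := fun x =>
  ∑' i : ℕ, ∑ j ∈ Finset.Icc (i - 1) (i + 1), D.block i u x * D.block j v x

end DyadicPartition

/-! ### Symbols and pseudodifferential operators -/

/-- `D_1^{j_1} D_2^{j_2} σ`, with `D_l` the forward difference in the direction `l` of the frequency
variable. -/
def symbolDiff (j : Fin 2 → ℕ) (σ : Torus2 → Freq → ℂ) : Torus2 → Freq → ℂ := fun x =>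
  (fwdDiff (Pi.single 0 1 : Freq))^[j 0] ((fwdDiff (Pi.single 1 1 : Freq))^[j 1] (σ x))

/-- The class `Σ^s_α` of symbols. The derivatives in `x` are taken in the sense of
distributions; since all of them lie in `C^α`, each `σ(·, k)` is smooth. -/
structure IsSymbol (D : DyadicPartition) (s α : ℝ) (σ : Torus2 → Freq → ℂ) : Prop where
  continuous : ∀ k, Continuous fun x => σ x k
  bound : ∀ i j : Fin 2 → ℕ, ∃ C : ℝ, ∀ k : Freq,
    D.besovENorm α (iteratedPartial i (ofFun fun x => symbolDiff j σ x k))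
      ≤ ENNReal.ofReal (C * k.bracket ^ (s - ((j 0 : ℝ) + (j 1 : ℝ))))
  spectral : ∃ μ : ℝ, 0 < μ ∧ μ < 1 ∧ ∀ n k : Freq, μ * k.bracket < n.len →
    mFourierCoeff (fun x => σ x k) n = 0

/-- The operator with symbol `σ`: `(A v)(x) = ∑_k σ(x, k) v̂(k) e_k(x)`, for `v` with rapidly
decreasing Fourier coefficients. -/
def pseudoDiff (σ : Torus2 → Freq → ℂ) (v : TorusDistribution) : Torus2 → ℂ := fun x =>
  ∑' k : Freq, σ x k * v.coeff k * mFourier k x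

/-! ### White noise and its regularisation -/

/-- A smooth cut-off `[0, ∞) → [0, 1]`, equal to `1` on `[0, 1]` and to `0` on `[2, ∞)`. -/
structure Cutoff where
  /-- The underlying function; only its values on `[0, ∞)` matter. -/
  toFun : ℝ → ℝ
  smooth : ContDiffOn ℝ (⊤ : ℕ∞) toFun (Set.Ici 0)
  nonneg : ∀ t, 0 ≤ t → 0 ≤ toFun t
  le_one : ∀ t, 0 ≤ t → toFun t ≤ 1
  eq_one : ∀ t, 0 ≤ t → t ≤ 1 → toFun t = 1
  eq_zero : ∀ t, 2 ≤ t → toFun t = 0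

/-- The regularisation `R^ε u`, with Fourier coefficients `χ(ε |k|) û(k)`, for `ε ≥ 0`; the
absolute value only serves to define it for all `ε`. -/
def Cutoff.regularize (χ : Cutoff) (ε : ℝ) (u : TorusDistribution) : TorusDistribution :=
  multiplier (fun k => (χ.toFun (|ε| * k.len) : ℂ)) (SlowGrowth.of_bounded 1 (fun k => by
    have h : 0 ≤ |ε| * k.len := mul_nonneg (abs_nonneg _) k.len_nonneg
    rw [Complex.norm_real, Real.norm_eq_abs, abs_of_nonneg (χ.nonneg _ h)]
    exact χ.le_one _ h)) u

/-- Space white noise on the torus: a random real distribution `ξ` such that `ξ(φ)` is a centred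
Gaussian variable of variance `‖φ‖²_{L²}` for each smooth real function `φ`. By linearity the
family of all `ξ(φ)` is then jointly Gaussian with covariance `⟨φ, ψ⟩_{L²}`. -/
structure IsWhiteNoise {Ω : Type*} [MeasurableSpace Ω] (P : Measure Ω)
    (ξ : Ω → TorusDistribution) : Prop where
  real : ∀ ω, (ξ ω).IsReal
  law : ∀ φ : Torus2 → ℝ, SmoothOnTorus φ →
    HasLaw (fun ω => ((ξ ω).pairing φ).re) (gaussianReal 0 (∫ x, φ x ^ 2 ∂torusMeasure).toNNReal) P

end

section

open TorusDistribution

/-! ### Trigonometric polynomials -/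

/-! Expanding both factors in Fourier series, the regularised product is the finite double sum of
`pairWeight ε k l` · ξ̂(k) ξ̂(l) · Π(a(·,k) e_k, e_l), where `pairWeight ε k l` = χ(ε|k|) |k|⁻²
χ(ε|l|). Since E[ξ̂(k) ξ̂(l)] = 1_{k+l=0}, its expectation is an explicit smooth function, the pairs
l = -k alone. This expectation is c^ε, and what remains is a centred element of the second Gaussian
chaos.

Such an element is controlled by its variance. In the n-th Fourier mode of Π(a(·,k) e_k, e_l), the
factor a(·,k) e_k carries the frequency n - l, which the spectral condition keeps below 2⟨k⟩; the
resonance then forces l, hence n, to be at most of order ⟨k⟩ (`exists_kernelCoeff_support`). So the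
block of index q only sees ⟨k⟩ ≳ 2^q. The symbol contributes ⟨k⟩^s with decay ⟨n-l-k⟩⁻³ off the
diagonal, the operator -Δ⁻¹ contributes ⟨k⟩⁻², and summing squares gives a pointwise variance of
order 2^{2qs} up to arbitrarily small powers of 2^q (`exists_sum_sq_block_kernel_le`). This is the
regularity -s up to an arbitrarily small loss, so C^{2α-2-s} leaves a gap of 2(1-α). Half of it pays
for crude lattice counts and for a rate in ε, the other half for the passage from moments at a point
to the supremum.

That passage combines equivalence of moments in the second chaos
(`GaussianDominated.lintegral_quadratic_le`), the inequality `supENorm_trigPoly_pow_le`, whose cost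
is a fixed power of 2^q, and a sum over blocks; taking the moment 2p large makes the geometric
series converge.

For the convergence, the weights at ε and δ agree on low frequencies and otherwise differ by at most
a constant times η^θ ⟨k⟩^{θ-2} for η ≥ max(ε, δ) (`Cutoff.norm_pairWeight_sub_le`). The same moment
bound then gives a Cauchy property with rate η^θ in every L^r, and completeness of C^γ gives the
limit (`exists_tendsto_eLpNorm_of_rate`).

For the divergence, the mean of c^ε is the sum over k of χ(ε|k|)² |k|⁻² ∫ a(x,k) dx. Its real part
is at least κ times the partial sums of ∑ |k|⁻², up to a bounded error, and that series diverges in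
dimension two (`Freq.not_summable_invLenSq`). -/

instance : IsProbabilityMeasure torusMeasure := by
  unfold torusMeasure
  infer_instance

/-! ### Lengths and brackets of frequencies. -/

namespace Freq

theorem vec_add (m n : Freq) : (m + n).vec = m.vec + n.vec := by
  ext i
  simp [Freq.vec]

theorem vec_neg (n : Freq) : (-n).vec = -n.vec := by
  ext i
  simp [Freq.vec]

theorem len_add_le (m n : Freq) : (m + n).len ≤ m.len + n.len := by
  rw [len, vec_add]
  exact norm_add_le _ _

theorem len_neg (n : Freq) : (-n).len = n.len := by
  rw [len, vec_neg, norm_neg, len]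

theorem len_zero : (0 : Freq).len = 0 := by
  have : (0 : Freq).vec = 0 := by
    ext i
    simp [Freq.vec]
  rw [len, this, norm_zero]

theorem bracket_pos (n : Freq) : 0 < n.bracket := zero_lt_one.trans_le n.one_le_bracket

theorem bracket_add_le (m n : Freq) : (m + n).bracket ≤ m.bracket + n.bracket := by
  have := len_add_le m n
  unfold bracket
  linarith

theorem one_le_len {k : Freq} (hk : k ≠ 0) : 1 ≤ k.len := by
  obtain ⟨l, hl⟩ : ∃ l, k l ≠ 0 := by
    by_contra! h
    exact hk (funext h)
  have h1 : (1 : ℝ) ≤ |(k l : ℝ)| := by exact_mod_cast Int.one_le_abs hl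
  exact h1.trans (k.abs_coord_le l)

theorem len_le_abs_add_abs (k : Freq) : k.len ≤ |(k 0 : ℝ)| + |(k 1 : ℝ)| := by
  rw [len, EuclideanSpace.norm_eq, Fin.sum_univ_two]
  refine Real.sqrt_le_iff.2 ⟨by positivity, ?_⟩
  simp only [vec, Real.norm_eq_abs]
  nlinarith [abs_nonneg (k 0 : ℝ), abs_nonneg (k 1 : ℝ)]

theorem norm_le_len (k : Freq) : ‖k‖ ≤ k.len := by
  refine (pi_norm_le_iff_of_nonneg k.len_nonneg).2 fun i => ?_
  rw [Int.norm_eq_abs]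
  exact k.abs_coord_le i

end Freq

/-! ### Characters and Fourier coefficients. -/

theorem norm_mFourier_apply (n : Freq) (x : Torus2) : ‖mFourier n x‖ = 1 := by
  simp [mFourier, Circle.norm_coe]

theorem mFourier_add_apply (m n : Freq) (x : Torus2) :
    mFourier (m + n) x = mFourier m x * mFourier n x := mFourier_add

theorem mFourier_neg_apply (n : Freq) (x : Torus2) :
    mFourier (-n) x = conj (mFourier n x) := mFourier_neg

theorem Continuous.integrable_torus {E : Type*} [NormedAddCommGroup E] {f : Torus2 → E}
    (hf : Continuous f) : Integrable f torusMeasure :=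
  hf.integrable_of_hasCompactSupport (HasCompactSupport.of_compactSpace f)

theorem mFourierCoeff_eq (f : Torus2 → ℂ) (n : Freq) :
    mFourierCoeff f n = ∫ x, mFourier (-n) x * f x ∂torusMeasure := rfl

theorem integral_mFourier (n : Freq) :
    ∫ x, mFourier n x ∂torusMeasure = if n = 0 then 1 else 0 := by
  have h := (orthonormal_iff_ite.1 (orthonormal_mFourier (d := Fin 2))) 0 n
  have h2 : inner ℂ (mFourierLp (d := Fin 2) 2 0) (mFourierLp 2 n)
      = ∫ x, mFourier n x ∂torusMeasure := by
    rw [mFourierLp, mFourierLp, ContinuousMap.inner_toLp]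
    change ∫ x, _ ∂torusMeasure = _
    refine integral_congr_ae (Eventually.of_forall fun x => ?_)
    simp [mFourier_zero]
  rw [← h2, h]
  simp only [eq_comm]

theorem mFourierCoeff_mFourier (m n : Freq) :
    mFourierCoeff (mFourier m : Torus2 → ℂ) n = if n = m then 1 else 0 := by
  rw [mFourierCoeff_eq]
  have : ∀ x, mFourier (-n) x * mFourier m x = mFourier (-n + m) x := fun x => by
    rw [mFourier_add_apply]
  simp only [this, integral_mFourier, neg_add_eq_zero]

theorem mFourierCoeff_add {f g : Torus2 → ℂ} (hf : Continuous f) (hg : Continuous g) (n : Freq) :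
    mFourierCoeff (fun x => f x + g x) n = mFourierCoeff f n + mFourierCoeff g n := by
  simp only [mFourierCoeff_eq, mul_add]
  exact integral_add (Continuous.integrable_torus (by fun_prop))
    (Continuous.integrable_torus (by fun_prop))

theorem mFourierCoeff_const_mul (c : ℂ) (f : Torus2 → ℂ) (n : Freq) :
    mFourierCoeff (fun x => c * f x) n = c * mFourierCoeff f n := by
  simp only [mFourierCoeff_eq, mul_left_comm _ c, integral_const_mul]

theorem mFourierCoeff_sum {ι : Type*} (S : Finset ι) {f : ι → Torus2 → ℂ}
    (hf : ∀ i ∈ S, Continuous (f i)) (n : Freq) :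
    mFourierCoeff (fun x => ∑ i ∈ S, f i x) n = ∑ i ∈ S, mFourierCoeff (f i) n := by
  simp only [mFourierCoeff_eq, Finset.mul_sum]
  refine integral_finsetSum S fun i hi => ?_
  have := hf i hi
  exact Continuous.integrable_torus (by fun_prop)

theorem mFourierCoeff_mul_mFourier (f : Torus2 → ℂ) (k n : Freq) :
    mFourierCoeff (fun x => f x * mFourier k x) n = mFourierCoeff f (n - k) := by
  simp only [mFourierCoeff_eq]
  refine integral_congr_ae (Eventually.of_forall fun x => ?_)
  have : mFourier (-(n - k)) x = mFourier (-n) x * mFourier k x := by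
    rw [← mFourier_add_apply]
    congr 2
    abel
  simp only [this]
  ring

/-- The trigonometric polynomial with coefficients `w` on the finite set `S`. -/
noncomputable def trigPoly (S : Finset Freq) (w : Freq → ℂ) (x : Torus2) : ℂ :=
  ∑ n ∈ S, w n * mFourier n x

theorem continuous_trigPoly (S : Finset Freq) (w : Freq → ℂ) : Continuous (trigPoly S w) := by
  unfold trigPoly
  fun_prop

theorem mFourierCoeff_trigPoly (S : Finset Freq) (w : Freq → ℂ) (n : Freq) :
    mFourierCoeff (trigPoly S w) n = if n ∈ S then w n else 0 := by
  have := mFourierCoeff_sum S (f := fun m x => w m * mFourier m x)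
    (fun i _ => by fun_prop) n
  refine this.trans ?_
  simp only [mFourierCoeff_const_mul, mFourierCoeff_mFourier, mul_ite, mul_one, mul_zero,
    Finset.sum_ite_eq]

theorem contDiff_mFourier_lift (n : Freq) : ContDiff ℝ (⊤ : ℕ∞)
    (fun y : Fin 2 → ℝ => mFourier n (fun i => (y i : UnitAddCircle))) := by
  simp only [mFourier, ContinuousMap.coe_mk, fourier_coe_apply]
  refine contDiff_prod fun i _ => ?_
  refine ContDiff.cexp ?_
  have : ContDiff ℝ (⊤ : ℕ∞) (fun y : Fin 2 → ℝ => ((y i : ℝ) : ℂ)) :=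
    Complex.ofRealCLM.contDiff.comp (contDiff_apply ℝ ℝ i)
  fun_prop

theorem smoothOnTorus_trigPoly (S : Finset Freq) (w : Freq → ℂ) :
    SmoothOnTorus (trigPoly S w) := by
  unfold SmoothOnTorus trigPoly
  exact ContDiff.sum fun n _ => contDiff_const.mul (contDiff_mFourier_lift n)

/-- Parseval for finite sums. The injective relabelling `κ` allows both `k ↦ k` and `k ↦ -k`; the
latter arises because the noise is paired with conjugate characters. -/
theorem integral_normSq_sum_mFourier {ι : Type*} (S : Finset ι) (κ : ι → Freq)
    (hκ : Set.InjOn κ S) (w : ι → ℂ) :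
    ∫ x, ‖∑ i ∈ S, w i * mFourier (κ i) x‖ ^ 2 ∂torusMeasure = ∑ i ∈ S, ‖w i‖ ^ 2 := by
  classical
  have h1 : ∀ x, ((‖∑ i ∈ S, w i * mFourier (κ i) x‖ ^ 2 : ℝ) : ℂ)
      = ∑ i ∈ S, ∑ j ∈ S, conj (w i) * w j * mFourier (-κ i + κ j) x := fun x => by
    rw [Complex.ofReal_pow, ← Complex.conj_mul', map_sum, Finset.sum_mul_sum]
    refine Finset.sum_congr rfl fun i _ => Finset.sum_congr rfl fun j _ => ?_
    rw [mFourier_add_apply, mFourier_neg_apply, map_mul]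
    ring
  have h2 : ((∫ x, ‖∑ i ∈ S, w i * mFourier (κ i) x‖ ^ 2 ∂torusMeasure : ℝ) : ℂ)
      = ((∑ i ∈ S, ‖w i‖ ^ 2 : ℝ) : ℂ) := by
    rw [← integral_complex_ofReal]
    simp only [h1]
    rw [integral_finsetSum _ fun i _ => Continuous.integrable_torus (by fun_prop)]
    push_cast
    refine Finset.sum_congr rfl fun i hi => ?_
    rw [integral_finsetSum _ fun i _ => Continuous.integrable_torus (by fun_prop)]
    simp only [integral_const_mul, integral_mFourier]
    rw [Finset.sum_eq_single i]
    · simp [Complex.conj_mul']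
    · intro j hj hij
      have : -κ i + κ j ≠ 0 := fun h => hij (hκ hj hi (neg_add_eq_zero.1 h).symm)
      simp [this]
    · exact fun h => (h hi).elim
  exact_mod_cast h2

/-- The frequencies of length at most `R`. -/
noncomputable def freqBall (R : ℝ) : Finset Freq := (DyadicPartition.finite_freq_len_le R).toFinset

theorem mem_freqBall {R : ℝ} {n : Freq} : n ∈ freqBall R ↔ n.len ≤ R := by
  simp [freqBall]

/-- The trigonometric polynomials of degree at most `R`. -/
noncomputable def trigSpan (R : ℝ) : Submodule ℂ C(Torus2, ℂ) :=
  Submodule.span ℂ (mFourier '' (freqBall R : Set Freq))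

theorem mul_mem_trigSpan {R R' : ℝ} {f g : C(Torus2, ℂ)} (hf : f ∈ trigSpan R)
    (hg : g ∈ trigSpan R') : f * g ∈ trigSpan (R + R') := by
  have h := Submodule.mul_mem_mul hf hg
  rw [trigSpan, trigSpan, Submodule.span_mul_span] at h
  refine Submodule.span_mono ?_ h
  rintro _ ⟨_, ⟨m, hm, rfl⟩, _, ⟨n, hn, rfl⟩, rfl⟩
  refine ⟨m + n, ?_, ?_⟩
  · simp only [Finset.mem_coe, mem_freqBall] at hm hn ⊢
    exact (Freq.len_add_le m n).trans (add_le_add hm hn)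
  · ext x
    simp [mFourier_add_apply]

theorem pow_mem_trigSpan {R : ℝ} {f : C(Torus2, ℂ)} (hf : f ∈ trigSpan R) (p : ℕ) :
    f ^ p ∈ trigSpan (p * R) := by
  induction p with
  | zero =>
    rw [pow_zero, ← mFourier_zero]
    refine Submodule.subset_span ⟨0, ?_, rfl⟩
    simp [mem_freqBall, Freq.len_zero]
  | succ p ih =>
    rw [pow_succ]
    have := mul_mem_trigSpan ih hf
    rwa [show (p : ℝ) * R + R = ((p + 1 : ℕ) : ℝ) * R by push_cast; ring] at this

/-- Cauchy–Schwarz on the coefficients followed by Parseval; the constant is the number of available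
frequencies. -/
theorem enorm_sq_le_of_mem_trigSpan {R : ℝ} {f : C(Torus2, ℂ)} (hf : f ∈ trigSpan R)
    (x : Torus2) :
    ‖f x‖ₑ ^ 2 ≤ (freqBall R).card * ∫⁻ y, ‖f y‖ₑ ^ 2 ∂torusMeasure := by
  classical
  obtain ⟨c, hc⟩ := (Submodule.mem_span_image_finset_iff_exists_fun ℂ).1 hf
  have hfx : ∀ y, f y = ∑ n ∈ (freqBall R).attach, c n * mFourier (n : Freq) y := fun y => by
    rw [← hc]
    simp [ContinuousMap.sum_apply]
  have h1 : ‖f x‖ ^ 2 ≤ (freqBall R).card * ∑ n ∈ (freqBall R).attach, ‖c n‖ ^ 2 := by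
    have h2 : ‖f x‖ ≤ ∑ n ∈ (freqBall R).attach, ‖c n‖ := by
      rw [hfx]
      refine (norm_sum_le _ _).trans (le_of_eq ?_)
      simp [norm_mFourier_apply]
    rw [← Finset.card_attach]
    exact (pow_le_pow_left₀ (norm_nonneg _) h2 2).trans (sq_sum_le_card_mul_sum_sq)
  have h3 := integral_normSq_sum_mFourier (freqBall R).attach Subtype.val
    Subtype.val_injective.injOn c
  simp only [← hfx] at h3
  rw [← h3] at h1
  have h4 : ∫⁻ y, ‖f y‖ₑ ^ 2 ∂torusMeasure
      = ENNReal.ofReal (∫ y, ‖f y‖ ^ 2 ∂torusMeasure) := by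
    rw [ofReal_integral_eq_lintegral_ofReal (Continuous.integrable_torus (by fun_prop))
      (Eventually.of_forall fun y => by positivity)]
    refine lintegral_congr fun y => ?_
    rw [ENNReal.ofReal_pow (norm_nonneg _), ofReal_norm]
  rw [h4, ← ofReal_norm, ← ENNReal.ofReal_pow (norm_nonneg _), ← ENNReal.ofReal_natCast,
    ← ENNReal.ofReal_mul (by positivity)]
  exact ENNReal.ofReal_le_ofReal h1

/-- A Bernstein (Nikolskii) inequality: the supremum of a trigonometric polynomial is controlled by
its `L^{2p}` norm. -/
theorem supENorm_trigPoly_pow_le {R : ℝ} {S : Finset Freq} (hS : ∀ n ∈ S, n.len ≤ R)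
    (w : Freq → ℂ) {p : ℕ} (hp : p ≠ 0) :
    supENorm (trigPoly S w) ^ (2 * p)
      ≤ (freqBall (p * R)).card * ∫⁻ y, ‖trigPoly S w y‖ₑ ^ (2 * p) ∂torusMeasure := by
  set f : C(Torus2, ℂ) := ⟨trigPoly S w, continuous_trigPoly S w⟩ with hf
  have hmem : f ∈ trigSpan R := by
    have : f = ∑ n ∈ S, w n • (mFourier n : C(Torus2, ℂ)) := by
      ext x
      simp [hf, trigPoly, ContinuousMap.sum_apply]
    rw [this]
    refine Submodule.sum_mem _ fun n hn => Submodule.smul_mem _ _ (Submodule.subset_span ⟨n, ?_, rfl⟩)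
    simpa [mem_freqBall] using hS n hn
  have key : ∀ x, ‖trigPoly S w x‖ₑ ^ (2 * p)
      ≤ (freqBall (p * R)).card * ∫⁻ y, ‖trigPoly S w y‖ₑ ^ (2 * p) ∂torusMeasure := fun x => by
    -- The power `f ^ p` has degree at most `p * R`, so the passage from L² to the supremum for `f ^
    -- p` is the passage from L^{2p} for `f`.
    have h := enorm_sq_le_of_mem_trigSpan (pow_mem_trigSpan hmem p) x
    simp only [ContinuousMap.pow_apply, enorm_pow, ← pow_mul, mul_comm p 2] at h
    exact h
  have h2p : (0 : ℝ) < ((2 * p : ℕ) : ℝ) := by positivity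
  rw [← ENNReal.rpow_natCast, ← ENNReal.le_rpow_inv_iff h2p]
  refine iSup_le fun x => (ENNReal.le_rpow_inv_iff h2p).2 ?_
  rw [ENNReal.rpow_natCast]
  exact key x

/-! ### Moments of quadratic functionals of Gaussian vectors -/

theorem ENNReal.add_pow_le_two_pow_mul (a b : ℝ≥0∞) (n : ℕ) :
    (a + b) ^ n ≤ 2 ^ n * (a ^ n + b ^ n) := by
  have h : a + b ≤ 2 * max a b := by
    rw [two_mul]
    exact add_le_add (le_max_left a b) (le_max_right a b)
  refine (pow_le_pow_left' h n).trans ?_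
  rw [mul_pow]
  gcongr
  rcases max_choice a b with h | h <;> rw [h]
  · exact le_self_add
  · exact le_add_self

/-- The moment of order `2p` of the standard Gaussian law. -/
noncomputable def gaussianMoment (p : ℕ) : ℝ≥0∞ := ∫⁻ x, ‖x‖ₑ ^ (2 * p) ∂gaussianReal 0 1

theorem gaussianMoment_lt_top (p : ℕ) : gaussianMoment p < ∞ := by
  have h := (memLp_id_gaussianReal' (μ := 0) (v := 1) ((2 * p : ℕ) : ℝ≥0∞)
    (ENNReal.natCast_ne_top _)).integrable_norm_pow'
  have h2 := h.2
  rw [hasFiniteIntegral_iff_enorm] at h2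
  simpa [gaussianMoment, enorm_pow] using h2

theorem lintegral_pow_gaussianReal (p : ℕ) (v : NNReal) :
    ∫⁻ x, ‖x‖ₑ ^ (2 * p) ∂gaussianReal 0 v = gaussianMoment p * (v : ℝ≥0∞) ^ p := by
  have h := gaussianReal_map_const_mul (μ := 0) (v := 1) (Real.sqrt v)
  have h2 : (NNReal.mk (Real.sqrt v ^ 2) (sq_nonneg _) : NNReal) * 1 = v := by
    ext
    simp
  rw [mul_zero, h2] at h
  rw [← h, lintegral_map (by fun_prop) (by fun_prop)]
  simp only [enorm_mul, mul_pow]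
  rw [lintegral_const_mul _ (by fun_prop), mul_comm, gaussianMoment, pow_mul ‖√(v : ℝ)‖ₑ,
    ← enorm_pow, Real.sq_sqrt (NNReal.coe_nonneg v)]
  simp

section Chaos

variable {ι : Type*} [Fintype ι]

/-- A law on `ℂ^ι` all of whose real linear functionals are centred Gaussian variables with a
variance not exceeding that of the white noise. -/
def GaussianDominated (μ : Measure (ι → ℂ)) : Prop :=
  ∀ w : ι → ℂ, ∃ v : NNReal, (v : ℝ) ≤ ∑ i, ‖w i‖ ^ 2 ∧
    μ.map (fun z => (∑ i, w i * z i).re) = gaussianReal 0 v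

/-- With w_i = L(e_i) - i L(i e_i). Gaussianity is tested on real functionals because the
coordinates satisfy conjugation relations, so that no complex Gaussian structure is available. -/
theorem exists_eq_re_sum_mul [DecidableEq ι] (L : (ι → ℂ) →L[ℝ] ℝ) :
    ∃ w : ι → ℂ, ∀ z, L z = (∑ i, w i * z i).re := by
  refine ⟨fun i => (L (Pi.single i 1) : ℂ) - (L (Pi.single i Complex.I) : ℂ) * Complex.I,
    fun z => ?_⟩
  have hz : z = ∑ i, ((z i).re • (Pi.single i (1 : ℂ) : ι → ℂ)
      + (z i).im • (Pi.single i Complex.I : ι → ℂ)) := by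
    ext j
    rw [Finset.sum_apply, Finset.sum_eq_single j]
    · simp
    · intro i _ hij
      simp [Pi.single_eq_of_ne hij.symm]
    · simp
  conv_lhs => rw [hz]
  simp only [map_sum, map_add, map_smul, Complex.re_sum, smul_eq_mul]
  refine Finset.sum_congr rfl fun i _ => ?_
  simp
  ring

variable {μ : Measure (ι → ℂ)}

theorem GaussianDominated.isGaussian (hμ : GaussianDominated μ) : IsGaussian μ := by
  classical
  refine isGaussian_of_map_eq_gaussianReal fun L => ?_
  obtain ⟨w, hw⟩ := exists_eq_re_sum_mul L
  obtain ⟨v, -, hv⟩ := hμ w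
  exact ⟨0, v, by rw [← hv]; congr 1; ext z; exact hw z⟩

/-- A pair of independent copies of a centred Gaussian vector is invariant under rotations; the
assumption on all real functionals supplies both Gaussianity and centring. -/
theorem GaussianDominated.map_rotation (hμ : GaussianDominated μ) (θ : ℝ) :
    (μ.prod μ).map (ContinuousLinearMap.rotation θ) = μ.prod μ := by
  classical
  have := hμ.isGaussian
  refine IsGaussian.map_rotation_eq_self_of_forall_strongDual_eq_zero (fun L => ?_) θ
  obtain ⟨w, hw⟩ := exists_eq_re_sum_mul L
  obtain ⟨v, -, hv⟩ := hμ w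
  have h1 : ∫ x, x ∂(μ.map L) = ∫ z, L z ∂μ := integral_map (by fun_prop) (by fun_prop)
  have h2 : μ.map L = gaussianReal 0 v := by
    rw [← hv]
    congr 1
    ext z
    exact hw z
  rw [← h1, h2, integral_id_gaussianReal]

/-- Real and imaginary parts are each Gaussian, the imaginary part being the real part for the
weights `-I * w`. The two parts and the inequality (x + y)^{2p} ≤ 2^{2p} (x^{2p} + y^{2p}) account
for the factor 2^{2p+1}. -/
theorem GaussianDominated.lintegral_linear_le (hμ : GaussianDominated μ) (w : ι → ℂ) (p : ℕ) :
    ∫⁻ z, ‖∑ i, w i * z i‖ₑ ^ (2 * p) ∂μ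
      ≤ 2 ^ (2 * p + 1) * gaussianMoment p * (∑ i, ‖w i‖ₑ ^ 2) ^ p := by
  have key : ∀ w : ι → ℂ, ∫⁻ z, ‖(∑ i, w i * z i).re‖ₑ ^ (2 * p) ∂μ
      ≤ gaussianMoment p * (∑ i, ‖w i‖ₑ ^ 2) ^ p := fun w => by
    obtain ⟨v, hv, hv'⟩ := hμ w
    have h1 : ∫⁻ x, ‖x‖ₑ ^ (2 * p) ∂(μ.map (fun z => (∑ i, w i * z i).re))
        = ∫⁻ z, ‖(∑ i, w i * z i).re‖ₑ ^ (2 * p) ∂μ :=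
      lintegral_map (by fun_prop) (by fun_prop)
    rw [← h1, hv', lintegral_pow_gaussianReal]
    gcongr
    have h2 : ∑ i, ‖w i‖ₑ ^ 2 = ENNReal.ofReal (∑ i, ‖w i‖ ^ 2) := by
      rw [ENNReal.ofReal_sum_of_nonneg fun i _ => by positivity]
      refine Finset.sum_congr rfl fun i _ => ?_
      rw [ENNReal.ofReal_pow (norm_nonneg _), ofReal_norm]
    rw [h2, ← ENNReal.ofReal_coe_nnreal]
    exact ENNReal.ofReal_le_ofReal hv
  have him : ∀ z : ι → ℂ, (∑ i, w i * z i).im = (∑ i, (-Complex.I * w i) * z i).re := fun z => by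
    simp only [mul_assoc, ← Finset.mul_sum]
    simp
  have hle : ∀ c : ℂ, ‖c‖ₑ ^ (2 * p) ≤ 2 ^ (2 * p) * (‖c.re‖ₑ ^ (2 * p) + ‖c.im‖ₑ ^ (2 * p)) :=
    fun c => by
      refine le_trans (pow_le_pow_left' ?_ _) (ENNReal.add_pow_le_two_pow_mul _ _ _)
      rw [← ofReal_norm, ← ofReal_norm, ← ofReal_norm, ← ENNReal.ofReal_add (norm_nonneg _)
        (norm_nonneg _)]
      exact ENNReal.ofReal_le_ofReal (Complex.norm_le_abs_re_add_abs_im c)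
  calc ∫⁻ z, ‖∑ i, w i * z i‖ₑ ^ (2 * p) ∂μ
      ≤ ∫⁻ z, 2 ^ (2 * p) * (‖(∑ i, w i * z i).re‖ₑ ^ (2 * p)
          + ‖(∑ i, (-Complex.I * w i) * z i).re‖ₑ ^ (2 * p)) ∂μ :=
        lintegral_mono fun z => by
          rw [← him]
          exact hle _
    _ = 2 ^ (2 * p) * (∫⁻ z, ‖(∑ i, w i * z i).re‖ₑ ^ (2 * p) ∂μ
          + ∫⁻ z, ‖(∑ i, (-Complex.I * w i) * z i).re‖ₑ ^ (2 * p) ∂μ) := by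
        rw [lintegral_const_mul _ (by fun_prop), lintegral_add_left (by fun_prop)]
    _ ≤ 2 ^ (2 * p) * (gaussianMoment p * (∑ i, ‖w i‖ₑ ^ 2) ^ p
          + gaussianMoment p * (∑ i, ‖w i‖ₑ ^ 2) ^ p) := by
        gcongr
        · exact key w
        · refine (key _).trans (le_of_eq ?_)
          have hI : ‖Complex.I‖ₑ = 1 := by rw [← ofReal_norm]; simp
          simp [enorm_mul, hI]
    _ = 2 ^ (2 * p + 1) * gaussianMoment p * (∑ i, ‖w i‖ₑ ^ 2) ^ p := by ring

/-- Minkowski's inequality in L^p for the functions |f_j|². -/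
theorem lintegral_sum_sq_pow_le {Ω κ : Type*} [MeasurableSpace Ω] {P : Measure Ω} (S : Finset κ)
    {f : κ → Ω → ℂ} (hf : ∀ j ∈ S, AEStronglyMeasurable (f j) P) {p : ℕ} (hp : p ≠ 0) {C : ℝ≥0∞}
    {β : κ → ℝ≥0∞} (h : ∀ j ∈ S, ∫⁻ ω, ‖f j ω‖ₑ ^ (2 * p) ∂P ≤ C * β j ^ p) :
    ∫⁻ ω, (∑ j ∈ S, ‖f j ω‖ₑ ^ 2) ^ p ∂P ≤ C * (∑ j ∈ S, β j) ^ p := by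
  have hp' : (1 : ℝ≥0∞) ≤ (p : ℝ≥0∞) := by exact_mod_cast Nat.one_le_iff_ne_zero.2 hp
  have hp0 : (0 : ℝ) < p := by positivity
  have hL : ∀ F : Ω → ℝ, eLpNorm F p P = (∫⁻ ω, ‖F ω‖ₑ ^ p ∂P) ^ (p : ℝ)⁻¹ := fun F => by
    rw [eLpNorm_eq_lintegral_rpow_enorm_toReal (by simpa using hp) (ENNReal.natCast_ne_top _)]
    simp
  have h1 : eLpNorm (∑ j ∈ S, fun ω => ‖f j ω‖ ^ 2) p P
      ≤ ∑ j ∈ S, eLpNorm (fun ω => ‖f j ω‖ ^ 2) p P :=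
    eLpNorm_sum_le (fun j hj => (hf j hj).norm.pow 2) hp'
  have h2 : ∀ j ∈ S, eLpNorm (fun ω => ‖f j ω‖ ^ 2) p P ≤ C ^ (p : ℝ)⁻¹ * β j := fun j hj => by
    rw [hL]
    refine (ENNReal.rpow_le_rpow (z := (p : ℝ)⁻¹) (by
      simpa [enorm_pow, ← pow_mul] using h j hj) (by positivity)).trans ?_
    rw [ENNReal.mul_rpow_of_nonneg _ _ (by positivity), ← ENNReal.rpow_natCast, ← ENNReal.rpow_mul,
      mul_inv_cancel₀ hp0.ne', ENNReal.rpow_one]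
  have h3 := h1.trans (Finset.sum_le_sum h2)
  rw [hL, ← Finset.mul_sum] at h3
  have h4 := ENNReal.rpow_le_rpow (z := (p : ℝ)) h3 hp0.le
  rw [← ENNReal.rpow_mul, inv_mul_cancel₀ hp0.ne', ENNReal.rpow_one,
    ENNReal.mul_rpow_of_nonneg _ _ hp0.le, ← ENNReal.rpow_mul, inv_mul_cancel₀ hp0.ne',
    ENNReal.rpow_one, ENNReal.rpow_natCast] at h4
  refine le_trans (le_of_eq (lintegral_congr fun ω => ?_)) h4
  congr 1
  rw [Finset.sum_apply, Real.enorm_of_nonneg (Finset.sum_nonneg fun j _ => by positivity),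
    ENNReal.ofReal_sum_of_nonneg fun i _ => by positivity]
  refine Finset.sum_congr rfl fun i _ => ?_
  rw [ENNReal.ofReal_pow (norm_nonneg _), ofReal_norm]

/-- For a frozen first variable the form is linear Gaussian in the second; its conditional variance
is a sum of squares of linear Gaussian functionals of the first, handled by Minkowski. Each variable
costs one factor 2^{2p+1} `gaussianMoment p`. -/
theorem GaussianDominated.lintegral_bilinear_le [IsProbabilityMeasure μ]
    (hμ : GaussianDominated μ) (b : ι → ι → ℂ)
    {p : ℕ} (hp : p ≠ 0) :
    ∫⁻ z, ‖∑ i, ∑ j, b i j * z.1 i * z.2 j‖ₑ ^ (2 * p) ∂(μ.prod μ)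
      ≤ (2 ^ (2 * p + 1) * gaussianMoment p) ^ 2 * (∑ i, ∑ j, ‖b i j‖ₑ ^ 2) ^ p := by
  set C : ℝ≥0∞ := 2 ^ (2 * p + 1) * gaussianMoment p with hC
  rw [lintegral_prod _ (by fun_prop)]
  have h1 : ∀ x : ι → ℂ, ∫⁻ y, ‖∑ i, ∑ j, b i j * x i * y j‖ₑ ^ (2 * p) ∂μ
      ≤ C * (∑ j, ‖∑ i, b i j * x i‖ₑ ^ 2) ^ p := fun x => by
    refine le_trans (le_of_eq (lintegral_congr fun y => ?_))
      (hμ.lintegral_linear_le (fun j => ∑ i, b i j * x i) p)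
    rw [Finset.sum_comm]
    simp only [Finset.sum_mul]
  refine (lintegral_mono h1).trans ?_
  rw [lintegral_const_mul _ (by fun_prop), Finset.sum_comm (f := fun i j => ‖b i j‖ₑ ^ 2)]
  have h2 : ∫⁻ x : ι → ℂ, (∑ j, ‖∑ i, b i j * x i‖ₑ ^ 2) ^ p ∂μ
      ≤ C * (∑ j, ∑ i, ‖b i j‖ₑ ^ 2) ^ p :=
    lintegral_sum_sq_pow_le Finset.univ (fun j _ => Measurable.aestronglyMeasurable (by fun_prop)) hp
      fun j _ => hμ.lintegral_linear_le (fun i => b i j) p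
  refine (mul_le_mul_right h2 C).trans (le_of_eq ?_)
  rw [sq, mul_assoc C C]

/-- Jensen's inequality with an independent copy: f - E f is the average of f(ω) - f(ω') over ω'. -/
theorem lintegral_enorm_sub_integral_pow_le {Ω : Type*} [MeasurableSpace Ω] {P : Measure Ω}
    [IsProbabilityMeasure P] {f : Ω → ℂ} (hf : Integrable f P) (hf' : Measurable f) {n : ℕ}
    (hn : n ≠ 0) :
    ∫⁻ ω, ‖f ω - ∫ ω', f ω' ∂P‖ₑ ^ n ∂P ≤ ∫⁻ z, ‖f z.1 - f z.2‖ₑ ^ n ∂(P.prod P) := by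
  rw [lintegral_prod _ (by fun_prop)]
  refine lintegral_mono fun ω => ?_
  have h1 : f ω - ∫ ω', f ω' ∂P = ∫ ω', (f ω - f ω') ∂P := by
    rw [integral_sub (integrable_const _) hf]
    simp
  have hn' : (0 : ℝ) < n := by positivity
  have h2 : ∫⁻ ω', ‖f ω - f ω'‖ₑ ∂P ≤ (∫⁻ ω', ‖f ω - f ω'‖ₑ ^ n ∂P) ^ (n : ℝ)⁻¹ := by
    have := eLpNorm_le_eLpNorm_of_exponent_le (p := 1) (q := n) (μ := P)
      (f := fun ω' => f ω - f ω') (by exact_mod_cast Nat.one_le_iff_ne_zero.2 hn)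
      (by fun_prop)
    rw [eLpNorm_one_eq_lintegral_enorm,
      eLpNorm_eq_lintegral_rpow_enorm_toReal (by simpa using hn) (ENNReal.natCast_ne_top _)] at this
    simpa using this
  have h3 := (enorm_integral_le_lintegral_enorm (μ := P) fun ω' => f ω - f ω').trans h2
  rw [← h1, ENNReal.le_rpow_inv_iff hn', ENNReal.rpow_natCast] at h3
  exact h3

theorem GaussianDominated.integrable_mul (hμ : GaussianDominated μ) (i j : ι) :
    Integrable (fun z : ι → ℂ => z i * z j) μ := by
  have := hμ.isGaussian
  have h : ∀ i, MemLp (fun z : ι → ℂ => z i) 2 μ := fun i => by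
    have h2 := (ContinuousLinearMap.proj (R := ℝ) (φ := fun _ : ι => ℂ) i).comp_memLp'
      (IsGaussian.memLp_two_id (μ := μ))
    exact h2
  exact (h i).integrable_mul (h j)

/-- Moments of the second Gaussian chaos are controlled by its variance. The proof decouples the
quadratic functional by means of the rotation invariance of the product measure. -/
theorem GaussianDominated.lintegral_quadratic_le [IsProbabilityMeasure μ]
    (hμ : GaussianDominated μ) (b : ι → ι → ℂ)
    {p : ℕ} (hp : p ≠ 0) :
    ∫⁻ z, ‖∑ i, ∑ j, b i j * (z i * z j - ∫ y, y i * y j ∂μ)‖ₑ ^ (2 * p) ∂μ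
      ≤ 2 ^ (2 * p + 1) * (2 ^ (2 * p + 1) * gaussianMoment p) ^ 2
        * (∑ i, ∑ j, ‖b i j‖ₑ ^ 2) ^ p := by
  set Q : (ι → ℂ) → ℂ := fun z => ∑ i, ∑ j, b i j * (z i * z j) with hQ
  set B : (ι → ℂ) → (ι → ℂ) → ℂ := fun x y => ∑ i, ∑ j, b i j * x i * y j with hB
  have hint : ∀ i j, Integrable (fun z : ι → ℂ => b i j * (z i * z j)) μ :=
    fun i j => (hμ.integrable_mul i j).const_mul _
  have hQi : Integrable Q μ := integrable_finsetSum _ fun i _ => integrable_finsetSum _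
    fun j _ => hint i j
  have hQm : Measurable Q := by fun_prop
  have h1 : ∀ z, ∑ i, ∑ j, b i j * (z i * z j - ∫ y, y i * y j ∂μ) = Q z - ∫ y, Q y ∂μ := by
    intro z
    simp only [hQ]
    rw [integral_finsetSum _ fun i _ => integrable_finsetSum _ fun j _ => hint i j]
    simp only [integral_finsetSum _ fun j _ => hint _ j, integral_const_mul, mul_sub,
      Finset.sum_sub_distrib]
  simp only [h1]
  refine (lintegral_enorm_sub_integral_pow_le hQi hQm (by positivity)).trans ?_
  rw [← hμ.map_rotation (Real.pi / 4), lintegral_map (by fun_prop) (by fun_prop)]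
  -- Polarisation: Q((x+y)/√2) - Q((y-x)/√2) contains only cross terms, so the symmetrised quadratic
  -- form has the law of a decoupled bilinear form.
  have h2 : ∀ z : (ι → ℂ) × (ι → ℂ), Q (ContinuousLinearMap.rotation (Real.pi / 4) z).1
      - Q (ContinuousLinearMap.rotation (Real.pi / 4) z).2 = B z.1 z.2 + B z.2 z.1 := fun z => by
    simp only [hQ, hB, ContinuousLinearMap.rotation_apply, Real.cos_pi_div_four,
      Real.sin_pi_div_four, ← Finset.sum_sub_distrib, ← Finset.sum_add_distrib]
    refine Finset.sum_congr rfl fun i _ => Finset.sum_congr rfl fun j _ => ?_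
    have h3 : ((Real.sqrt 2 / 2 : ℝ) : ℂ) * ((Real.sqrt 2 / 2 : ℝ) : ℂ) = 1 / 2 := by
      rw [← Complex.ofReal_mul, div_mul_div_comm, Real.mul_self_sqrt (by norm_num)]
      norm_num
    simp only [Pi.add_apply, Pi.smul_apply, Complex.real_smul, neg_smul, Pi.neg_apply]
    linear_combination (2 * b i j * (z.1 i * z.2 j + z.2 i * z.1 j)) * h3
  simp only [h2]
  have h4 : ∫⁻ z, ‖B z.2 z.1‖ₑ ^ (2 * p) ∂(μ.prod μ)
      ≤ (2 ^ (2 * p + 1) * gaussianMoment p) ^ 2 * (∑ i, ∑ j, ‖b i j‖ₑ ^ 2) ^ p := by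
    rw [Finset.sum_comm (f := fun i j => ‖b i j‖ₑ ^ 2)]
    refine le_trans (le_of_eq (lintegral_congr fun z => ?_))
      (hμ.lintegral_bilinear_le (fun i j => b j i) hp)
    congr 2
    simp only [hB]
    rw [Finset.sum_comm]
    refine Finset.sum_congr rfl fun i _ => Finset.sum_congr rfl fun j _ => ?_
    ring
  have h5 := hμ.lintegral_bilinear_le b hp
  calc ∫⁻ z, ‖B z.1 z.2 + B z.2 z.1‖ₑ ^ (2 * p) ∂(μ.prod μ)
      ≤ ∫⁻ z, 2 ^ (2 * p) * (‖B z.1 z.2‖ₑ ^ (2 * p) + ‖B z.2 z.1‖ₑ ^ (2 * p)) ∂(μ.prod μ) :=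
        lintegral_mono fun z => (pow_le_pow_left' (enorm_add_le _ _) _).trans
          (ENNReal.add_pow_le_two_pow_mul _ _ _)
    _ = 2 ^ (2 * p) * (∫⁻ z, ‖B z.1 z.2‖ₑ ^ (2 * p) ∂(μ.prod μ)
          + ∫⁻ z, ‖B z.2 z.1‖ₑ ^ (2 * p) ∂(μ.prod μ)) := by
        rw [lintegral_const_mul _ (by fun_prop), lintegral_add_left (by fun_prop)]
    _ ≤ 2 ^ (2 * p) * ((2 ^ (2 * p + 1) * gaussianMoment p) ^ 2 * (∑ i, ∑ j, ‖b i j‖ₑ ^ 2) ^ p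
          + (2 ^ (2 * p + 1) * gaussianMoment p) ^ 2 * (∑ i, ∑ j, ‖b i j‖ₑ ^ 2) ^ p) := by
        gcongr
    _ = _ := by ring

end Chaos

/-! ### Fourier coefficients of the white noise -/

/-- The real part splits each character into two conjugate halves; for a real distribution they
contribute conjugate numbers. The frequencies are `-κ i` because the pairing matches û(k) with the
coefficient of the test function at -k. -/
theorem pairing_re_eq {ι : Type*} (S : Finset ι) (κ : ι → Freq) (w : ι → ℂ)
    {u : TorusDistribution} (hu : u.IsReal) :
    (u.pairing (fun x => (∑ i ∈ S, w i * mFourier (-κ i) x).re)).re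
      = (∑ i ∈ S, w i * u.coeff (κ i)).re := by
  classical
  have h1 : ∀ x, (((∑ i ∈ S, w i * mFourier (-κ i) x).re : ℝ) : ℂ)
      = ∑ i ∈ S, (w i / 2 * mFourier (-κ i) x + conj (w i) / 2 * mFourier (κ i) x) := fun x => by
    rw [Complex.re_eq_add_conj, map_sum, ← Finset.sum_add_distrib, Finset.sum_div]
    refine Finset.sum_congr rfl fun i _ => ?_
    rw [map_mul, ← mFourier_neg_apply, neg_neg]
    ring
  have h2 : ∀ k, u.coeff k
      * mFourierCoeff (fun x => (((∑ i ∈ S, w i * mFourier (-κ i) x).re : ℝ) : ℂ)) (-k)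
      = ∑ i ∈ S, ((if k = κ i then w i / 2 * u.coeff (κ i) else 0)
        + if k = -κ i then conj (w i) / 2 * u.coeff (-κ i) else 0) := fun k => by
    simp only [h1]
    rw [mFourierCoeff_sum S (fun i _ => by fun_prop), Finset.mul_sum]
    refine Finset.sum_congr rfl fun i _ => ?_
    rw [mFourierCoeff_add (by fun_prop) (by fun_prop), mFourierCoeff_const_mul,
      mFourierCoeff_const_mul, mFourierCoeff_mFourier, mFourierCoeff_mFourier, mul_add]
    congr 1
    · by_cases h : k = κ i
      · simp [h, mul_comm]
      · simp [h]
    · by_cases h : k = -κ i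
      · simp [h, mul_comm]
      · simp [h, neg_eq_iff_eq_neg]
  have h3 : HasSum (fun k => u.coeff k
      * mFourierCoeff (fun x => (((∑ i ∈ S, w i * mFourier (-κ i) x).re : ℝ) : ℂ)) (-k))
      (∑ i ∈ S, (w i / 2 * u.coeff (κ i) + conj (w i) / 2 * u.coeff (-κ i))) := by
    simp only [h2]
    exact hasSum_sum fun i _ => (hasSum_ite_eq _ _).add (hasSum_ite_eq _ _)
  rw [TorusDistribution.pairing, h3.tsum_eq, Complex.re_sum, Complex.re_sum]
  refine Finset.sum_congr rfl fun i _ => ?_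
  rw [hu (κ i), show conj (w i) / 2 * conj (u.coeff (κ i)) = conj (w i / 2 * u.coeff (κ i)) by
      rw [map_mul, map_div₀, map_ofNat],
    Complex.add_re, Complex.conj_re, show w i / 2 * u.coeff (κ i)
      = ((1 / 2 : ℝ) : ℂ) * (w i * u.coeff (κ i)) by push_cast; ring, Complex.re_ofReal_mul]
  ring

theorem smoothOnTorus_re_sum_mFourier {ι : Type*} (S : Finset ι) (κ : ι → Freq) (w : ι → ℂ) :
    SmoothOnTorus (fun x => (∑ i ∈ S, w i * mFourier (κ i) x).re) := by
  unfold SmoothOnTorus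
  exact Complex.reCLM.contDiff.comp
    (ContDiff.sum fun i _ => contDiff_const.mul (contDiff_mFourier_lift (κ i)))

/-- Polarisation: E[AB] is a universal expression in the second moments of the real variables Re(wA
+ zB), with w, z in {0, 1, -i}. Two pairs with the same second moments therefore have the same
E[AB], which transfers the covariance from characters to the noise without computing any of these
moments. -/
theorem integral_mul_eq_of_quadratic {Ω : Type*} [MeasurableSpace Ω] {P : Measure Ω} {A B : Ω → ℂ}
    (hA : MemLp A 2 P) (hB : MemLp B 2 P) {m : ℂ → ℂ → ℝ}
    (hm : ∀ w z : ℂ, ∫ ω, ((w * A ω + z * B ω).re) ^ 2 ∂P = m w z) :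
    ∫ ω, A ω * B ω ∂P = ((1 / 2 * (m 1 1 - m 1 0 - m 0 1)
      - 1 / 2 * (m (-Complex.I) (-Complex.I) - m (-Complex.I) 0 - m 0 (-Complex.I)) : ℝ) : ℂ)
      + Complex.I * ((1 / 2 * (m 1 (-Complex.I) - m 1 0 - m 0 (-Complex.I))
      + 1 / 2 * (m (-Complex.I) 1 - m (-Complex.I) 0 - m 0 1) : ℝ) : ℂ) := by
  set q : ℂ → ℂ → Ω → ℝ := fun w z ω => ((w * A ω + z * B ω).re) ^ 2 with hq
  have hi : ∀ w z, Integrable (q w z) P := fun w z =>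
    (((hA.const_mul w).add (hB.const_mul z)).re).integrable_sq
  have hm' : ∀ w z, ∫ ω, q w z ω ∂P = m w z := hm
  have hab : ∀ ω, A ω * B ω = ((1 / 2 * (q 1 1 ω - q 1 0 ω - q 0 1 ω)
      - 1 / 2 * (q (-Complex.I) (-Complex.I) ω - q (-Complex.I) 0 ω - q 0 (-Complex.I) ω) : ℝ) : ℂ)
      + Complex.I * ((1 / 2 * (q 1 (-Complex.I) ω - q 1 0 ω - q 0 (-Complex.I) ω)
      + 1 / 2 * (q (-Complex.I) 1 ω - q (-Complex.I) 0 ω - q 0 1 ω) : ℝ) : ℂ) := fun ω => by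
    have hq' : ∀ w z : ℂ, q w z ω = (w.re * (A ω).re - w.im * (A ω).im
        + (z.re * (B ω).re - z.im * (B ω).im)) ^ 2 := fun w z => by
      simp only [hq, Complex.add_re, Complex.mul_re]
    apply Complex.ext <;>
    · simp only [hq', Complex.add_re, Complex.mul_re, Complex.ofReal_re, Complex.ofReal_im,
        Complex.add_im, Complex.mul_im, Complex.I_re, Complex.I_im, Complex.one_re, Complex.one_im,
        Complex.zero_re, Complex.zero_im, Complex.neg_re, Complex.neg_im]
      ring
  have h3 : ∀ w z w₁ z₁ w₂ z₂, Integrable (fun ω => 1 / 2 * (q w z ω - q w₁ z₁ ω - q w₂ z₂ ω)) P :=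
    fun w z w₁ z₁ w₂ z₂ => (((hi w z).sub (hi w₁ z₁)).sub (hi w₂ z₂)).const_mul _
  have h4 : ∀ w z w₁ z₁ w₂ z₂, ∫ ω, 1 / 2 * (q w z ω - q w₁ z₁ ω - q w₂ z₂ ω) ∂P
      = 1 / 2 * (m w z - m w₁ z₁ - m w₂ z₂) := fun w z w₁ z₁ w₂ z₂ => by
    have h5 : Integrable (fun ω => q w z ω - q w₁ z₁ ω) P := (hi w z).sub (hi w₁ z₁)
    rw [integral_const_mul, integral_sub h5 (hi w₂ z₂),
      integral_sub (hi w z) (hi w₁ z₁), hm', hm', hm']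
  simp only [hab]
  rw [integral_add ((h3 _ _ _ _ _ _).sub (h3 _ _ _ _ _ _)).ofReal
    (((h3 _ _ _ _ _ _).add (h3 _ _ _ _ _ _)).ofReal.const_mul _), integral_const_mul,
    integral_complex_ofReal, integral_complex_ofReal,
    integral_sub (h3 _ _ _ _ _ _) (h3 _ _ _ _ _ _), integral_add (h3 _ _ _ _ _ _) (h3 _ _ _ _ _ _)]
  simp only [h4]

namespace IsWhiteNoise

variable {Ω : Type*} [MeasurableSpace Ω] {P : Measure Ω} {ξ : Ω → TorusDistribution}

theorem hasLaw_linear (hξ : IsWhiteNoise P ξ) {ι : Type*} (S : Finset ι) (κ : ι → Freq)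
    (w : ι → ℂ) :
    HasLaw (fun ω => (∑ i ∈ S, w i * (ξ ω).coeff (κ i)).re) (gaussianReal 0
      (∫ x, (∑ i ∈ S, w i * mFourier (-κ i) x).re ^ 2 ∂torusMeasure).toNNReal) P := by
  have h := hξ.law _ (smoothOnTorus_re_sum_mFourier S (fun i => -κ i) w)
  simpa only [pairing_re_eq S κ w (hξ.real _)] using h

theorem hasLaw_re (hξ : IsWhiteNoise P ξ) (k : Freq) (w : ℂ) :
    ∃ v, HasLaw (fun ω => (w * (ξ ω).coeff k).re) (gaussianReal 0 v) P := by
  have h := hξ.hasLaw_linear {()} (fun _ => k) (fun _ => w)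
  simp only [Finset.sum_singleton] at h
  exact ⟨_, h⟩

theorem memLp_two_coeff (hξ : IsWhiteNoise P ξ) (k : Freq) :
    MemLp (fun ω => (ξ ω).coeff k) 2 P := by
  have h : ∀ w : ℂ, MemLp (fun ω => (w * (ξ ω).coeff k).re) 2 P := fun w => by
    obtain ⟨v, hv⟩ := hξ.hasLaw_re k w
    have h2 := memLp_id_gaussianReal' (μ := 0) (v := v) 2 (by simp)
    rw [← hv.map_eq, memLp_map_measure_iff (by fun_prop) hv.aemeasurable] at h2
    exact h2
  have h3 := (Complex.ofRealCLM.comp_memLp' (h 1)).add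
    ((Complex.ofRealCLM.comp_memLp' (h (-Complex.I))).const_mul Complex.I)
  refine (memLp_congr_ae (Eventually.of_forall fun ω => ?_)).1 h3
  apply Complex.ext <;> simp

theorem integral_coeff_mul_coeff (hξ : IsWhiteNoise P ξ) (k l : Freq) :
    ∫ ω, (ξ ω).coeff k * (ξ ω).coeff l ∂P = if k + l = 0 then 1 else 0 := by
  have hT : ∀ k : Freq, MemLp (fun x : Torus2 => mFourier k x) 2 torusMeasure := fun k =>
    MemLp.of_bound (by fun_prop) 1 (Eventually.of_forall fun x => (norm_mFourier_apply k x).le)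
  -- The law of the noise says that Re(w ξ̂(k) + z ξ̂(l)) has the second moment of Re(w e_{-k} + z
  -- e_{-l}) on the torus. Hence E[ξ̂(k) ξ̂(l)] = ∫ e_{-k} e_{-l}.
  have h1 := integral_mul_eq_of_quadratic (hT (-k)) (hT (-l)) (fun w z => rfl)
  have h2 := integral_mul_eq_of_quadratic (hξ.memLp_two_coeff k) (hξ.memLp_two_coeff l)
    (m := fun w z => ∫ x, ((w * mFourier (-k) x + z * mFourier (-l) x).re) ^ 2 ∂torusMeasure)
    (fun w z => by
      have h := hξ.hasLaw_linear Finset.univ ![k, l] ![w, z]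
      simp only [Fin.sum_univ_two, Matrix.cons_val_zero, Matrix.cons_val_one] at h
      have h3 : ∫ y, y ^ 2 ∂(P.map fun ω => (w * (ξ ω).coeff k + z * (ξ ω).coeff l).re)
          = ∫ ω, ((w * (ξ ω).coeff k + z * (ξ ω).coeff l).re) ^ 2 ∂P :=
        integral_map h.aemeasurable (by fun_prop)
      have h4 : ∀ v, ∫ y, y ^ 2 ∂gaussianReal 0 v = v := fun v => by
        have h5 := variance_id_gaussianReal (μ := 0) (v := v)
        rw [variance_of_integral_eq_zero (by fun_prop) (by simp)] at h5
        exact h5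
      rw [← h3, h.map_eq, h4]
      exact Real.coe_toNNReal _ (integral_nonneg fun x => sq_nonneg _))
  rw [h2, ← h1]
  simp only [← mFourier_add_apply, integral_mFourier, ← neg_add, neg_eq_zero]

theorem aemeasurable_coeff (hξ : IsWhiteNoise P ξ) (k : Freq) :
    AEMeasurable (fun ω => (ξ ω).coeff k) P := (hξ.memLp_two_coeff k).1.aemeasurable

/-- The variance of a functional is the L² norm squared of the real part of a trigonometric
polynomial, which is at most that of the polynomial itself. Only this inequality holds in general,
since S may contain both k and -k. -/
theorem gaussianDominated (hξ : IsWhiteNoise P ξ) (S : Finset Freq) :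
    GaussianDominated (P.map fun ω (k : S) => (ξ ω).coeff k) := by
  intro w
  have h := hξ.hasLaw_linear Finset.univ (fun k : S => (k : Freq)) w
  have h2 := AEMeasurable.map_map_of_aemeasurable
    (g := fun z : S → ℂ => (∑ i, w i * z i).re)
    (Complex.measurable_re.comp (by fun_prop)).aemeasurable
    (aemeasurable_pi_lambda _ fun k : S => hξ.aemeasurable_coeff k)
  refine ⟨_, ?_, h2.trans h.map_eq⟩
  · rw [Real.coe_toNNReal _ (integral_nonneg fun x => sq_nonneg _),
      ← integral_normSq_sum_mFourier Finset.univ (fun k : S => -(k : Freq))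
        (fun i _ j _ hij => Subtype.ext (neg_injective hij)) w]
    refine integral_mono (Continuous.integrable_torus
      ((Complex.continuous_re.comp (by fun_prop)).pow 2))
      (Continuous.integrable_torus (by fun_prop)) fun x => ?_
    refine sq_le_sq.2 ?_
    rw [abs_norm]
    exact Complex.abs_re_le_norm _

/-- Moments of the second Wiener chaos. -/
theorem lintegral_chaos_le [IsProbabilityMeasure P] (hξ : IsWhiteNoise P ξ) (S : Finset Freq)
    (b : Freq → Freq → ℂ) {p : ℕ} (hp : p ≠ 0) :
    ∫⁻ ω, ‖∑ k ∈ S, ∑ l ∈ S, b k l * ((ξ ω).coeff k * (ξ ω).coeff l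
        - if k + l = 0 then 1 else 0)‖ₑ ^ (2 * p) ∂P
      ≤ 2 ^ (2 * p + 1) * (2 ^ (2 * p + 1) * gaussianMoment p) ^ 2
        * (∑ k ∈ S, ∑ l ∈ S, ‖b k l‖ₑ ^ 2) ^ p := by
  have hm : AEMeasurable (fun ω (k : S) => (ξ ω).coeff k) P :=
    aemeasurable_pi_lambda _ fun k => hξ.aemeasurable_coeff k
  have : IsProbabilityMeasure (P.map fun ω (k : S) => (ξ ω).coeff k) :=
    Measure.isProbabilityMeasure_map hm
  have h := (hξ.gaussianDominated S).lintegral_quadratic_le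
    (fun k l : S => b (k : Freq) (l : Freq)) hp
  have hcov : ∀ i j : S, ∫ y, y i * y j ∂(P.map fun ω (k : S) => (ξ ω).coeff k)
      = if (i : Freq) + j = 0 then 1 else 0 := fun i j => by
    rw [integral_map hm (by fun_prop)]
    exact hξ.integral_coeff_mul_coeff i j
  simp only [hcov] at h
  rw [lintegral_map' (by fun_prop) hm] at h
  have hs : ∀ {M : Type} [AddCommMonoid M] (F : Freq → Freq → M),
      ∑ k : S, ∑ l : S, F k l = ∑ k ∈ S, ∑ l ∈ S, F k l := fun F => by
    rw [← Finset.sum_coe_sort S fun k => ∑ l ∈ S, F k l]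
    exact Finset.sum_congr rfl fun k _ => Finset.sum_coe_sort S _
  rw [hs fun k l => ‖b k l‖ₑ ^ 2] at h
  refine le_trans (le_of_eq (lintegral_congr fun ω => ?_)) h
  rw [← hs]

end IsWhiteNoise

/-! ### Littlewood-Paley weights -/

namespace DyadicPartition

variable (D : DyadicPartition)

theorem exists_weight_support : ∃ c C : ℝ, 0 < c ∧ 0 < C ∧ ∀ (q : ℕ) (n : Freq),
    D.weight q n.vec ≠ 0 → c * 2 ^ q ≤ n.bracket ∧ n.bracket ≤ C * 2 ^ q := by
  obtain ⟨R, hR⟩ := D.chi_support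
  obtain ⟨R₁, R₂, hR₁, hR₂⟩ := D.rho_support
  -- The weight of index j + 1 lives at scale 2^j, whence R₁ / 2; the entry 1 serves the ball, where
  -- only ⟨n⟩ ≥ 1 is known.
  refine ⟨min 1 (R₁ / 2), 1 + |R| + |R₂|, by positivity, by positivity, fun q n hn => ?_⟩
  have hb := n.one_le_bracket
  cases q with
  | zero =>
    have h := hR _ hn
    rw [pow_zero, mul_one, mul_one]
    refine ⟨(min_le_left _ _).trans hb, ?_⟩
    have h' : n.len ≤ R := h
    rw [Freq.bracket]
    linarith [le_abs_self R, abs_nonneg R₂]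
  | succ j =>
    have h := hR₂ _ hn
    rw [norm_smul, norm_pow, norm_inv, Real.norm_ofNat, inv_pow] at h
    have h2 : (0 : ℝ) < 2 ^ j := by positivity
    have h2' : (1 : ℝ) ≤ 2 ^ j := one_le_pow₀ (by norm_num)
    have h3 : n.len ≤ 2 ^ j * R₂ := (inv_mul_le_iff₀ h2).1 h.2
    have h4 : 2 ^ j * R₁ ≤ n.len := (le_inv_mul_iff₀ h2).1 h.1
    constructor
    · calc min 1 (R₁ / 2) * 2 ^ (j + 1) ≤ R₁ / 2 * 2 ^ (j + 1) := by
            gcongr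
            exact min_le_right _ _
        _ = 2 ^ j * R₁ := by ring
        _ ≤ n.bracket := h4.trans (by unfold Freq.bracket; linarith)
    · have h5 : (2 : ℝ) ^ j * R₂ ≤ 2 ^ j * |R₂| := by
        gcongr
        exact le_abs_self _
      have h6 : (0 : ℝ) ≤ 2 ^ j * |R₂| := by positivity
      have h7 : (0 : ℝ) ≤ 2 ^ j * |R| := by positivity
      rw [pow_succ, Freq.bracket]
      nlinarith

theorem exists_weight_bound : ∃ M : ℝ, 0 ≤ M ∧ ∀ q x, |D.weight q x| ≤ M := by
  have key : ∀ f : EuclideanSpace ℝ (Fin 2) → ℝ, Continuous f →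
      (∃ R : ℝ, ∀ x, f x ≠ 0 → ‖x‖ ≤ R) → ∃ M, ∀ x, ‖f x‖ ≤ M := by
    rintro f hf ⟨R, hR⟩
    have hc : HasCompactSupport f := HasCompactSupport.intro (isCompact_closedBall 0 R)
      fun x hx => by
        by_contra h
        exact hx (by simpa using hR x h)
    exact hc.exists_bound_of_continuous hf
  obtain ⟨M₁, h₁⟩ := key D.chi D.chi_smooth.continuous D.chi_support
  obtain ⟨M₂, h₂⟩ := key D.rho D.rho_smooth.continuous (by
    obtain ⟨R₁, R₂, -, h⟩ := D.rho_support
    exact ⟨R₂, fun x hx => (h x hx).2⟩)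
  refine ⟨max M₁ M₂, le_max_of_le_left ((norm_nonneg _).trans (h₁ 0)), fun q x => ?_⟩
  cases q with
  | zero => exact le_max_of_le_left (h₁ x)
  | succ j => exact le_max_of_le_right (h₂ _)

theorem weight_mul_weight {i j : ℕ} (h : i + 2 ≤ j) (x : EuclideanSpace ℝ (Fin 2)) :
    D.weight i x * D.weight j x = 0 := by
  obtain ⟨j, rfl⟩ : ∃ j', j = j' + 1 := ⟨j - 1, by omega⟩
  cases i with
  | zero => exact D.chi_mul_rho j (by omega) x
  | succ i => exact D.rho_mul_rho i j (by omega) x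

/-- At i = 0 the truncated `i - 1` is 0, so the window is {0, 1}, as it should be. -/
theorem weight_eq_zero_of_notMem {i j : ℕ} {x : EuclideanSpace ℝ (Fin 2)} (hi : D.weight i x ≠ 0)
    (hj : j ∉ Finset.Icc (i - 1) (i + 1)) : D.weight j x = 0 := by
  rw [Finset.mem_Icc, not_and_or] at hj
  rcases le_or_gt (i + 2) j with h | h
  · exact (mul_eq_zero.1 (D.weight_mul_weight h x)).resolve_left hi
  · exact (mul_eq_zero.1 (D.weight_mul_weight (i := j) (j := i) (by omega) x)).resolve_right hi

theorem hasSum_weight (x : EuclideanSpace ℝ (Fin 2)) : HasSum (fun q => D.weight q x) 1 := by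
  have h := (hasSum_nat_add_iff (f := fun q => D.weight q x) 1).1 (D.sum_eq_one x)
  simpa [weight] using h

theorem exists_weight_ne_zero (x : EuclideanSpace ℝ (Fin 2)) : ∃ q, D.weight q x ≠ 0 := by
  by_contra! h
  have h1 := D.hasSum_weight x
  simp only [h] at h1
  exact zero_ne_one (hasSum_zero.unique h1)

theorem sum_weight_Icc {i : ℕ} {x : EuclideanSpace ℝ (Fin 2)} (hi : D.weight i x ≠ 0) :
    ∑ j ∈ Finset.Icc (i - 1) (i + 1), D.weight j x = 1 :=
  (hasSum_sum_of_ne_finset_zero fun _ hj => D.weight_eq_zero_of_notMem hi hj).unique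
    (D.hasSum_weight x)

theorem card_Icc_pred_succ_le (i : ℕ) : ((Finset.Icc (i - 1) (i + 1)).card : ℝ) ≤ 3 := by
  rw [Nat.card_Icc]
  exact_mod_cast (by omega : i + 1 + 1 - (i - 1) ≤ 3)

/-- At most three consecutive weights are non-zero and they sum to one. This allows a Fourier
coefficient to be read off from a single block. -/
theorem exists_third_le_weight (x : EuclideanSpace ℝ (Fin 2)) : ∃ q, 1 / 3 ≤ |D.weight q x| := by
  obtain ⟨i, hi⟩ := D.exists_weight_ne_zero x
  by_contra! h
  have h1 := D.sum_weight_Icc hi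
  have h2 : |∑ j ∈ Finset.Icc (i - 1) (i + 1), D.weight j x| < 1 :=
    calc |∑ j ∈ Finset.Icc (i - 1) (i + 1), D.weight j x|
        ≤ ∑ j ∈ Finset.Icc (i - 1) (i + 1), |D.weight j x| := Finset.abs_sum_le_sum_abs _ _
      _ < ∑ j ∈ Finset.Icc (i - 1) (i + 1), (1 / 3 : ℝ) :=
          Finset.sum_lt_sum_of_nonempty ⟨i, by simp⟩ fun j _ => h j
      _ ≤ 1 := by
          rw [Finset.sum_const, nsmul_eq_mul]
          linarith [card_Icc_pred_succ_le i]
  rw [h1, abs_one] at h2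
  exact lt_irrefl _ h2

/-- The symbol of the resonant product. -/
noncomputable def resonantWeight (m l : Freq) : ℝ :=
  ∑' i, D.weight i m.vec * ∑ j ∈ Finset.Icc (i - 1) (i + 1), D.weight j l.vec

theorem hasSum_resonantWeight (m l : Freq) :
    HasSum (fun i => D.weight i m.vec * ∑ j ∈ Finset.Icc (i - 1) (i + 1), D.weight j l.vec)
      (D.resonantWeight m l) := by
  obtain ⟨i, hi⟩ := D.exists_weight_ne_zero m.vec
  exact (summable_of_ne_finset_zero (s := Finset.Icc (i - 1) (i + 1)) fun j hj => by
    rw [D.weight_eq_zero_of_notMem hi hj, zero_mul]).hasSum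

theorem exists_resonantWeight_bound : ∃ M : ℝ, 0 ≤ M ∧ ∀ m l, |D.resonantWeight m l| ≤ M := by
  obtain ⟨M, hM, h⟩ := D.exists_weight_bound
  refine ⟨3 * (M * (3 * M)), by positivity, fun m l => ?_⟩
  obtain ⟨i, hi⟩ := D.exists_weight_ne_zero m.vec
  rw [resonantWeight, tsum_eq_sum (s := Finset.Icc (i - 1) (i + 1)) fun j hj => by
    rw [D.weight_eq_zero_of_notMem hi hj, zero_mul]]
  have key : ∀ (i : ℕ) (f : ℕ → ℝ) (B : ℝ), 0 ≤ B → (∀ j, |f j| ≤ B) →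
      |∑ j ∈ Finset.Icc (i - 1) (i + 1), f j| ≤ 3 * B := fun i f B hB hf => by
    refine (Finset.abs_sum_le_sum_abs _ _).trans ((Finset.sum_le_sum fun j _ => hf j).trans ?_)
    rw [Finset.sum_const, nsmul_eq_mul]
    exact mul_le_mul_of_nonneg_right (card_Icc_pred_succ_le i) hB
  refine key i _ _ (by positivity) fun j => ?_
  rw [abs_mul]
  exact mul_le_mul (h j _) (key j _ M hM fun j => h j _) (abs_nonneg _) hM

theorem exists_of_resonantWeight_ne_zero {m l : Freq} (h : D.resonantWeight m l ≠ 0) :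
    ∃ i, ∃ j ∈ Finset.Icc (i - 1) (i + 1), D.weight i m.vec ≠ 0 ∧ D.weight j l.vec ≠ 0 := by
  by_contra! h'
  refine h ((D.hasSum_resonantWeight m l).unique ?_)
  convert! hasSum_zero with i
  by_cases hi : D.weight i m.vec = 0
  · rw [hi, zero_mul]
  · rw [Finset.sum_eq_zero fun j hj => h' i j hj hi, mul_zero]

theorem weight_neg (q : ℕ) (n : Freq) : D.weight q (-n).vec = D.weight q n.vec := by
  cases q with
  | zero => exact D.chi_radial _ _ (by rw [Freq.vec_neg, norm_neg])
  | succ j => exact D.rho_radial _ _ (by rw [Freq.vec_neg, smul_neg, norm_neg])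

/-- The weights are even, so any pair of blocks that both see k and -k is resonant, and the double
sum collapses to the square of the partition of unity. The counterterm thus keeps the full weight of
every pair (k, -k). -/
theorem resonantWeight_neg_self (k : Freq) : D.resonantWeight k (-k) = 1 := by
  refine (D.hasSum_resonantWeight k (-k)).unique ?_
  convert! D.hasSum_weight k.vec using 2 with i
  simp only [weight_neg]
  by_cases hi : D.weight i k.vec = 0
  · rw [hi, zero_mul]
  · rw [D.sum_weight_Icc hi, mul_one]

theorem block_eq_sum_of_support (q : ℕ) {u : TorusDistribution} {A : Finset Freq}
    (hA : ∀ n ∉ A, u.coeff n = 0) (x : Torus2) :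
    D.block q u x = ∑ n ∈ A, (D.weight q n.vec : ℂ) * u.coeff n * mFourier n x :=
  tsum_eq_sum fun n hn => by rw [hA n hn, mul_zero, zero_mul]

theorem resonant_eq_sum {u v : TorusDistribution} {A B : Finset Freq}
    (hA : ∀ n ∉ A, u.coeff n = 0) (hB : ∀ n ∉ B, v.coeff n = 0) (x : Torus2) :
    D.resonant u v x = ∑ m ∈ A, ∑ l ∈ B,
      (D.resonantWeight m l : ℂ) * (u.coeff m * v.coeff l) * mFourier (m + l) x := by
  refine HasSum.tsum_eq ?_
  have h : ∀ i, ∑ j ∈ Finset.Icc (i - 1) (i + 1), D.block i u x * D.block j v x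
      = ∑ m ∈ A, ∑ l ∈ B,
        ((D.weight i m.vec * ∑ j ∈ Finset.Icc (i - 1) (i + 1), D.weight j l.vec : ℝ) : ℂ)
          * ((u.coeff m * v.coeff l) * mFourier (m + l) x) := fun i => by
    simp only [D.block_eq_sum_of_support _ hA, D.block_eq_sum_of_support _ hB,
      Finset.sum_mul_sum]
    rw [Finset.sum_comm]
    refine Finset.sum_congr rfl fun m _ => ?_
    rw [Finset.sum_comm]
    refine Finset.sum_congr rfl fun l _ => ?_
    push_cast
    rw [Finset.mul_sum, Finset.sum_mul]
    refine Finset.sum_congr rfl fun j _ => ?_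
    rw [mFourier_add_apply]
    ring
  simp only [h, mul_assoc]
  exact hasSum_sum fun m _ => hasSum_sum fun l _ =>
    ((Complex.hasSum_ofReal.2 (D.hasSum_resonantWeight m l)).mul_right _)

/-! ### Besov norms -/

theorem block_eq_trigPoly (q : ℕ) (u : TorusDistribution) : D.block q u
    = trigPoly (D.finite_weight q).toFinset (fun n => (D.weight q n.vec : ℂ) * u.coeff n) :=
  funext fun x => D.block_eq_sum q u x

theorem mFourierCoeff_block (q : ℕ) (u : TorusDistribution) (n : Freq) :
    mFourierCoeff (D.block q u) n = D.weight q n.vec * u.coeff n := by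
  rw [block_eq_trigPoly, mFourierCoeff_trigPoly]
  split_ifs with h
  · rfl
  · have : D.weight q n.vec = 0 := by simpa using h
    simp [this]

theorem enorm_mFourierCoeff_le (f : Torus2 → ℂ) (n : Freq) :
    ‖mFourierCoeff f n‖ₑ ≤ supENorm f := by
  rw [mFourierCoeff_eq]
  refine (enorm_integral_le_lintegral_enorm _).trans ?_
  calc ∫⁻ x, ‖mFourier (-n) x * f x‖ₑ ∂torusMeasure ≤ ∫⁻ _, supENorm f ∂torusMeasure :=
        lintegral_mono fun x => by
          rw [enorm_mul, ← ofReal_norm (mFourier (-n) x), norm_mFourier_apply, ENNReal.ofReal_one,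
            one_mul]
          exact le_iSup (fun x => ‖f x‖ₑ) x
    _ = supENorm f := by simp

theorem le_besovENorm (γ : ℝ) (q : ℕ) (u : TorusDistribution) :
    ENNReal.ofReal ((2 : ℝ) ^ (γ * ((q : ℝ) - 1))) * supENorm (D.block q u) ≤ D.besovENorm γ u :=
  le_iSup (fun q : ℕ => ENNReal.ofReal ((2 : ℝ) ^ (γ * ((q : ℝ) - 1))) * supENorm (D.block q u)) q

/-- Fourier coefficients are controlled by Besov norms. -/
theorem exists_enorm_coeff_le (γ : ℝ) : ∃ (K : ℝ) (N : ℕ), 0 ≤ K ∧ (γ = 0 → N = 0) ∧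
    ∀ (u : TorusDistribution) (n : Freq),
      ‖u.coeff n‖ₑ ≤ ENNReal.ofReal (K * n.bracket ^ N) * D.besovENorm γ u := by
  obtain ⟨c, C, hc, hC, hsupp⟩ := D.exists_weight_support
  -- The absolute value covers both signs of γ. For γ = 0 there is no loss in n, which the estimates
  -- on symbols use.
  set N := ⌈|γ|⌉₊ with hN
  have hγN : |γ| ≤ N := Nat.le_ceil _
  refine ⟨3 * (2 ^ |γ| * (1 + c⁻¹) ^ N), N, by positivity, fun h => by simp [hN, h], fun u n => ?_⟩
  obtain ⟨q, hq⟩ := D.exists_third_le_weight n.vec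
  have hw : D.weight q n.vec ≠ 0 := fun h => by
    rw [h, abs_zero] at hq
    norm_num at hq
  have hb := n.one_le_bracket
  have h2q : (2 : ℝ) ^ q ≤ (1 + c⁻¹) * n.bracket := by
    have := (hsupp q n hw).1
    have h3 : (2 : ℝ) ^ q ≤ c⁻¹ * n.bracket := (le_inv_mul_iff₀ hc).2 this
    linarith
  have h1 : (2 : ℝ) ^ (-(γ * ((q : ℝ) - 1))) ≤ 2 ^ |γ| * ((1 + c⁻¹) * n.bracket) ^ N := by
    calc (2 : ℝ) ^ (-(γ * ((q : ℝ) - 1))) ≤ 2 ^ (|γ| + q * |γ|) := by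
          refine Real.rpow_le_rpow_of_exponent_le (by norm_num) ?_
          have h5 : (0 : ℝ) ≤ q := by positivity
          nlinarith [neg_abs_le γ, le_abs_self γ]
      _ = 2 ^ |γ| * ((2 : ℝ) ^ q) ^ |γ| := by
          rw [Real.rpow_add (by norm_num), Real.rpow_mul (by norm_num), Real.rpow_natCast]
      _ ≤ 2 ^ |γ| * ((2 : ℝ) ^ q) ^ (N : ℝ) := by
          gcongr
          exact one_le_pow₀ (by norm_num)
      _ ≤ 2 ^ |γ| * ((1 + c⁻¹) * n.bracket) ^ N := by
          rw [Real.rpow_natCast]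
          gcongr
  have h2 : ‖u.coeff n‖ₑ ≤ 3 * supENorm (D.block q u) := by
    have h3 := enorm_mFourierCoeff_le (D.block q u) n
    rw [mFourierCoeff_block, enorm_mul] at h3
    have h4 : (1 : ℝ≥0∞) ≤ 3 * ‖(D.weight q n.vec : ℂ)‖ₑ := by
      rw [← ofReal_norm, Complex.norm_real, Real.norm_eq_abs,
        show (3 : ℝ≥0∞) = ENNReal.ofReal 3 by simp, ← ENNReal.ofReal_mul (by norm_num)]
      exact ENNReal.one_le_ofReal.2 (by linarith)
    calc ‖u.coeff n‖ₑ = 1 * ‖u.coeff n‖ₑ := (one_mul _).symm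
      _ ≤ 3 * ‖(D.weight q n.vec : ℂ)‖ₑ * ‖u.coeff n‖ₑ := by gcongr
      _ ≤ 3 * supENorm (D.block q u) := by
          rw [mul_assoc]
          gcongr
  have h3 : supENorm (D.block q u)
      ≤ ENNReal.ofReal ((2 : ℝ) ^ (-(γ * ((q : ℝ) - 1)))) * D.besovENorm γ u := by
    have h4 := mul_le_mul_right (D.le_besovENorm γ q u)
      (ENNReal.ofReal ((2 : ℝ) ^ (-(γ * ((q : ℝ) - 1)))))
    rwa [← mul_assoc, ← ENNReal.ofReal_mul (by positivity), ← Real.rpow_add (by norm_num),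
      neg_add_cancel, Real.rpow_zero, ENNReal.ofReal_one, one_mul] at h4
  calc ‖u.coeff n‖ₑ ≤ 3 * (ENNReal.ofReal ((2 : ℝ) ^ (-(γ * ((q : ℝ) - 1))))
        * D.besovENorm γ u) := h2.trans (by gcongr)
    _ = ENNReal.ofReal (3 * (2 : ℝ) ^ (-(γ * ((q : ℝ) - 1)))) * D.besovENorm γ u := by
        rw [ENNReal.ofReal_mul (by norm_num), mul_assoc]
        simp
    _ ≤ _ := by
        refine mul_le_mul_left (ENNReal.ofReal_le_ofReal ?_) _
        rw [mul_assoc 3, mul_assoc (2 ^ |γ|), ← mul_pow]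
        gcongr

theorem coeff_sub_apply (u v : TorusDistribution) (n : Freq) :
    (u - v).coeff n = u.coeff n - v.coeff n := rfl

theorem enorm_besovSpace {γ : ℝ} (u : D.BesovSpace γ) :
    ‖u‖ₑ = D.besovENorm γ u.toDistribution := by
  have hu : D.besovENorm γ u.toDistribution < ∞ := Subtype.property u
  rw [← ofReal_norm]
  exact ENNReal.ofReal_toReal hu.ne

/-- A distribution of finite `C^γ` norm as an element of `C^γ`. -/
def BesovSpace.mk {γ : ℝ} (u : TorusDistribution) (hu : D.besovENorm γ u < ∞) : D.BesovSpace γ :=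
  (⟨u, hu⟩ : D.besovSubmodule γ)

/-- The coefficients of a Cauchy sequence converge, with a uniform polynomial bound that makes the
limit a distribution. Lower semicontinuity of the norm then gives convergence in norm. Completeness
is what produces the limit in L^r. -/
instance (γ : ℝ) : CompleteSpace (D.BesovSpace γ) := by
  refine Metric.complete_of_cauchySeq_tendsto fun u hu => ?_
  obtain ⟨K, N, hK, -, hKN⟩ := D.exists_enorm_coeff_le γ
  have hcoeff : ∀ (v : D.BesovSpace γ) n,
      ‖v.toDistribution.coeff n‖ ≤ K * n.bracket ^ N * ‖v‖ := fun v n => by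
    have h := hKN v.toDistribution n
    have hb := n.bracket_pos
    rw [← enorm_besovSpace, ← ofReal_norm, ← ofReal_norm, ← ENNReal.ofReal_mul (by positivity)] at h
    exact (ENNReal.ofReal_le_ofReal_iff (by positivity)).1 h
  have hlim : ∀ n, ∃ z, Tendsto (fun j => (u j).toDistribution.coeff n) atTop (𝓝 z) := fun n => by
    refine cauchySeq_tendsto_of_complete (Metric.cauchySeq_iff'.2 fun ε hε => ?_)
    have hb := n.bracket_pos
    obtain ⟨J, hJ⟩ := Metric.cauchySeq_iff'.1 hu (ε / (K * n.bracket ^ N + 1)) (by positivity)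
    refine ⟨J, fun j hj => ?_⟩
    have h1 := hJ j hj
    rw [dist_eq_norm] at h1 ⊢
    calc _ ≤ K * n.bracket ^ N * ‖u j - u J‖ := hcoeff (u j - u J) n
      _ ≤ (K * n.bracket ^ N + 1) * ‖u j - u J‖ := by
          gcongr
          linarith
      _ < ε := by
          rw [lt_div_iff₀ (by positivity)] at h1
          linarith
  choose v hv using hlim
  obtain ⟨B, hB⟩ := hu.norm_bddAbove
  have hvs : SlowGrowth v := ⟨K * B, N, fun n => by
    refine le_of_tendsto (hv n).norm (Eventually.of_forall fun j => ?_)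
    refine (hcoeff (u j) n).trans ?_
    have hb := n.bracket_pos
    calc K * n.bracket ^ N * ‖u j‖ ≤ K * n.bracket ^ N * B := by
          gcongr
          exact hB ⟨j, rfl⟩
      _ = K * B * n.bracket ^ N := by ring⟩
  set V : TorusDistribution := ⟨v, hvs⟩ with hV
  have key : ∀ ε > 0, ∃ J, ∀ j ≥ J,
      D.besovENorm γ ((u j).toDistribution - V) ≤ ENNReal.ofReal ε := fun ε hε => by
    obtain ⟨J, hJ⟩ := Metric.cauchySeq_iff.1 hu ε hε
    refine ⟨J, fun j hj => iSup_le fun q => ?_⟩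
    rw [supENorm, ENNReal.mul_iSup]
    refine iSup_le fun x => ?_
    -- For fixed q and x the block is a finite sum of coefficients, so the Cauchy estimate survives
    -- the limit in i before the suprema are taken.
    have h1 : Tendsto (fun i => D.block q ((u j).toDistribution - (u i).toDistribution) x) atTop
        (𝓝 (D.block q ((u j).toDistribution - V) x)) := by
      simp only [block_eq_sum]
      refine tendsto_finsetSum _ fun n _ => Tendsto.mul_const _ (Tendsto.const_mul _ ?_)
      simp only [coeff_sub_apply]
      exact (hv n).const_sub _
    have h2 := ENNReal.Tendsto.const_mul (a := ENNReal.ofReal ((2 : ℝ) ^ (γ * ((q : ℝ) - 1))))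
      h1.enorm (Or.inr ENNReal.ofReal_ne_top)
    refine le_of_tendsto h2 (eventually_atTop.2 ⟨J, fun i hi => ?_⟩)
    have h3 := hJ j hj i hi
    rw [dist_eq_norm] at h3
    calc _ ≤ ENNReal.ofReal ((2 : ℝ) ^ (γ * ((q : ℝ) - 1)))
          * supENorm (D.block q ((u j).toDistribution - (u i).toDistribution)) := by
          gcongr
          exact le_iSup (fun x => ‖D.block q ((u j).toDistribution - (u i).toDistribution) x‖ₑ) x
      _ ≤ D.besovENorm γ (u j - u i).toDistribution := D.le_besovENorm γ q _
      _ = ENNReal.ofReal ‖u j - u i‖ := by rw [← enorm_besovSpace, ofReal_norm]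
      _ ≤ ENNReal.ofReal ε := ENNReal.ofReal_le_ofReal h3.le
  have hVmem : V ∈ D.besovSubmodule γ := by
    obtain ⟨J, hJ⟩ := key 1 one_pos
    have h1 : (u J).toDistribution - V ∈ D.besovSubmodule γ :=
      (hJ J le_rfl).trans_lt ENNReal.ofReal_lt_top
    have h2 := (D.besovSubmodule γ).sub_mem (Subtype.property (u J)) h1
    have h3 : (u J).toDistribution - ((u J).toDistribution - V) = V := sub_sub_cancel _ _
    rw [← h3]
    exact h2
  refine ⟨BesovSpace.mk D V hVmem, Metric.tendsto_atTop.2 fun ε hε => ?_⟩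
  obtain ⟨J, hJ⟩ := key (ε / 2) (by positivity)
  refine ⟨J, fun j hj => ?_⟩
  have h1 := hJ j hj
  have h2 : ‖u j - BesovSpace.mk D V hVmem‖ₑ ≤ ENNReal.ofReal (ε / 2) := by
    rw [enorm_besovSpace]
    exact h1
  rw [← ofReal_norm, ENNReal.ofReal_le_ofReal_iff (by positivity)] at h2
  rw [dist_eq_norm]
  exact h2.trans_lt (by linarith)

theorem besovENorm_lt_top_of_support (γ : ℝ) {u : TorusDistribution} {A : Finset Freq}
    (hA : ∀ n ∉ A, u.coeff n = 0) : D.besovENorm γ u < ∞ := by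
  obtain ⟨c, C, hc, -, hsupp⟩ := D.exists_weight_support
  obtain ⟨Q, hQ⟩ : ∃ Q : ℕ, ∀ q ≥ Q, D.block q u = 0 := by
    obtain ⟨Q, hQ⟩ : ∃ Q : ℕ, ∀ n ∈ A, n.bracket < c * 2 ^ Q := by
      obtain ⟨B, hB⟩ := (A.image Freq.bracket).exists_le
      obtain ⟨Q, hQ⟩ := pow_unbounded_of_one_lt (B / c) (one_lt_two : (1 : ℝ) < 2)
      refine ⟨Q, fun n hn => (hB _ (Finset.mem_image_of_mem _ hn)).trans_lt ?_⟩
      rw [div_lt_iff₀ hc] at hQ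
      linarith
    refine ⟨Q, fun q hq => funext fun x => ?_⟩
    rw [D.block_eq_sum_of_support q hA]
    refine Finset.sum_eq_zero fun n hn => ?_
    have : D.weight q n.vec = 0 := by
      by_contra h
      have h1 := (hsupp q n h).1
      have h2 : c * 2 ^ Q ≤ c * (2 : ℝ) ^ q := by
        gcongr
        norm_num
      linarith [hQ n hn]
    simp [this]
  have hb : ∀ q : ℕ, ENNReal.ofReal ((2 : ℝ) ^ (γ * ((q : ℝ) - 1))) * supENorm (D.block q u) < ∞ :=
    fun q => by
    refine ENNReal.mul_lt_top ENNReal.ofReal_lt_top ?_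
    obtain ⟨B, hB⟩ := (isCompact_univ (X := Torus2)).exists_bound_of_continuousOn
      (D.block_eq_trigPoly q u ▸ continuous_trigPoly _ _).continuousOn
    refine lt_of_le_of_lt (iSup_le fun x => ?_) (ENNReal.ofReal_lt_top (r := B))
    rw [← ofReal_norm]
    exact ENNReal.ofReal_le_ofReal (hB x trivial)
  refine lt_of_le_of_lt (iSup_le fun q => ?_) (ENNReal.sum_lt_top.2 fun q (_ : q ∈ Finset.range Q) => hb q)
  rcases lt_or_ge q Q with h | h
  · exact Finset.single_le_sum (f := fun q : ℕ =>
      ENNReal.ofReal ((2 : ℝ) ^ (γ * ((q : ℝ) - 1))) * supENorm (D.block q u))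
      (fun _ _ => zero_le) (Finset.mem_range.2 h)
  · rw [hQ q h, supENorm_zero, mul_zero]
    exact zero_le

end DyadicPartition

/-! ### Lattice sums -/

theorem summable_bracket_rpow {τ : ℝ} (hτ : 2 < τ) :
    Summable fun n : Freq => n.bracket ^ (-τ) := by
  have h1 := EisensteinSeries.summable_one_div_norm_rpow hτ
  have h2 : Summable fun n : Freq => if n = 0 then (1 : ℝ) else 0 :=
    summable_of_ne_finset_zero (s := {0}) fun n hn => if_neg (by simpa using hn)
  refine (h1.add h2).of_nonneg_of_le (fun n => Real.rpow_nonneg n.bracket_pos.le _) fun n => ?_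
  by_cases hn : n = 0
  · rw [if_pos hn]
    have h3 : n.bracket ^ (-τ) ≤ 1 := Real.rpow_le_one_of_one_le_of_nonpos n.one_le_bracket (by linarith)
    have h4 : 0 ≤ ‖n‖ ^ (-τ) := Real.rpow_nonneg (norm_nonneg _) _
    linarith
  · rw [if_neg hn, add_zero]
    refine Real.rpow_le_rpow_of_nonpos (norm_pos_iff.2 hn) ?_ (by linarith)
    refine n.norm_le_len.trans ?_
    unfold Freq.bracket
    linarith

/-- The sum of `⟨n⟩^{-τ}` over the lattice. -/
noncomputable def bracketSum (τ : ℝ) : ℝ := ∑' n : Freq, n.bracket ^ (-τ)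

theorem bracketSum_nonneg (τ : ℝ) : 0 ≤ bracketSum τ :=
  tsum_nonneg fun n => Real.rpow_nonneg n.bracket_pos.le _

theorem sum_bracket_rpow_le {τ : ℝ} (hτ : 2 < τ) {ι : Type*} (S : Finset ι) (κ : ι → Freq)
    (hκ : Set.InjOn κ S) : ∑ i ∈ S, (κ i).bracket ^ (-τ) ≤ bracketSum τ := by
  classical
  rw [← Finset.sum_image (f := fun n : Freq => n.bracket ^ (-τ)) hκ]
  exact (summable_bracket_rpow hτ).sum_le_tsum _ fun n _ => Real.rpow_nonneg n.bracket_pos.le _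

/-- Each point contributes at least R^{-τ} to a convergent sum. The count exceeds the true order R²
by R^{τ-2}, a loss that the applications can afford. -/
theorem card_le_of_bracket_le {τ : ℝ} (hτ : 2 < τ) {N : Finset Freq} {R : ℝ} (hR : 0 < R)
    (hN : ∀ n ∈ N, n.bracket ≤ R) : (N.card : ℝ) ≤ bracketSum τ * R ^ τ := by
  have h1 : (N.card : ℝ) * R ^ (-τ) ≤ bracketSum τ := by
    refine le_trans ?_ (sum_bracket_rpow_le hτ N id (Set.injOn_id _))
    rw [← nsmul_eq_mul]
    exact Finset.card_nsmul_le_sum _ _ _ fun n hn =>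
      Real.rpow_le_rpow_of_nonpos n.bracket_pos (hN n hn) (by linarith)
  rwa [Real.rpow_neg hR.le, ← div_eq_mul_inv, div_le_iff₀ (by positivity)] at h1

/-- A Schur-type bound: one factor of the square is bounded by summing over n, the other is summed
over l first, which leaves the number of output frequencies. The exponent 3 only has to exceed the
dimension. -/
theorem sum_sq_sum_le (N : Finset Freq) (S : Finset Freq) (k : Freq) :
    ∑ l ∈ S, (∑ n ∈ N, (n - l - k).bracket ^ (-3 : ℝ)) ^ 2 ≤ bracketSum 3 ^ 2 * N.card := by
  have h3 : (2 : ℝ) < 3 := by norm_num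
  have h1 : ∀ l, ∑ n ∈ N, (n - l - k).bracket ^ (-3 : ℝ) ≤ bracketSum 3 := fun l =>
    sum_bracket_rpow_le h3 N (fun n => n - l - k) fun m _ n _ h => by simpa using h
  have h0 : ∀ l, 0 ≤ ∑ n ∈ N, (n - l - k).bracket ^ (-3 : ℝ) := fun l =>
    Finset.sum_nonneg fun n _ => Real.rpow_nonneg (Freq.bracket_pos _).le _
  calc ∑ l ∈ S, (∑ n ∈ N, (n - l - k).bracket ^ (-3 : ℝ)) ^ 2
      ≤ ∑ l ∈ S, bracketSum 3 * ∑ n ∈ N, (n - l - k).bracket ^ (-3 : ℝ) :=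
        Finset.sum_le_sum fun l _ => by
          rw [sq]
          exact mul_le_mul_of_nonneg_right (h1 l) (h0 l)
    _ = bracketSum 3 * ∑ n ∈ N, ∑ l ∈ S, (n - l - k).bracket ^ (-3 : ℝ) := by
        rw [← Finset.mul_sum, Finset.sum_comm]
    _ ≤ bracketSum 3 * ∑ n ∈ N, bracketSum 3 := by
        refine mul_le_mul_of_nonneg_left (Finset.sum_le_sum fun n _ => ?_) (bracketSum_nonneg 3)
        exact sum_bracket_rpow_le h3 S (fun l => n - l - k) fun l _ m _ h => by simpa using h
    _ = bracketSum 3 ^ 2 * N.card := by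
        rw [Finset.sum_const, nsmul_eq_mul]
        ring

/-- The decay in k is split: ⟨k⟩^{-τ} is kept for summation, and the rest is evaluated at the
smallest admissible bracket r, which will be of order 2^q. -/
theorem Freq.sq_bracket_rpow_mul_le {k : Freq} {r s θ τ : ℝ} (h : 2 * (θ - 2 + s) + τ ≤ 0)
    (hr : 0 < r) (hrk : r ≤ k.bracket) :
    (k.bracket ^ (θ - 2) * k.bracket ^ s) ^ 2
      ≤ r ^ (2 * (θ - 2 + s) + τ) * k.bracket ^ (-τ) := by
  have hk := k.bracket_pos
  have h1 : (k.bracket ^ (θ - 2) * k.bracket ^ s) ^ 2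
      = k.bracket ^ (2 * (θ - 2 + s) + τ) * k.bracket ^ (-τ) := by
    rw [← Real.rpow_add hk, ← Real.rpow_add hk, ← Real.rpow_natCast, ← Real.rpow_mul hk.le]
    congr 1
    push_cast
    ring
  rw [h1]
  exact mul_le_mul_of_nonneg_right (Real.rpow_le_rpow_of_nonpos hr hrk h)
    (Real.rpow_nonneg hk.le _)

theorem sum_sum_bracket_mul_sq_sum_le {τ : ℝ} (hτ : 2 < τ) (N S : Finset Freq) {A : ℝ}
    (hA : 0 ≤ A) :
    ∑ k ∈ S, ∑ l ∈ S, A * k.bracket ^ (-τ) * (∑ n ∈ N, (n - l - k).bracket ^ (-3 : ℝ)) ^ 2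
      ≤ A * (bracketSum 3 ^ 2 * N.card) * bracketSum τ := by
  calc _ = ∑ k ∈ S, A * k.bracket ^ (-τ)
          * ∑ l ∈ S, (∑ n ∈ N, (n - l - k).bracket ^ (-3 : ℝ)) ^ 2 := by
        simp only [Finset.mul_sum]
    _ ≤ ∑ k ∈ S, A * k.bracket ^ (-τ) * (bracketSum 3 ^ 2 * N.card) :=
        Finset.sum_le_sum fun k _ => mul_le_mul_of_nonneg_left (sum_sq_sum_le N S k)
          (mul_nonneg hA (Real.rpow_nonneg k.bracket_pos.le _))
    _ = A * (bracketSum 3 ^ 2 * N.card) * ∑ k ∈ S, k.bracket ^ (-τ) := by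
        rw [Finset.mul_sum]
        exact Finset.sum_congr rfl fun k _ => by ring
    _ ≤ _ := mul_le_mul_of_nonneg_left (sum_bracket_rpow_le hτ S id (Set.injOn_id _))
        (by positivity)

/-! ### Fourier coefficients of symbols -/

theorem coeff_partialDeriv_iterate (l : Fin 2) (N : ℕ) (u : TorusDistribution) (n : Freq) :
    ((partialDeriv l)^[N] u).coeff n = (Complex.I * (n l : ℂ)) ^ N * u.coeff n := by
  induction N with
  | zero => simp
  | succ N ih =>
    rw [Function.iterate_succ_apply', pow_succ', mul_assoc, ← ih]
    rfl

theorem coeff_iteratedPartial (i : Fin 2 → ℕ) (u : TorusDistribution) (n : Freq) :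
    (iteratedPartial i u).coeff n
      = (Complex.I * (n 0 : ℂ)) ^ i 0 * ((Complex.I * (n 1 : ℂ)) ^ i 1 * u.coeff n) := by
  rw [iteratedPartial, coeff_partialDeriv_iterate, coeff_partialDeriv_iterate]

theorem Freq.bracket_pow_three_le (n : Freq) :
    n.bracket ^ 3 ≤ 16 * (1 + |(n 0 : ℝ)| ^ 3 + |(n 1 : ℝ)| ^ 3) := by
  have h := n.len_le_abs_add_abs
  have h0 := abs_nonneg (n 0 : ℝ)
  have h1 := abs_nonneg (n 1 : ℝ)
  have h2 : n.bracket ^ 3 ≤ (1 + (|(n 0 : ℝ)| + |(n 1 : ℝ)|)) ^ 3 :=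
    pow_le_pow_left₀ n.bracket_pos.le (by unfold Freq.bracket; linarith) 3
  -- The inequality (x + y)³ ≤ 4 (x³ + y³) is used twice, whence 16.
  have h3 := add_pow_le zero_le_one (add_nonneg h0 h1) 3
  have h4 := add_pow_le h0 h1 3
  norm_num at h3 h4
  linarith

namespace IsSymbol

variable {D : DyadicPartition} {s : ℝ} {a : Torus2 → Freq → ℂ}

/-- Three derivatives in x do not worsen the growth ⟨k⟩^s and give decay of order 3 in n, just
enough integer decay to be summable on ℤ². No difference in k is needed. -/
theorem exists_norm_coeff_le (ha : IsSymbol D s 0 a) : ∃ K : ℝ, 0 ≤ K ∧ ∀ n k : Freq,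
    ‖mFourierCoeff (fun x => a x k) n‖ ≤ K * k.bracket ^ s * n.bracket ^ (-3 : ℝ) := by
  obtain ⟨K₀, N, hK₀, hN, hcoeff⟩ := D.exists_enorm_coeff_le 0
  have key : ∀ i : Fin 2 → ℕ, ∃ K : ℝ, 0 ≤ K ∧ ∀ n k : Freq,
      |(n 0 : ℝ)| ^ i 0 * |(n 1 : ℝ)| ^ i 1 * ‖mFourierCoeff (fun x => a x k) n‖
        ≤ K * k.bracket ^ s := fun i => by
    obtain ⟨C, hC⟩ := ha.bound i 0
    refine ⟨K₀ * |C|, by positivity, fun n k => ?_⟩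
    have hk := Real.rpow_nonneg k.bracket_pos.le s
    have h1 := hcoeff (iteratedPartial i (ofFun fun x => symbolDiff 0 a x k)) n
    have h2 := hC k
    simp only [Pi.zero_apply, CharP.cast_eq_zero, add_zero, sub_zero] at h2
    rw [hN rfl, pow_zero, mul_one] at h1
    have h3 := h1.trans (mul_le_mul_right (h2.trans (ENNReal.ofReal_le_ofReal
      (mul_le_mul_of_nonneg_right (le_abs_self C) hk))) _)
    rw [← ENNReal.ofReal_mul hK₀, ← ofReal_norm,
      ENNReal.ofReal_le_ofReal_iff (by positivity), coeff_iteratedPartial] at h3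
    have h4 : (ofFun fun x => symbolDiff 0 a x k).coeff n = mFourierCoeff (fun x => a x k) n := rfl
    rw [h4] at h3
    simp only [norm_mul, norm_pow, Complex.norm_I, one_mul, Complex.norm_intCast] at h3
    linarith
  obtain ⟨A, hA, hA'⟩ := key 0
  obtain ⟨B, hB, hB'⟩ := key ![3, 0]
  obtain ⟨C, hC, hC'⟩ := key ![0, 3]
  refine ⟨16 * (A + B + C), by positivity, fun n k => ?_⟩
  have h1 := hA' n k
  have h2 := hB' n k
  have h3 := hC' n k
  simp only [Pi.zero_apply, pow_zero, Matrix.cons_val_zero, Matrix.cons_val_one, one_mul,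
    mul_one] at h1 h2 h3
  have hn := n.bracket_pos
  rw [Real.rpow_neg hn.le, ← div_eq_mul_inv, le_div_iff₀ (by positivity)]
  have h4 : n.bracket ^ (3 : ℝ) = n.bracket ^ 3 := by
    rw [← Real.rpow_natCast]
    norm_num
  rw [h4]
  have h5 := mul_le_mul_of_nonneg_left n.bracket_pow_three_le
    (norm_nonneg (mFourierCoeff (fun x => a x k) n))
  linarith

theorem bracket_add_le_of_coeff_ne_zero (ha : IsSymbol D s 0 a) {n k : Freq}
    (h : mFourierCoeff (fun x => a x k) n ≠ 0) :
    n.len ≤ k.bracket ∧ (n + k).bracket ≤ 2 * k.bracket := by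
  obtain ⟨μ, hμ, hμ', hμ''⟩ := ha.spectral
  have h1 : n.len ≤ μ * k.bracket := by
    by_contra! h2
    exact h (hμ'' n k h2)
  have hk := k.bracket_pos
  have h2 : n.len ≤ k.bracket := by nlinarith
  have h3 := Freq.len_add_le n k
  refine ⟨h2, ?_⟩
  unfold Freq.bracket at *
  linarith

end IsSymbol

/-! ### The kernel of the resonant product -/

namespace DyadicPartition

variable (D : DyadicPartition) (a : Torus2 → Freq → ℂ)

/-- The `n`-th Fourier coefficient of `Π(a(·, k) e_k, e_l)`. -/
noncomputable def kernelCoeff (k l n : Freq) : ℂ :=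
  D.resonantWeight (n - l) l * mFourierCoeff (fun x => a x k) (n - l - k)

/-- The trigonometric polynomial `Π(a(·, k) e_k, e_l)`. -/
noncomputable def kernel (k l : Freq) : Torus2 → ℂ :=
  trigPoly (freqBall (2 * k.bracket + l.bracket)) (D.kernelCoeff a k l)

variable {a} {s : ℝ}

theorem kernelCoeff_eq_zero (ha : IsSymbol D s 0 a) {k l n : Freq}
    (hn : n ∉ freqBall (2 * k.bracket + l.bracket)) : D.kernelCoeff a k l n = 0 := by
  by_contra h
  have h1 := (ha.bracket_add_le_of_coeff_ne_zero (right_ne_zero_of_mul h)).2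
  rw [sub_add_cancel] at h1
  have h2 := Freq.bracket_add_le (n - l) l
  rw [sub_add_cancel] at h2
  refine hn (mem_freqBall.2 ?_)
  have h3 : n.len ≤ n.bracket := by unfold Freq.bracket; linarith
  linarith

theorem mFourierCoeff_kernel (ha : IsSymbol D s 0 a) (k l n : Freq) :
    mFourierCoeff (D.kernel a k l) n = D.kernelCoeff a k l n := by
  rw [kernel, mFourierCoeff_trigPoly]
  split_ifs with h
  · rfl
  · rw [D.kernelCoeff_eq_zero ha h]

/-- The frequency n - l of a(·,k) e_k has bracket at most 2⟨k⟩, and resonance makes ⟨l⟩ at most of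
the same order; their sum n, and with it 2^q, is then also bounded by a multiple of ⟨k⟩. The block
index is thus a lower bound on the high frequency. -/
theorem exists_kernelCoeff_support (ha : IsSymbol D s 0 a) : ∃ Λ : ℝ, 0 < Λ ∧ ∀ k l n : Freq,
    D.kernelCoeff a k l n ≠ 0 → l.bracket ≤ Λ * k.bracket ∧
      ∀ q, D.weight q n.vec ≠ 0 → (2 : ℝ) ^ q ≤ Λ * k.bracket := by
  obtain ⟨c, C, hc, hC, hsupp⟩ := D.exists_weight_support
  refine ⟨max (4 * C / c) (c⁻¹ * (2 + 4 * C / c)), by positivity, fun k l n h => ?_⟩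
  have hk := k.bracket_pos
  have h1 := (ha.bracket_add_le_of_coeff_ne_zero (right_ne_zero_of_mul h)).2
  rw [sub_add_cancel] at h1
  obtain ⟨i, j, hj, hi', hj'⟩ := D.exists_of_resonantWeight_ne_zero (m := n - l) (l := l)
    fun h' => h (by rw [kernelCoeff, h', Complex.ofReal_zero, zero_mul])
  have h2 := (hsupp i _ hi').1
  have h3 := (hsupp j _ hj').2
  have h4 : (2 : ℝ) ^ j ≤ 2 * 2 ^ i := by
    rw [← pow_succ']
    exact pow_le_pow_right₀ (by norm_num) (Finset.mem_Icc.1 hj).2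
  have h5 : (2 : ℝ) ^ i ≤ 2 * k.bracket / c := by
    rw [le_div_iff₀ hc]
    linarith
  have h6 : l.bracket ≤ 4 * C / c * k.bracket := by
    calc l.bracket ≤ C * 2 ^ j := h3
      _ ≤ C * (2 * (2 * k.bracket / c)) := by
          gcongr
          linarith
      _ = 4 * C / c * k.bracket := by ring
  refine ⟨h6.trans (by gcongr; exact le_max_left _ _), fun q hq => ?_⟩
  have h7 := (hsupp q n hq).1
  have h8 := Freq.bracket_add_le (n - l) l
  rw [sub_add_cancel] at h8
  calc (2 : ℝ) ^ q ≤ c⁻¹ * ((2 + 4 * C / c) * k.bracket) := by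
        rw [le_inv_mul_iff₀ hc]
        linarith
    _ = c⁻¹ * (2 + 4 * C / c) * k.bracket := by ring
    _ ≤ _ := by
        gcongr
        exact le_max_right _ _

theorem block_kernel (ha : IsSymbol D s 0 a) (q : ℕ) (k l : Freq) (x : Torus2) :
    D.block q (ofFun (D.kernel a k l)) x = ∑ n ∈ (D.finite_weight q).toFinset,
      (D.weight q n.vec : ℂ) * D.kernelCoeff a k l n * mFourier n x := by
  rw [block_eq_sum]
  refine Finset.sum_congr rfl fun n _ => ?_
  rw [← D.mFourierCoeff_kernel ha]
  rfl

theorem exists_norm_block_kernel_le (ha : IsSymbol D s 0 a) : ∃ K : ℝ, 0 ≤ K ∧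
    ∀ (q : ℕ) (k l : Freq) (x : Torus2), ‖D.block q (ofFun (D.kernel a k l)) x‖
      ≤ K * k.bracket ^ s
        * ∑ n ∈ (D.finite_weight q).toFinset, (n - l - k).bracket ^ (-3 : ℝ) := by
  obtain ⟨K₁, hK₁, hcoeff⟩ := ha.exists_norm_coeff_le
  obtain ⟨K₂, hK₂, hres⟩ := D.exists_resonantWeight_bound
  obtain ⟨K₃, hK₃, hw⟩ := D.exists_weight_bound
  refine ⟨K₃ * K₂ * K₁, by positivity, fun q k l x => ?_⟩
  rw [D.block_kernel ha, Finset.mul_sum]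
  refine (norm_sum_le _ _).trans (Finset.sum_le_sum fun n _ => ?_)
  rw [norm_mul, norm_mul, norm_mFourier_apply, mul_one, kernelCoeff, norm_mul,
    Complex.norm_real, Complex.norm_real, Real.norm_eq_abs, Real.norm_eq_abs]
  calc |D.weight q n.vec| * (|D.resonantWeight (n - l) l|
        * ‖mFourierCoeff (fun x => a x k) (n - l - k)‖)
      ≤ K₃ * (K₂ * (K₁ * k.bracket ^ s * (n - l - k).bracket ^ (-3 : ℝ))) :=
        mul_le_mul (hw _ _) (mul_le_mul (hres _ _) (hcoeff _ _) (norm_nonneg _) hK₂)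
          (by positivity) hK₃
    _ = K₃ * K₂ * K₁ * k.bracket ^ s * (n - l - k).bracket ^ (-3 : ℝ) := by ring

/-- Square summability of the blocks of the kernel. -/
theorem exists_sum_sq_block_kernel_le (ha : IsSymbol D s 0 a) (hs : s ≤ 0) {Λ : ℝ} (hΛ : 0 < Λ)
    (hsupp : ∀ k l n : Freq, D.kernelCoeff a k l n ≠ 0 → l.bracket ≤ Λ * k.bracket ∧
      ∀ q, D.weight q n.vec ≠ 0 → (2 : ℝ) ^ q ≤ Λ * k.bracket)
    {θ τ : ℝ} (hτ : 2 < τ) (hθτ : 2 * (θ - 2) + τ ≤ 0) :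
    ∃ K : ℝ, 0 ≤ K ∧ ∀ (M : ℝ) (b : Freq → Freq → ℂ), 0 ≤ M →
      (∀ k l, l.bracket ≤ Λ * k.bracket → ‖b k l‖ ≤ M * k.bracket ^ (θ - 2)) →
      ∀ (S : Finset Freq) (q : ℕ) (x : Torus2),
        ∑ k ∈ S, ∑ l ∈ S, ‖b k l * D.block q (ofFun (D.kernel a k l)) x‖ ^ 2
          ≤ M ^ 2 * K * ((2 : ℝ) ^ q) ^ (2 * (θ - 2 + s) + 2 * τ) := by
  obtain ⟨K₀, hK₀', hblock⟩ := D.exists_norm_block_kernel_le ha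
  obtain ⟨c, C, hc, hC, hball⟩ := D.exists_weight_support
  have hb3 := bracketSum_nonneg 3
  have hbτ := bracketSum_nonneg τ
  -- Exponent left for 2^q once ⟨k⟩^{-τ} has been set aside; it must be nonpositive for the lower
  -- bound on ⟨k⟩ to be usable.
  set e : ℝ := 2 * (θ - 2 + s) + τ with he
  have he0 : e ≤ 0 := by rw [he]; linarith
  refine ⟨K₀ ^ 2 * (bracketSum 3 ^ 2 * (bracketSum τ * C ^ τ)) * (bracketSum τ * (1 / Λ) ^ e),
    by positivity, fun M b hM hb S q x => ?_⟩
  have h2q : (0 : ℝ) < 2 ^ q := by positivity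
  set N := (D.finite_weight q).toFinset with hN
  have hNw : ∀ n ∈ N, D.weight q n.vec ≠ 0 := fun n hn => by simpa [hN] using hn
  have hcard : (N.card : ℝ) ≤ bracketSum τ * C ^ τ * (2 ^ q : ℝ) ^ τ := by
    rw [mul_assoc, ← Real.mul_rpow hC.le h2q.le]
    exact card_le_of_bracket_le hτ (by positivity) fun n hn => (hball q n (hNw n hn)).2
  set V : Freq → Freq → ℝ := fun k l => ∑ n ∈ N, (n - l - k).bracket ^ (-3 : ℝ) with hV
  have hA : 0 ≤ M ^ 2 * K₀ ^ 2 * ((2 : ℝ) ^ q / Λ) ^ e :=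
    mul_nonneg (by positivity) (Real.rpow_nonneg (div_pos h2q hΛ).le _)
  have hterm : ∀ k l, ‖b k l * D.block q (ofFun (D.kernel a k l)) x‖ ^ 2
      ≤ M ^ 2 * K₀ ^ 2 * ((2 : ℝ) ^ q / Λ) ^ e * k.bracket ^ (-τ) * V k l ^ 2 := fun k l => by
    have hk := k.bracket_pos
    -- Either one mode of the block is present, and the support property gives 2^q / Λ ≤ ⟨k⟩, or the
    -- block vanishes.
    by_cases hn : ∃ n ∈ N, D.kernelCoeff a k l n ≠ 0
    · obtain ⟨n₀, hn₀, hn₀'⟩ := hn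
      obtain ⟨hl, hq⟩ := hsupp k l n₀ hn₀'
      have hq' : (2 : ℝ) ^ q / Λ ≤ k.bracket := by
        rw [div_le_iff₀ hΛ]
        linarith [hq q (hNw n₀ hn₀)]
      have hF := hblock q k l x
      have hpow := Freq.sq_bracket_rpow_mul_le (s := s) (θ := θ) (τ := τ) he0
        (div_pos h2q hΛ) hq'
      have h1 : ‖b k l * D.block q (ofFun (D.kernel a k l)) x‖
          ≤ M * K₀ * (k.bracket ^ (θ - 2) * k.bracket ^ s) * V k l := by
        rw [norm_mul]
        exact (mul_le_mul (hb k l hl) hF (norm_nonneg _) (by positivity)).trans_eq (by ring)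
      refine (pow_le_pow_left₀ (norm_nonneg _) h1 2).trans ?_
      have hMK : 0 ≤ M ^ 2 * K₀ ^ 2 := by positivity
      have h2 := mul_le_mul_of_nonneg_right (mul_le_mul_of_nonneg_left hpow hMK)
        (sq_nonneg (V k l))
      exact le_trans (le_of_eq (by ring)) (h2.trans (le_of_eq (by ring)))
    · push Not at hn
      have : D.block q (ofFun (D.kernel a k l)) x = 0 := by
        rw [D.block_kernel ha]
        exact Finset.sum_eq_zero fun n hn' => by rw [hn n hn', mul_zero, zero_mul]
      rw [this, mul_zero, norm_zero, zero_pow two_ne_zero]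
      exact mul_nonneg (mul_nonneg hA (Real.rpow_nonneg hk.le _)) (sq_nonneg _)
  calc ∑ k ∈ S, ∑ l ∈ S, ‖b k l * D.block q (ofFun (D.kernel a k l)) x‖ ^ 2
      ≤ ∑ k ∈ S, ∑ l ∈ S,
        M ^ 2 * K₀ ^ 2 * ((2 : ℝ) ^ q / Λ) ^ e * k.bracket ^ (-τ) * V k l ^ 2 :=
        Finset.sum_le_sum fun k _ => Finset.sum_le_sum fun l _ => hterm k l
    _ ≤ M ^ 2 * K₀ ^ 2 * ((2 : ℝ) ^ q / Λ) ^ e * (bracketSum 3 ^ 2 * N.card) * bracketSum τ :=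
        sum_sum_bracket_mul_sq_sum_le hτ N S hA
    _ ≤ M ^ 2 * K₀ ^ 2 * ((2 : ℝ) ^ q / Λ) ^ e
          * (bracketSum 3 ^ 2 * (bracketSum τ * C ^ τ * (2 ^ q : ℝ) ^ τ)) * bracketSum τ :=
        mul_le_mul_of_nonneg_right (mul_le_mul_of_nonneg_left
          (mul_le_mul_of_nonneg_left hcard (sq_nonneg _)) hA) hbτ
    _ = _ := by
        have h1 : ((2 : ℝ) ^ q / Λ) ^ e = ((2 : ℝ) ^ q) ^ e * (1 / Λ) ^ e := by
          rw [← Real.mul_rpow h2q.le (by positivity), mul_one_div]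
        have h2 : ((2 : ℝ) ^ q) ^ (2 * (θ - 2 + s) + 2 * τ)
            = ((2 : ℝ) ^ q) ^ e * ((2 : ℝ) ^ q) ^ τ := by
          rw [← Real.rpow_add h2q]
          congr 1
          rw [he]
          ring
        rw [h1, h2]
        ring

end DyadicPartition

/-! ### Moments of Besov norms in the second chaos -/

namespace DyadicPartition

variable (D : DyadicPartition)

theorem block_sum {ι : Type*} (q : ℕ) (S : Finset ι) (u : ι → TorusDistribution) :
    D.block q (∑ i ∈ S, u i) = ∑ i ∈ S, D.block q (u i) := by
  classical
  induction S using Finset.induction_on with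
  | empty => simp [block_zero]
  | insert i S hi ih => rw [Finset.sum_insert hi, Finset.sum_insert hi, block_add, ih]

/-- Bounding the supremum over blocks by a sum lets expectations be taken block by block. -/
theorem besovENorm_pow_le_tsum (γ : ℝ) (u : TorusDistribution) {n : ℕ} (hn : n ≠ 0) :
    D.besovENorm γ u ^ n
      ≤ ∑' q : ℕ, ENNReal.ofReal ((2 : ℝ) ^ (γ * ((q : ℝ) - 1))) ^ n
        * supENorm (D.block q u) ^ n := by
  have hn' : (0 : ℝ) < n := by positivity
  rw [← ENNReal.rpow_natCast, ← ENNReal.le_rpow_inv_iff hn']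
  refine iSup_le fun q => (ENNReal.le_rpow_inv_iff hn').2 ?_
  rw [ENNReal.rpow_natCast, mul_pow]
  exact ENNReal.le_tsum (f := fun q : ℕ => ENNReal.ofReal ((2 : ℝ) ^ (γ * ((q : ℝ) - 1))) ^ n
    * supENorm (D.block q u) ^ n) q

theorem exists_supENorm_block_pow_le {p : ℕ} (hp : p ≠ 0) : ∃ K : ℝ, 0 ≤ K ∧
    ∀ (q : ℕ) (u : TorusDistribution), supENorm (D.block q u) ^ (2 * p)
      ≤ ENNReal.ofReal (K * ((2 : ℝ) ^ q) ^ (3 : ℝ))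
        * ∫⁻ x, ‖D.block q u x‖ₑ ^ (2 * p) ∂torusMeasure := by
  obtain ⟨c, C, hc, hC, hball⟩ := D.exists_weight_support
  refine ⟨bracketSum 3 * (1 + p * C) ^ (3 : ℝ), mul_nonneg (bracketSum_nonneg 3) (by positivity),
    fun q u => ?_⟩
  have h2q : (1 : ℝ) ≤ 2 ^ q := one_le_pow₀ (by norm_num)
  have h := supENorm_trigPoly_pow_le (R := C * 2 ^ q) (S := (D.finite_weight q).toFinset)
    (fun n hn => by
      have h1 := (hball q n (by simpa using hn)).2
      unfold Freq.bracket at h1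
      linarith) (fun n => (D.weight q n.vec : ℂ) * u.coeff n) hp
  rw [← block_eq_trigPoly] at h
  refine h.trans (mul_le_mul_left ?_ _)
  rw [← ENNReal.ofReal_natCast]
  refine ENNReal.ofReal_le_ofReal ?_
  rw [mul_assoc, ← Real.mul_rpow (by positivity) (by positivity)]
  -- Counted with τ = 3. The resulting power of 2^q does not depend on p and is absorbed by taking p
  -- large.
  refine card_le_of_bracket_le (by norm_num) (by positivity) fun n hn => ?_
  rw [mem_freqBall] at hn
  unfold Freq.bracket
  nlinarith

variable (a : Torus2 → Freq → ℂ)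

/-- The centred quadratic functional `∑ b(k, l) (g_k g_l - 1_{k + l = 0}) Π(a(·, k) e_k, e_l)`. -/
noncomputable def chaos (S : Finset Freq) (b : Freq → Freq → ℂ) (g : Freq → ℂ) :
    TorusDistribution :=
  ∑ k ∈ S, ∑ l ∈ S, (b k l * (g k * g l - if k + l = 0 then 1 else 0)) • ofFun (D.kernel a k l)

theorem block_chaos (q : ℕ) (S : Finset Freq) (b : Freq → Freq → ℂ) (g : Freq → ℂ) (x : Torus2) :
    D.block q (D.chaos a S b g) x = ∑ k ∈ S, ∑ l ∈ S,
      (b k l * D.block q (ofFun (D.kernel a k l)) x) * (g k * g l - if k + l = 0 then 1 else 0) := by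
  rw [chaos, block_sum, Finset.sum_apply]
  refine Finset.sum_congr rfl fun k _ => ?_
  rw [block_sum, Finset.sum_apply]
  refine Finset.sum_congr rfl fun l _ => ?_
  rw [block_smul, Pi.smul_apply, smul_eq_mul]
  ring

theorem continuous_block (q : ℕ) (u : TorusDistribution) : Continuous (D.block q u) := by
  rw [block_eq_trigPoly]
  exact continuous_trigPoly _ _

variable {a} {s : ℝ}

theorem aemeasurable_block_chaos {Ω : Type*} [MeasurableSpace Ω] {P : Measure Ω}
    {ξ : Ω → TorusDistribution} (hξ : IsWhiteNoise P ξ) (q n : ℕ)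
    (S : Finset Freq) (b : Freq → Freq → ℂ) :
    AEMeasurable (fun z : Ω × Torus2 => ‖D.block q (D.chaos a S b (ξ z.1).coeff) z.2‖ₑ ^ n)
      (P.prod torusMeasure) := by
  simp only [block_chaos]
  refine AEMeasurable.pow_const (AEMeasurable.enorm ?_) _
  refine Finset.aemeasurable_fun_sum _ fun k _ => Finset.aemeasurable_fun_sum _ fun l _ => ?_
  have h1 := (D.continuous_block q (ofFun (D.kernel a k l))).measurable
  have h2 := hξ.aemeasurable_coeff
  exact ((h1.const_mul (b k l)).comp measurable_snd).aemeasurable.mul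
    (((h2 k).comp_fst.mul (h2 l).comp_fst).sub_const _)

/-- After Tonelli, the block at a fixed x is a scalar second chaos, so a variance bound uniform in x
suffices. -/
theorem lintegral_lintegral_block_chaos_le {Ω : Type*} [MeasurableSpace Ω] {P : Measure Ω}
    [IsProbabilityMeasure P] {ξ : Ω → TorusDistribution} (hξ : IsWhiteNoise P ξ) {p : ℕ}
    (hp : p ≠ 0) {q : ℕ} {S : Finset Freq} {b : Freq → Freq → ℂ} {V : ℝ}
    (hV : ∀ x, ∑ k ∈ S, ∑ l ∈ S, ‖b k l * D.block q (ofFun (D.kernel a k l)) x‖ ^ 2 ≤ V) :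
    ∫⁻ ω, ∫⁻ x, ‖D.block q (D.chaos a S b (ξ ω).coeff) x‖ₑ ^ (2 * p) ∂torusMeasure ∂P
      ≤ 2 ^ (2 * p + 1) * (2 ^ (2 * p + 1) * gaussianMoment p) ^ 2 * ENNReal.ofReal V ^ p := by
  rw [lintegral_lintegral_swap (D.aemeasurable_block_chaos hξ q (2 * p) S b)]
  calc ∫⁻ x, ∫⁻ ω, ‖D.block q (D.chaos a S b (ξ ω).coeff) x‖ₑ ^ (2 * p) ∂P ∂torusMeasure
      ≤ ∫⁻ _, 2 ^ (2 * p + 1) * (2 ^ (2 * p + 1) * gaussianMoment p) ^ 2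
        * ENNReal.ofReal V ^ p ∂torusMeasure := by
        refine lintegral_mono fun x => ?_
        simp only [block_chaos]
        refine (hξ.lintegral_chaos_le S _ hp).trans ?_
        gcongr
        refine le_trans (le_of_eq ?_) (ENNReal.ofReal_le_ofReal (hV x))
        rw [ENNReal.ofReal_sum_of_nonneg fun k _ => by positivity]
        refine Finset.sum_congr rfl fun k _ => ?_
        rw [ENNReal.ofReal_sum_of_nonneg fun k _ => by positivity]
        refine Finset.sum_congr rfl fun l _ => ?_
        rw [ENNReal.ofReal_pow (norm_nonneg _), ofReal_norm]
    _ = _ := by simp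

theorem tsum_ofReal_two_pow_rpow_ne_top {β : ℝ} (hβ : β < 0) :
    ∑' q : ℕ, ENNReal.ofReal (((2 : ℝ) ^ q) ^ β) ≠ ∞ := by
  have h : ∀ q : ℕ, ((2 : ℝ) ^ q) ^ β = ((2 : ℝ) ^ β) ^ q := fun q => by
    rw [← Real.rpow_natCast, ← Real.rpow_natCast, ← Real.rpow_mul (by norm_num),
      ← Real.rpow_mul (by norm_num), mul_comm]
  simp only [h]
  rw [← ENNReal.ofReal_tsum_of_nonneg (fun q => by positivity)
    (summable_geometric_of_lt_one (by positivity)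
      (Real.rpow_lt_one_of_one_lt_of_neg (by norm_num) hβ))]
  exact ENNReal.ofReal_ne_top

/-- The moments of the Besov norm of a second order chaos are controlled by the size of its
coefficients. -/
theorem exists_lintegral_besovENorm_chaos_le (ha : IsSymbol D s 0 a) (hs : s ≤ 0) {Λ : ℝ}
    (hΛ : 0 < Λ) (hsupp : ∀ k l n : Freq, D.kernelCoeff a k l n ≠ 0 → l.bracket ≤ Λ * k.bracket ∧
      ∀ q, D.weight q n.vec ≠ 0 → (2 : ℝ) ^ q ≤ Λ * k.bracket)
    {α : ℝ} (hα : 0 < α) (hα' : α < 1) {Ω : Type*} [MeasurableSpace Ω] {P : Measure Ω}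
    [IsProbabilityMeasure P] {ξ : Ω → TorusDistribution} (hξ : IsWhiteNoise P ξ) {p : ℕ}
    (hp : 3 < 2 * p * (1 - α)) :
    ∃ B : ℝ≥0∞, B ≠ ∞ ∧ ∀ (M : ℝ) (b : Freq → Freq → ℂ), 0 ≤ M →
      (∀ k l, l.bracket ≤ Λ * k.bracket → ‖b k l‖ ≤ M * k.bracket ^ ((1 - α) / 2 - 2)) →
      ∀ S : Finset Freq, ∫⁻ ω, D.besovENorm (2 * α - 2 - s) (D.chaos a S b (ξ ω).coeff) ^ (2 * p) ∂P
        ≤ B * ENNReal.ofReal M ^ (2 * p) := by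
  have hp0 : p ≠ 0 := by
    rintro rfl
    norm_num at hp
  obtain ⟨K₁, hK₁, hsup⟩ := D.exists_supENorm_block_pow_le hp0
  -- With this θ and τ the variance of a block is of order 2^{2q(1-α+s)}, which is half of the
  -- available gap in regularity.
  obtain ⟨K₂, hK₂, hsq⟩ := D.exists_sum_sq_block_kernel_le ha hs hΛ hsupp (θ := (1 - α) / 2)
    (τ := 2 + (1 - α) / 2) (by linarith) (by linarith)
  set γ : ℝ := 2 * α - 2 - s with hγ
  set β : ℝ := 3 - 2 * p * (1 - α) with hβ
  set G : ℝ≥0∞ := 2 ^ (2 * p + 1) * (2 ^ (2 * p + 1) * gaussianMoment p) ^ 2 with hG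
  have hGtop : G ≠ ∞ := by
    have := (gaussianMoment_lt_top p).ne
    rw [hG]
    finiteness
  set E : ℝ := 2 * ((1 - α) / 2 - 2 + s) + 2 * (2 + (1 - α) / 2) with hE
  refine ⟨ENNReal.ofReal (2 ^ (-(2 * p * γ)) * K₁ * K₂ ^ p) * G
    * ∑' q : ℕ, ENNReal.ofReal (((2 : ℝ) ^ q) ^ β), ?_, fun M b hM hb S => ?_⟩
  · exact ENNReal.mul_ne_top (ENNReal.mul_ne_top ENNReal.ofReal_ne_top hGtop)
      (tsum_ofReal_two_pow_rpow_ne_top (by linarith))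
  -- Total power of 2^q: 2pγ from the norm, 3 from the supremum, 2p(1-α+s) from the variance, hence
  -- β = 3 - 2p(1-α), negative by the choice of p. The factor 2^{-2pγ} comes from the shifted block
  -- index.
  have hreal : ∀ q : ℕ, ((2 : ℝ) ^ (γ * ((q : ℝ) - 1))) ^ (2 * p) * (K₁ * ((2 : ℝ) ^ q) ^ (3 : ℝ))
      * (M ^ 2 * K₂ * ((2 : ℝ) ^ q) ^ E) ^ p
      = 2 ^ (-(2 * p * γ)) * K₁ * K₂ ^ p * M ^ (2 * p) * ((2 : ℝ) ^ q) ^ β := fun q => by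
    have h1 : ((2 : ℝ) ^ (γ * ((q : ℝ) - 1))) ^ (2 * p)
        = 2 ^ (-(2 * p * γ)) * ((2 : ℝ) ^ q) ^ (2 * p * γ) := by
      rw [← Real.rpow_natCast, ← Real.rpow_natCast, ← Real.rpow_mul (by norm_num),
        ← Real.rpow_mul (by norm_num), ← Real.rpow_add (by norm_num)]
      congr 1
      push_cast
      ring
    have h2 : ((2 : ℝ) ^ q) ^ β
        = ((2 : ℝ) ^ q) ^ (2 * p * γ) * ((2 : ℝ) ^ q) ^ (3 : ℝ) * (((2 : ℝ) ^ q) ^ E) ^ p := by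
      rw [← Real.rpow_natCast (((2 : ℝ) ^ q) ^ E), ← Real.rpow_mul (by positivity),
        ← Real.rpow_add (by positivity), ← Real.rpow_add (by positivity)]
      congr 1
      rw [hβ, hγ, hE]
      ring
    rw [h1, h2, mul_pow, mul_pow, ← pow_mul]
    ring
  set H : ℕ → Ω → ℝ≥0∞ := fun q ω =>
    ∫⁻ x, ‖D.block q (D.chaos a S b (ξ ω).coeff) x‖ₑ ^ (2 * p) ∂torusMeasure with hH
  have hterm : ∀ q : ℕ, ∫⁻ ω, ENNReal.ofReal ((2 : ℝ) ^ (γ * ((q : ℝ) - 1))) ^ (2 * p)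
        * (ENNReal.ofReal (K₁ * ((2 : ℝ) ^ q) ^ (3 : ℝ)) * H q ω) ∂P
      ≤ ENNReal.ofReal (2 ^ (-(2 * p * γ)) * K₁ * K₂ ^ p) * G * ENNReal.ofReal M ^ (2 * p)
        * ENNReal.ofReal (((2 : ℝ) ^ q) ^ β) := fun q => by
    rw [lintegral_const_mul' _ _ (by finiteness), lintegral_const_mul' _ _ (by finiteness)]
    refine (mul_le_mul_right (mul_le_mul_right (D.lintegral_lintegral_block_chaos_le hξ hp0
      (hsq M b hM hb S q)) _) _).trans (le_of_eq ?_)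
    rw [← ENNReal.ofReal_pow (by positivity), ← ENNReal.ofReal_pow (by positivity),
      ← ENNReal.ofReal_pow hM]
    calc _ = ENNReal.ofReal (((2 : ℝ) ^ (γ * ((q : ℝ) - 1))) ^ (2 * p))
          * ENNReal.ofReal (K₁ * ((2 : ℝ) ^ q) ^ (3 : ℝ))
          * ENNReal.ofReal ((M ^ 2 * K₂ * ((2 : ℝ) ^ q) ^ E) ^ p) * G := by ring
      _ = ENNReal.ofReal (2 ^ (-(2 * p * γ)) * K₁ * K₂ ^ p * M ^ (2 * p) * ((2 : ℝ) ^ q) ^ β) * G := by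
          rw [← ENNReal.ofReal_mul (by positivity), ← ENNReal.ofReal_mul (by positivity), hreal]
      _ = _ := by
          rw [ENNReal.ofReal_mul (by positivity), ENNReal.ofReal_mul (by positivity)]
          ring
  calc ∫⁻ ω, D.besovENorm γ (D.chaos a S b (ξ ω).coeff) ^ (2 * p) ∂P
      ≤ ∫⁻ ω, ∑' q : ℕ, ENNReal.ofReal ((2 : ℝ) ^ (γ * ((q : ℝ) - 1))) ^ (2 * p)
        * (ENNReal.ofReal (K₁ * ((2 : ℝ) ^ q) ^ (3 : ℝ)) * H q ω) ∂P :=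
        lintegral_mono fun ω => (D.besovENorm_pow_le_tsum γ _ (by positivity)).trans
          (ENNReal.tsum_le_tsum fun q => mul_le_mul_right (hsup q _) _)
    _ = ∑' q : ℕ, ∫⁻ ω, ENNReal.ofReal ((2 : ℝ) ^ (γ * ((q : ℝ) - 1))) ^ (2 * p)
        * (ENNReal.ofReal (K₁ * ((2 : ℝ) ^ q) ^ (3 : ℝ)) * H q ω) ∂P :=
        lintegral_tsum fun q =>
          ((D.aemeasurable_block_chaos hξ q (2 * p) S b).lintegral_prod_right'.const_mul _).const_mul _
    _ ≤ ∑' q : ℕ, ENNReal.ofReal (2 ^ (-(2 * p * γ)) * K₁ * K₂ ^ p) * G * ENNReal.ofReal M ^ (2 * p)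
        * ENNReal.ofReal (((2 : ℝ) ^ q) ^ β) := ENNReal.tsum_le_tsum hterm
    _ = _ := by
        rw [ENNReal.tsum_mul_left]
        ring

end DyadicPartition

/-! ### The regularised resonant product -/

theorem coeff_sum {ι : Type*} (S : Finset ι) (u : ι → TorusDistribution) (n : Freq) :
    (∑ i ∈ S, u i).coeff n = ∑ i ∈ S, (u i).coeff n := by
  classical
  induction S using Finset.induction_on with
  | empty => simp [coeff_zero]
  | insert i S hi ih =>
    rw [Finset.sum_insert hi, Finset.sum_insert hi, coeff_add, Pi.add_apply, ih]

theorem ofFun_sum_mul {ι : Type*} (S : Finset ι) (c : ι → ℂ) (f : ι → Torus2 → ℂ)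
    (hf : ∀ i, Continuous (f i)) :
    ofFun (fun x => ∑ i ∈ S, c i * f i x) = ∑ i ∈ S, c i • ofFun (f i) := by
  refine coeff_injective (funext fun n => ?_)
  rw [coeff_sum]
  refine (mFourierCoeff_sum S (f := fun i x => c i * f i x)
    (fun i _ => continuous_const.mul (hf i)) n).trans (Finset.sum_congr rfl fun i _ => ?_)
  exact mFourierCoeff_const_mul (c i) (f i) n

/-! ### The symbol of the inverse Laplacian. -/

namespace Freq

theorem len_sq (k : Freq) : k.len ^ 2 = (k 0 : ℝ) ^ 2 + (k 1 : ℝ) ^ 2 := by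
  rw [len, EuclideanSpace.norm_sq_eq, Fin.sum_univ_two]
  simp [vec]

/-- The symbol of `-Δ⁻¹`. -/
noncomputable def invLenSq (k : Freq) : ℝ := if k = 0 then 0 else 1 / k.len ^ 2

theorem invLenSq_nonneg (k : Freq) : 0 ≤ k.invLenSq := by
  unfold invLenSq
  split_ifs <;> positivity

theorem invLenSq_le (k : Freq) : k.invLenSq ≤ 4 * k.bracket ^ (-2 : ℝ) := by
  have hk := k.bracket_pos
  rw [Real.rpow_neg hk.le, show k.bracket ^ (2 : ℝ) = k.bracket ^ 2 by
    rw [← Real.rpow_natCast]; norm_num, ← div_eq_mul_inv]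
  unfold invLenSq
  split_ifs with h
  · positivity
  · have h1 := one_le_len h
    -- The factor 4 comes from ⟨k⟩ ≤ 2|k| for |k| ≥ 1.
    rw [div_le_div_iff₀ (by positivity) (by positivity)]
    unfold bracket
    nlinarith

/-- On the points (n+1, i) with 0 ≤ i ≤ n one has |k|² ≤ 2(n+1)², so each column contributes at
least 1/(2(n+1)) and the harmonic series is a lower bound. -/
theorem not_summable_invLenSq : ¬ Summable invLenSq := by
  intro h
  set κ : (Σ n : ℕ, Fin (n + 1)) → Freq := fun z => ![(z.1 : ℤ) + 1, (z.2 : ℤ)] with hκ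
  have hinj : Function.Injective κ := by
    rintro ⟨n, i⟩ ⟨m, j⟩ hij
    have h0 := congrFun hij 0
    have h1 := congrFun hij 1
    simp only [hκ, Matrix.cons_val_zero, Matrix.cons_val_one] at h0 h1
    obtain rfl : n = m := by omega
    obtain rfl : i = j := Fin.ext (by exact_mod_cast h1)
    rfl
  have h1 := ((summable_sigma_of_nonneg fun z => invLenSq_nonneg (κ z)).1
    (h.comp_injective hinj)).2
  have h2 : ∀ n : ℕ, 1 / 2 * (1 / ((n + 1 : ℕ) : ℝ)) ≤ ∑' i : Fin (n + 1), (κ ⟨n, i⟩).invLenSq := by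
    intro n
    rw [tsum_fintype]
    have h3 : ∀ i : Fin (n + 1), 1 / (2 * ((n : ℝ) + 1) ^ 2) ≤ (κ ⟨n, i⟩).invLenSq := fun i => by
      have hne : κ ⟨n, i⟩ ≠ 0 := fun h0 => by
        have := congrFun h0 0
        simp only [hκ, Matrix.cons_val_zero, Pi.zero_apply] at this
        omega
      rw [invLenSq, if_neg hne]
      have hpos := one_le_len hne
      refine one_div_le_one_div_of_le (by positivity) ?_
      rw [len_sq]
      simp only [hκ, Matrix.cons_val_zero, Matrix.cons_val_one]
      push_cast
      have hi : ((i : ℕ) : ℝ) ≤ n := by exact_mod_cast Nat.lt_succ_iff.1 i.2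
      have hi0 : (0 : ℝ) ≤ (i : ℕ) := by positivity
      nlinarith
    refine le_trans (le_of_eq ?_) (Finset.card_nsmul_le_sum _ _ _ fun i _ => h3 i)
    rw [Finset.card_univ, Fintype.card_fin, nsmul_eq_mul]
    push_cast
    field_simp
  have h3 := h1.of_nonneg_of_le (fun n => by positivity) h2
  have h4 := (summable_mul_left_iff (by norm_num : (1 / 2 : ℝ) ≠ 0)).1 h3
  exact Real.not_summable_one_div_natCast
    ((summable_nat_add_iff (f := fun n : ℕ => 1 / (n : ℝ)) 1).1 h4)

end Freq

namespace Cutoff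

variable (χ : Cutoff)

/-- The coefficient of the pair of frequencies `(k, l)` in the regularised resonant product. -/
noncomputable def pairWeight (ε : ℝ) (k l : Freq) : ℝ :=
  χ.toFun (|ε| * k.len) * k.invLenSq * χ.toFun (|ε| * l.len)

variable {χ} {ε : ℝ}

theorem toFun_len_nonneg (k : Freq) : 0 ≤ χ.toFun (|ε| * k.len) :=
  χ.nonneg _ (mul_nonneg (abs_nonneg _) k.len_nonneg)

theorem toFun_len_le_one (k : Freq) : χ.toFun (|ε| * k.len) ≤ 1 :=
  χ.le_one _ (mul_nonneg (abs_nonneg _) k.len_nonneg)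

theorem toFun_len_eq_zero (hε : 0 < ε) {k : Freq} (hk : k ∉ freqBall (2 / ε)) :
    χ.toFun (|ε| * k.len) = 0 := by
  refine χ.eq_zero _ ?_
  rw [mem_freqBall, not_le, div_lt_iff₀ hε] at hk
  rw [abs_of_pos hε]
  linarith

theorem pairWeight_eq_zero (hε : 0 < ε) {k l : Freq}
    (h : k ∉ freqBall (2 / ε) ∨ l ∉ freqBall (2 / ε)) : χ.pairWeight ε k l = 0 := by
  rw [pairWeight]
  rcases h with h | h
  · rw [toFun_len_eq_zero hε h, zero_mul, zero_mul]
  · rw [toFun_len_eq_zero hε h, mul_zero]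

theorem pairWeight_nonneg (k l : Freq) : 0 ≤ χ.pairWeight ε k l :=
  mul_nonneg (mul_nonneg (toFun_len_nonneg k) k.invLenSq_nonneg) (toFun_len_nonneg l)

theorem pairWeight_le (k l : Freq) : χ.pairWeight ε k l ≤ k.invLenSq := by
  have h1 := mul_le_mul_of_nonneg_right (toFun_len_le_one (χ := χ) (ε := ε) k) k.invLenSq_nonneg
  have h2 := mul_le_mul h1 (toFun_len_le_one (χ := χ) (ε := ε) l) (toFun_len_nonneg l)
    (by simpa using k.invLenSq_nonneg)
  simpa [pairWeight] using h2

theorem pairWeight_eq {k l : Freq} (hk : |ε| * k.len ≤ 1) (hl : |ε| * l.len ≤ 1) :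
    χ.pairWeight ε k l = k.invLenSq := by
  rw [pairWeight, χ.eq_one _ (mul_nonneg (abs_nonneg _) k.len_nonneg) hk,
    χ.eq_one _ (mul_nonneg (abs_nonneg _) l.len_nonneg) hl, one_mul, mul_one]

theorem coeff_regularize (u : TorusDistribution) (k : Freq) :
    (χ.regularize ε u).coeff k = χ.toFun (|ε| * k.len) * u.coeff k := rfl

theorem coeff_regularize_negInvLaplacian (u : TorusDistribution) (k : Freq) :
    (χ.regularize ε u.negInvLaplacian).coeff k
      = χ.toFun (|ε| * k.len) * ((k.invLenSq : ℝ) * u.coeff k) := by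
  rw [coeff_regularize]
  congr 1
  change (if k = 0 then (0 : ℂ) else ((1 / k.len ^ 2 : ℝ) : ℂ)) * u.coeff k = _
  congr 1
  unfold Freq.invLenSq
  split_ifs <;> simp

end Cutoff

namespace DyadicPartition

variable (D : DyadicPartition) {a : Torus2 → Freq → ℂ} {s : ℝ} (χ : Cutoff)

theorem coeff_ofFun_pseudoDiff (ha : IsSymbol D s 0 a) {v : TorusDistribution} {S : Finset Freq}
    (hv : ∀ k ∉ S, v.coeff k = 0) (m : Freq) :
    (ofFun (pseudoDiff a v)).coeff m
      = ∑ k ∈ S, v.coeff k * mFourierCoeff (fun x => a x k) (m - k) := by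
  have h1 : pseudoDiff a v = fun x => ∑ k ∈ S, v.coeff k * (a x k * mFourier k x) := by
    funext x
    rw [pseudoDiff, tsum_eq_sum (s := S) fun k hk => by rw [hv k hk, mul_zero, zero_mul]]
    exact Finset.sum_congr rfl fun k _ => by ring
  have h2 : ∀ k, Continuous fun x => a x k * mFourier k x := fun k =>
    (ha.continuous k).mul (by fun_prop)
  rw [h1, ofFun_sum_mul S (fun k => v.coeff k) (fun k x => a x k * mFourier k x) h2, coeff_sum]
  refine Finset.sum_congr rfl fun k _ => ?_
  rw [coeff_smul, Pi.smul_apply, smul_eq_mul]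
  congr 1
  exact mFourierCoeff_mul_mFourier (fun x => a x k) k m

/-- The substitution n = m + l passes from the frequency m of the first factor to that of the
product. -/
theorem sum_resonantWeight_eq_kernel (ha : IsSymbol D s 0 a) {k : Freq} {T : Finset Freq}
    (hT : ∀ m ∉ T, mFourierCoeff (fun x => a x k) (m - k) = 0) (l : Freq) (x : Torus2) :
    ∑ m ∈ T, (D.resonantWeight m l : ℂ) * mFourierCoeff (fun x => a x k) (m - k)
      * mFourier (m + l) x = D.kernel a k l x := by
  have h1 : ∑' n, D.kernelCoeff a k l n * mFourier n x = D.kernel a k l x :=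
    tsum_eq_sum fun n hn => by rw [D.kernelCoeff_eq_zero ha hn, zero_mul]
  have h2 : ∀ m, D.kernelCoeff a k l (m + l) = (D.resonantWeight m l : ℂ)
      * mFourierCoeff (fun x => a x k) (m - k) := fun m => by
    rw [kernelCoeff, add_sub_cancel_right]
  have h3 : ∑' m, D.kernelCoeff a k l (m + l) * mFourier (m + l) x
      = ∑ m ∈ T, D.kernelCoeff a k l (m + l) * mFourier (m + l) x :=
    tsum_eq_sum fun m hm => by rw [h2, hT m hm, mul_zero, zero_mul]
  simp only [← h2]
  rw [← h3, ← h1]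
  exact (Equiv.addRight l).tsum_eq fun n => D.kernelCoeff a k l n * mFourier n x

theorem resonant_pseudoDiff_eq_sum (ha : IsSymbol D s 0 a) {v w : TorusDistribution}
    {S : Finset Freq} (hv : ∀ k ∉ S, v.coeff k = 0) (hw : ∀ k ∉ S, w.coeff k = 0) (x : Torus2) :
    D.resonant (ofFun (pseudoDiff a v)) w x
      = ∑ k ∈ S, ∑ l ∈ S, v.coeff k * w.coeff l * D.kernel a k l x := by
  classical
  -- The spectral condition confines a(·,k) e_k to finitely many frequencies, so the first factor is
  -- a trigonometric polynomial and every sum below is finite.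
  set T : Finset Freq := S.biUnion fun k => freqBall (2 * k.bracket) with hT
  have hT' : ∀ k ∈ S, ∀ m ∉ T, mFourierCoeff (fun x => a x k) (m - k) = 0 := fun k hk m hm => by
    by_contra h
    have h1 := (ha.bracket_add_le_of_coeff_ne_zero h).2
    rw [sub_add_cancel] at h1
    refine hm (Finset.mem_biUnion.2 ⟨k, hk, mem_freqBall.2 (le_trans ?_ h1)⟩)
    unfold Freq.bracket
    linarith
  have hU : ∀ m ∉ T, (ofFun (pseudoDiff a v)).coeff m = 0 := fun m hm => by
    rw [D.coeff_ofFun_pseudoDiff ha hv]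
    exact Finset.sum_eq_zero fun k hk => by rw [hT' k hk m hm, mul_zero]
  rw [D.resonant_eq_sum hU hw]
  have h1 : ∀ k ∈ S, ∀ l, v.coeff k * w.coeff l * D.kernel a k l x
      = ∑ m ∈ T, v.coeff k * w.coeff l * ((D.resonantWeight m l : ℂ)
        * mFourierCoeff (fun x => a x k) (m - k) * mFourier (m + l) x) := fun k hk l => by
    rw [← D.sum_resonantWeight_eq_kernel ha (hT' k hk) l x, Finset.mul_sum]
  rw [Finset.sum_congr rfl fun k hk => Finset.sum_congr rfl fun l _ => h1 k hk l]
  rw [Finset.sum_comm (s := T), Finset.sum_comm (s := S) (t := S)]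
  refine Finset.sum_congr rfl fun l _ => ?_
  rw [Finset.sum_comm]
  refine Finset.sum_congr rfl fun m _ => ?_
  rw [D.coeff_ofFun_pseudoDiff ha hv, Finset.sum_mul, Finset.mul_sum, Finset.sum_mul]
  refine Finset.sum_congr rfl fun k _ => ?_
  ring

variable (a)

/-- The renormalisation function, the expectation of the regularised resonant product. -/
noncomputable def counterterm (ε : ℝ) : Torus2 → ℂ := fun x =>
  ∑ k ∈ freqBall (2 / ε), ∑ l ∈ freqBall (2 / ε),
    (χ.pairWeight ε k l : ℂ) * (if k + l = 0 then 1 else 0) * D.kernel a k l x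

theorem continuous_kernel (k l : Freq) : Continuous (D.kernel a k l) := continuous_trigPoly _ _

theorem smoothOnTorus_counterterm (ε : ℝ) : SmoothOnTorus (D.counterterm a χ ε) := by
  unfold SmoothOnTorus counterterm
  exact ContDiff.sum fun k _ => ContDiff.sum fun l _ =>
    contDiff_const.mul (smoothOnTorus_trigPoly _ _)

variable {a}

/-- The renormalised resonant product is a centred second order chaos. -/
theorem ofFun_resonant_sub_counterterm (ha : IsSymbol D s 0 a) {ε : ℝ} (hε : 0 < ε)
    (u : TorusDistribution) :
    ofFun (D.resonant (ofFun (pseudoDiff a (χ.regularize ε u.negInvLaplacian)))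
      (χ.regularize ε u) - D.counterterm a χ ε)
      = D.chaos a (freqBall (2 / ε)) (fun k l => (χ.pairWeight ε k l : ℂ)) u.coeff := by
  have h1 : (D.resonant (ofFun (pseudoDiff a (χ.regularize ε u.negInvLaplacian)))
      (χ.regularize ε u) - D.counterterm a χ ε)
      = fun x => ∑ z ∈ freqBall (2 / ε) ×ˢ freqBall (2 / ε), ((χ.pairWeight ε z.1 z.2 : ℂ)
        * (u.coeff z.1 * u.coeff z.2 - if z.1 + z.2 = 0 then 1 else 0)) * D.kernel a z.1 z.2 x := by
    funext x
    rw [Finset.sum_product, Pi.sub_apply, D.resonant_pseudoDiff_eq_sum ha (S := freqBall (2 / ε))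
      (fun k hk => by
        rw [Cutoff.coeff_regularize, Cutoff.toFun_len_eq_zero hε hk, Complex.ofReal_zero, zero_mul])
      (fun k hk => by
        rw [Cutoff.coeff_regularize, Cutoff.toFun_len_eq_zero hε hk, Complex.ofReal_zero, zero_mul]),
      counterterm, ← Finset.sum_sub_distrib]
    refine Finset.sum_congr rfl fun k _ => ?_
    rw [← Finset.sum_sub_distrib]
    refine Finset.sum_congr rfl fun l _ => ?_
    rw [Cutoff.coeff_regularize_negInvLaplacian, Cutoff.coeff_regularize, Cutoff.pairWeight]
    push_cast
    ring
  rw [h1, ofFun_sum_mul _ (fun z : Freq × Freq => (χ.pairWeight ε z.1 z.2 : ℂ)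
        * (u.coeff z.1 * u.coeff z.2 - if z.1 + z.2 = 0 then 1 else 0))
      (fun z => D.kernel a z.1 z.2) (fun z => D.continuous_kernel a z.1 z.2), chaos,
    Finset.sum_product]

/-! ### Divergence of the counterterm -/

/-- At n = 0 and l = -k the resonant weight is one and only the mean of a(·,k) enters. -/
theorem mFourierCoeff_counterterm_zero (ha : IsSymbol D s 0 a) (ε : ℝ) :
    mFourierCoeff (D.counterterm a χ ε) 0 = ∑ k ∈ freqBall (2 / ε),
      (χ.pairWeight ε k (-k) : ℂ) * mFourierCoeff (fun x => a x k) 0 := by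
  have hc : ∀ k l, Continuous fun x =>
      (χ.pairWeight ε k l : ℂ) * (if k + l = 0 then 1 else 0) * D.kernel a k l x :=
    fun k l => continuous_const.mul (D.continuous_kernel a k l)
  refine (mFourierCoeff_sum (freqBall (2 / ε)) (f := fun k x => ∑ l ∈ freqBall (2 / ε),
    (χ.pairWeight ε k l : ℂ) * (if k + l = 0 then 1 else 0) * D.kernel a k l x)
    (fun k _ => continuous_finsetSum _ fun l _ => hc k l) 0).trans ?_
  refine Finset.sum_congr rfl fun k hk => ?_
  rw [mFourierCoeff_sum _ fun l _ => hc k l, Finset.sum_eq_single (-k)]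
  · rw [mFourierCoeff_const_mul, D.mFourierCoeff_kernel ha, kernelCoeff]
    simp [resonantWeight_neg_self]
  · intro l _ hl
    have : k + l ≠ 0 := fun h => hl (eq_neg_of_add_eq_zero_right h)
    rw [mFourierCoeff_const_mul, if_neg this, mul_zero, zero_mul]
  · intro h
    rw [mem_freqBall, Freq.len_neg] at h
    exact absurd (mem_freqBall.1 hk) h

/-- The supremum norm dominates the mean, whose real part is compared with κ ∑ |k|⁻². -/
theorem tendsto_supENorm_counterterm (ha : IsSymbol D s 0 a)
    (h : ∃ κ : ℝ, 0 < κ ∧ ∃ R : ℝ, ∀ (x : Torus2) (k : Freq), R ≤ k.len → κ ≤ (a x k).re) :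
    Tendsto (fun ε => supENorm (D.counterterm a χ ε)) (𝓝[>] 0) (𝓝 ∞) := by
  classical
  obtain ⟨κ, hκ, R, hR⟩ := h
  set A : Freq → ℂ := fun k => mFourierCoeff (fun x => a x k) 0 with hA
  have hAre : ∀ k : Freq, R ≤ k.len → κ ≤ (A k).re := fun k hk => by
    have hi := Continuous.integrable_torus (ha.continuous k)
    have h1 : A k = ∫ x, a x k ∂torusMeasure := by
      simp only [hA, mFourierCoeff_eq]
      simp [mFourier_zero]
    have h2 : (A k).re = ∫ x, (a x k).re ∂torusMeasure := by
      rw [h1]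
      exact (integral_re hi).symm
    rw [h2]
    calc κ = ∫ _, κ ∂torusMeasure := by simp
      _ ≤ _ := integral_mono (integrable_const _) hi.re fun x => hR x k hk
  -- Correction at the finitely many low frequencies, where the real part of the symbol has no lower
  -- bound; its total effect is at most C, uniformly in ε.
  set E : Freq → ℝ := fun k => if k ∈ freqBall R then κ + ‖A k‖ else 0 with hE
  have hE0 : ∀ k, 0 ≤ E k := fun k => by
    simp only [hE]
    split_ifs <;> positivity
  have hAE : ∀ k, κ - E k ≤ (A k).re := fun k => by
    simp only [hE]
    split_ifs with hk
    · linarith [neg_abs_le (A k).re, Complex.abs_re_le_norm (A k)]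
    · rw [mem_freqBall, not_le] at hk
      linarith [hAre k hk.le]
  set C : ℝ := ∑ k ∈ freqBall R, k.invLenSq * E k with hC
  rw [ENNReal.tendsto_nhds_top_iff_nnreal]
  intro B
  -- A finite set on which the divergent series already exceeds the target. For small ε the cut-off
  -- equals one on F, and the other terms have nonnegative weights.
  obtain ⟨F, hF⟩ : ∃ F : Finset Freq, (B + 1 + C) / κ ≤ ∑ k ∈ F, k.invLenSq := by
    by_contra! hcon
    exact Freq.not_summable_invLenSq
      (summable_of_sum_le Freq.invLenSq_nonneg fun F => (hcon F).le)
  obtain ⟨L, hL⟩ := (F.image Freq.len).exists_le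
  filter_upwards [Ioo_mem_nhdsGT (show (0 : ℝ) < 1 / (|L| + 1) by positivity)] with ε hε
  obtain ⟨hε0, hε1⟩ := hε
  have hFlen : ∀ k ∈ F, |ε| * k.len ≤ 1 := fun k hk => by
    have h1 := hL _ (Finset.mem_image_of_mem _ hk)
    rw [abs_of_pos hε0]
    rw [lt_div_iff₀ (by positivity)] at hε1
    nlinarith [le_abs_self L]
  have hFS : F ⊆ freqBall (2 / ε) := fun k hk => by
    rw [mem_freqBall, le_div_iff₀ hε0]
    have := hFlen k hk
    rw [abs_of_pos hε0] at this
    linarith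
  have h1 : (B : ℝ) + 1 ≤ (mFourierCoeff (D.counterterm a χ ε) 0).re := by
    rw [D.mFourierCoeff_counterterm_zero χ ha, Complex.re_sum]
    simp only [Complex.re_ofReal_mul]
    have h2 : ∑ k ∈ F, k.invLenSq ≤ ∑ k ∈ freqBall (2 / ε), χ.pairWeight ε k (-k) := by
      refine le_trans (Finset.sum_le_sum fun k hk => ?_)
        (Finset.sum_le_sum_of_subset_of_nonneg hFS fun k _ _ => Cutoff.pairWeight_nonneg _ _)
      rw [Cutoff.pairWeight_eq (hFlen k hk) (by rw [Freq.len_neg]; exact hFlen k hk)]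
    have h3 : ∑ k ∈ freqBall (2 / ε), χ.pairWeight ε k (-k) * E k ≤ C := by
      calc _ ≤ ∑ k ∈ freqBall (2 / ε), k.invLenSq * E k := Finset.sum_le_sum fun k _ =>
            mul_le_mul_of_nonneg_right (Cutoff.pairWeight_le _ _) (hE0 k)
        _ = ∑ k ∈ freqBall (2 / ε) with k ∈ freqBall R, k.invLenSq * E k := by
            rw [Finset.sum_filter]
            refine Finset.sum_congr rfl fun k _ => ?_
            by_cases hk : k ∈ freqBall R
            · rw [if_pos hk]
            · rw [if_neg hk]
              simp only [hE, if_neg hk, mul_zero]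
        _ ≤ C := Finset.sum_le_sum_of_subset_of_nonneg
            (fun k hk => (Finset.mem_filter.1 hk).2)
            fun k _ _ => mul_nonneg k.invLenSq_nonneg (hE0 k)
    have h4 : ∑ k ∈ freqBall (2 / ε), χ.pairWeight ε k (-k) * (κ - E k)
        ≤ ∑ k ∈ freqBall (2 / ε), χ.pairWeight ε k (-k) * (A k).re :=
      Finset.sum_le_sum fun k _ => mul_le_mul_of_nonneg_left (hAE k) (Cutoff.pairWeight_nonneg _ _)
    simp only [mul_sub, Finset.sum_sub_distrib, ← Finset.sum_mul] at h4
    rw [div_le_iff₀ hκ] at hF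
    have h5 := mul_le_mul_of_nonneg_right h2 hκ.le
    linarith
  have h2 := enorm_mFourierCoeff_le (D.counterterm a χ ε) 0
  refine lt_of_lt_of_le ?_ h2
  rw [← ofReal_norm, ← ENNReal.ofReal_coe_nnreal]
  refine (ENNReal.ofReal_lt_ofReal_iff_of_nonneg B.2).2 ?_
  have h3 := (h1.trans (le_abs_self _)).trans (Complex.abs_re_le_norm _)
  change (B : ℝ) < _
  linarith

end DyadicPartition

/-! ### Convergence -/

/-- A family indexed by `ε ∈ (0, 1]` that is Cauchy in every `L^r` at a polynomial rate converges in
every `L^r` to a limit that does not depend on `r`. -/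
theorem exists_tendsto_eLpNorm_of_rate {Ω E : Type*} [MeasurableSpace Ω] {P : Measure Ω}
    [IsProbabilityMeasure P] [NormedAddCommGroup E] [CompleteSpace E] {Y : ℝ → Ω → E} {θ : ℝ}
    (hθ : 0 < θ)
    (hY : ∀ ε ∈ Set.Ioc (0 : ℝ) 1, ∀ r : ℝ≥0∞, 1 ≤ r → r ≠ ∞ → MemLp (Y ε) r P)
    (hrate : ∀ r : ℝ≥0∞, 1 ≤ r → r ≠ ∞ → ∃ B : ℝ≥0∞, B ≠ ∞ ∧ ∀ ε ∈ Set.Ioc (0 : ℝ) 1,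
      ∀ δ ∈ Set.Ioc (0 : ℝ) 1, ∀ η : ℝ, ε ≤ η → δ ≤ η →
        eLpNorm (Y ε - Y δ) r P ≤ B * ENNReal.ofReal (η ^ θ)) :
    ∃ L : Ω → E, ∀ r : ℝ≥0∞, 1 ≤ r → r ≠ ∞ → MemLp L r P ∧
      Tendsto (fun ε => eLpNorm (fun ω => Y ε ω - L ω) r P) (𝓝[>] 0) (𝓝 0) := by
  -- Along a dyadic sequence the polynomial rate becomes a summable geometric one.
  set e : ℕ → ℝ := fun n => (1 / 2) ^ n with he
  have he01 : ∀ n, e n ∈ Set.Ioc (0 : ℝ) 1 := fun n =>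
    ⟨by positivity, pow_le_one₀ (by norm_num) (by norm_num)⟩
  have hanti : ∀ {n m}, n ≤ m → e m ≤ e n := fun h =>
    pow_le_pow_of_le_one (by norm_num) (by norm_num) h
  have hetop : Tendsto e atTop (𝓝 0) :=
    tendsto_pow_atTop_nhds_zero_of_lt_one (by norm_num) (by norm_num)
  have hlim : ∀ r : ℝ≥0∞, 1 ≤ r → r ≠ ∞ → ∃ L : Ω → E, MemLp L r P ∧
      Tendsto (fun n => eLpNorm (Y (e n) - L) r P) atTop (𝓝 0) := fun r hr hr' => by
    obtain ⟨B, hB, hBr⟩ := hrate r hr hr'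
    have hρ : ∀ n, e n ^ θ = ((1 / 2 : ℝ) ^ θ) ^ n := fun n => by
      simp only [he]
      rw [← Real.rpow_natCast, ← Real.rpow_natCast, ← Real.rpow_mul (by norm_num),
        ← Real.rpow_mul (by norm_num), mul_comm]
    -- `B + 1` instead of `B` provides the strict inequality in the completeness criterion.
    have hsum : ∑' n, (B + 1) * ENNReal.ofReal (e n ^ θ) ≠ ∞ := by
      rw [ENNReal.tsum_mul_left]
      refine ENNReal.mul_ne_top (by finiteness) ?_
      simp only [hρ]
      rw [← ENNReal.ofReal_tsum_of_nonneg (fun n => by positivity)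
        (summable_geometric_of_lt_one (by positivity)
          (Real.rpow_lt_one (by norm_num) (by norm_num) hθ))]
      exact ENNReal.ofReal_ne_top
    refine MeasureTheory.Lp.cauchy_complete_eLpNorm hr (fun n => hY _ (he01 n) r hr hr') hsum
      fun N n m hn hm => ?_
    refine (hBr _ (he01 n) _ (he01 m) _ (hanti hn) (hanti hm)).trans_lt ?_
    have hpos : 0 < ENNReal.ofReal (e N ^ θ) :=
      ENNReal.ofReal_pos.2 (Real.rpow_pos_of_pos (he01 N).1 _)
    exact ENNReal.mul_lt_mul_left hpos.ne' ENNReal.ofReal_ne_top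
      (ENNReal.lt_add_right hB one_ne_zero)
  obtain ⟨L, hL, hLt⟩ := hlim 1 le_rfl ENNReal.one_ne_top
  refine ⟨L, fun r hr hr' => ?_⟩
  obtain ⟨L', hL', hLt'⟩ := hlim r hr hr'
  -- The limit in L^r is also a limit in L¹, so the L¹ limit serves for every r.
  have hae : L' =ᵐ[P] L := by
    have h1 : Tendsto (fun n => eLpNorm (Y (e n) - L') 1 P) atTop (𝓝 0) :=
      tendsto_of_tendsto_of_tendsto_of_le_of_le tendsto_const_nhds hLt' (fun _ => zero_le)
        fun n => eLpNorm_le_eLpNorm_of_exponent_le hr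
          ((hY _ (he01 n) r hr hr').1.sub hL'.1)
    have h2 : ∀ n, eLpNorm (L' - L) 1 P ≤ eLpNorm (Y (e n) - L') 1 P + eLpNorm (Y (e n) - L) 1 P := by
      intro n
      have hm := (hY _ (he01 n) 1 le_rfl ENNReal.one_ne_top).1
      have h3 : L' - L = (Y (e n) - L) - (Y (e n) - L') := by abel
      rw [h3, add_comm]
      exact eLpNorm_sub_le (hm.sub hL.1) (hm.sub hL'.1) le_rfl
    have h3 : eLpNorm (L' - L) 1 P = 0 := by
      have h4 := h1.add hLt
      rw [add_zero] at h4
      exact le_antisymm (ge_of_tendsto' h4 h2) zero_le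
    rw [eLpNorm_eq_zero_iff (hL'.1.sub hL.1) one_ne_zero] at h3
    filter_upwards [h3] with ω hω
    exact sub_eq_zero.1 hω
  have hLr : MemLp L r P := (memLp_congr_ae hae).1 hL'
  refine ⟨hLr, ?_⟩
  have hLtr : Tendsto (fun n => eLpNorm (Y (e n) - L) r P) atTop (𝓝 0) := by
    refine hLt'.congr fun n => eLpNorm_congr_ae ?_
    filter_upwards [hae] with ω hω
    simp only [Pi.sub_apply, hω]
  obtain ⟨B, hB, hBr⟩ := hrate r hr hr'
  -- For arbitrary ε the comparison is with a dyadic term e n ≤ ε, taking η = ε, before n tends to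
  -- infinity.
  have hbound : ∀ ε ∈ Set.Ioc (0 : ℝ) 1,
      eLpNorm (fun ω => Y ε ω - L ω) r P ≤ B * ENNReal.ofReal (ε ^ θ) := fun ε hε => by
    have h1 : Tendsto (fun n => B * ENNReal.ofReal (ε ^ θ) + eLpNorm (Y (e n) - L) r P) atTop
        (𝓝 (B * ENNReal.ofReal (ε ^ θ) + 0)) := tendsto_const_nhds.add hLtr
    rw [add_zero] at h1
    refine ge_of_tendsto h1 ?_
    filter_upwards [hetop.eventually_lt_const hε.1] with n hn
    have h3 : (fun ω => Y ε ω - L ω) = (Y ε - Y (e n)) + (Y (e n) - L) := by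
      ext ω
      simp
    rw [h3]
    refine (eLpNorm_add_le ((hY _ hε r hr hr').1.sub (hY _ (he01 n) r hr hr').1)
      ((hY _ (he01 n) r hr hr').1.sub hLr.1) hr).trans ?_
    gcongr
    exact hBr ε hε _ (he01 n) ε le_rfl hn.le
  have hzero : Tendsto (fun ε : ℝ => B * ENNReal.ofReal (ε ^ θ)) (𝓝[>] 0) (𝓝 0) := by
    have h1 : Tendsto (fun ε : ℝ => ε ^ θ) (𝓝[>] 0) (𝓝 0) := by
      have := (Real.continuousAt_rpow_const 0 θ (Or.inr hθ.le)).tendsto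
      rw [Real.zero_rpow hθ.ne'] at this
      exact this.mono_left nhdsWithin_le_nhds
    have h2 := ENNReal.Tendsto.const_mul (a := B) (ENNReal.tendsto_ofReal h1) (Or.inr hB)
    simpa using h2
  refine tendsto_of_tendsto_of_tendsto_of_le_of_le' tendsto_const_nhds hzero
    (Eventually.of_forall fun _ => zero_le) ?_
  filter_upwards [Ioc_mem_nhdsGT (zero_lt_one : (0 : ℝ) < 1)] with ε hε
  exact hbound ε hε

/-! ### Size and rate of convergence of the regularised weights. -/

namespace Cutoff

variable {χ : Cutoff} {ε δ : ℝ}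

theorem norm_pairWeight_le {θ : ℝ} (hθ : 0 ≤ θ) (k l : Freq) :
    ‖(χ.pairWeight ε k l : ℂ)‖ ≤ 4 * k.bracket ^ (θ - 2) := by
  rw [Complex.norm_real, Real.norm_eq_abs, abs_of_nonneg (pairWeight_nonneg k l)]
  refine (pairWeight_le k l).trans (k.invLenSq_le.trans ?_)
  gcongr
  · exact k.one_le_bracket
  · linarith

/-- If η(1+Λ)⟨k⟩ < 1, all the cut-offs equal one and the two weights agree; the relation between l
and k is needed for the cut-off in l. Otherwise (η(1+Λ)⟨k⟩)^θ ≥ 1 may be inserted, which trades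
decay in k for a rate in η. -/
theorem norm_pairWeight_sub_le {θ Λ η : ℝ} (hθ : 0 ≤ θ) (hΛ : 0 < Λ) (hε : 0 < ε) (hδ : 0 < δ)
    (hεη : ε ≤ η) (hδη : δ ≤ η) {k l : Freq} (hkl : l.bracket ≤ Λ * k.bracket) :
    ‖(χ.pairWeight ε k l : ℂ) - (χ.pairWeight δ k l : ℂ)‖
      ≤ 4 * (1 + Λ) ^ θ * η ^ θ * k.bracket ^ (θ - 2) := by
  have hη : 0 < η := hε.trans_le hεη
  have hk := k.bracket_pos
  rw [← Complex.ofReal_sub, Complex.norm_real, Real.norm_eq_abs]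
  by_cases ht : η * ((1 + Λ) * k.bracket) < 1
  · have key : ∀ ε, 0 < ε → ε ≤ η → χ.pairWeight ε k l = k.invLenSq := fun ε hε hεη => by
      have h1 : k.len ≤ (1 + Λ) * k.bracket := by
        have := mul_pos hΛ hk
        have h2 : k.len ≤ k.bracket := by unfold Freq.bracket; linarith
        linarith
      have h3 : l.len ≤ (1 + Λ) * k.bracket := by
        have h2 : l.len ≤ l.bracket := by unfold Freq.bracket; linarith
        linarith
      refine pairWeight_eq ?_ ?_ <;> rw [abs_of_pos hε]
      · exact (mul_le_mul hεη h1 k.len_nonneg hη.le).trans ht.le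
      · exact (mul_le_mul hεη h3 l.len_nonneg hη.le).trans ht.le
    rw [key ε hε hεη, key δ hδ hδη, sub_self, abs_zero]
    positivity
  · have h1 : |χ.pairWeight ε k l - χ.pairWeight δ k l| ≤ k.invLenSq := by
      rw [abs_le]
      constructor <;>
      linarith [pairWeight_nonneg (χ := χ) (ε := ε) k l, pairWeight_nonneg (χ := χ) (ε := δ) k l,
        pairWeight_le (χ := χ) (ε := ε) k l, pairWeight_le (χ := χ) (ε := δ) k l]
    have h2 : 1 ≤ (1 + Λ) ^ θ * η ^ θ * k.bracket ^ θ := by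
      rw [← Real.mul_rpow (by positivity) hη.le, ← Real.mul_rpow (by positivity) hk.le]
      refine Real.one_le_rpow ?_ hθ
      linarith
    calc _ ≤ 4 * k.bracket ^ (-2 : ℝ) * 1 := by
          rw [mul_one]
          exact h1.trans k.invLenSq_le
      _ ≤ 4 * k.bracket ^ (-2 : ℝ) * ((1 + Λ) ^ θ * η ^ θ * k.bracket ^ θ) := by gcongr
      _ = 4 * (1 + Λ) ^ θ * η ^ θ * k.bracket ^ (θ - 2) := by
          rw [sub_eq_add_neg, Real.rpow_add hk]
          ring

end Cutoff

/-! ### The chaos as a random element of C^γ. -/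

namespace DyadicPartition

variable (D : DyadicPartition) (a : Torus2 → Freq → ℂ)

theorem besovENorm_ofFun_kernel_lt_top (γ : ℝ) (k l : Freq) :
    D.besovENorm γ (ofFun (D.kernel a k l)) < ∞ :=
  D.besovENorm_lt_top_of_support γ (A := freqBall (2 * k.bracket + l.bracket)) fun n hn => by
    change mFourierCoeff (D.kernel a k l) n = 0
    rw [kernel, mFourierCoeff_trigPoly, if_neg hn]

/-- The chaos as an element of `C^γ`. -/
noncomputable def besovChaos (γ : ℝ) (S : Finset Freq) (b : Freq → Freq → ℂ) (g : Freq → ℂ) :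
    D.BesovSpace γ :=
  ∑ k ∈ S, ∑ l ∈ S, (b k l * (g k * g l - if k + l = 0 then 1 else 0)) •
    BesovSpace.mk D (ofFun (D.kernel a k l)) (D.besovENorm_ofFun_kernel_lt_top a γ k l)

theorem toDistribution_sum {γ : ℝ} {ι : Type*} (S : Finset ι) (u : ι → D.BesovSpace γ) :
    (∑ i ∈ S, u i).toDistribution = ∑ i ∈ S, (u i).toDistribution := by
  classical
  induction S using Finset.induction_on with
  | empty => rfl
  | insert i S hi ih =>
    rw [Finset.sum_insert hi, Finset.sum_insert hi, ← ih]
    rfl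

theorem toDistribution_besovChaos (γ : ℝ) (S : Finset Freq) (b : Freq → Freq → ℂ) (g : Freq → ℂ) :
    (D.besovChaos a γ S b g).toDistribution = D.chaos a S b g := by
  simp only [besovChaos, chaos, toDistribution_sum]
  rfl

/-- Brings the sums for two values of ε to a common index set, so that their difference is again a
chaos. -/
theorem besovChaos_eq_of_subset (γ : ℝ) {S T : Finset Freq} (hST : S ⊆ T) {b : Freq → Freq → ℂ}
    (hb : ∀ k l, k ∉ S ∨ l ∉ S → b k l = 0) (g : Freq → ℂ) :
    D.besovChaos a γ S b g = D.besovChaos a γ T b g := by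
  unfold besovChaos
  rw [← Finset.sum_subset hST fun k _ hk => Finset.sum_eq_zero fun l _ => by
    rw [hb k l (Or.inl hk), zero_mul, zero_smul]]
  refine Finset.sum_congr rfl fun k _ => ?_
  exact Finset.sum_subset hST fun l _ hl => by rw [hb k l (Or.inr hl), zero_mul, zero_smul]

theorem besovChaos_sub (γ : ℝ) (S : Finset Freq) (b b' : Freq → Freq → ℂ) (g : Freq → ℂ) :
    D.besovChaos a γ S b g - D.besovChaos a γ S b' g
      = D.besovChaos a γ S (fun k l => b k l - b' k l) g := by
  simp only [besovChaos, ← Finset.sum_sub_distrib, ← sub_smul, ← sub_mul]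

variable {a} {s : ℝ}

/-- A finite sum of scalar random variables times fixed vectors: strong measurability requires no
separability of C^γ. -/
theorem aestronglyMeasurable_besovChaos {Ω : Type*} [MeasurableSpace Ω] {P : Measure Ω}
    {ξ : Ω → TorusDistribution} (hξ : IsWhiteNoise P ξ) (γ : ℝ) (S : Finset Freq)
    (b : Freq → Freq → ℂ) :
    AEStronglyMeasurable (fun ω => D.besovChaos a γ S b (ξ ω).coeff) P := by
  unfold besovChaos
  refine Finset.aestronglyMeasurable_fun_sum _ fun k _ =>
    Finset.aestronglyMeasurable_fun_sum _ fun l _ => ?_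
  have h := fun k => (hξ.memLp_two_coeff k).1
  exact ((((h k).mul (h l)).sub aestronglyMeasurable_const).const_mul _).smul_const _

theorem exists_eLpNorm_besovChaos_le (ha : IsSymbol D s 0 a) (hs : s ≤ 0) {Λ : ℝ}
    (hΛ : 0 < Λ) (hsupp : ∀ k l n : Freq, D.kernelCoeff a k l n ≠ 0 → l.bracket ≤ Λ * k.bracket ∧
      ∀ q, D.weight q n.vec ≠ 0 → (2 : ℝ) ^ q ≤ Λ * k.bracket)
    {α : ℝ} (hα : 0 < α) (hα' : α < 1) {Ω : Type*} [MeasurableSpace Ω] {P : Measure Ω}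
    [IsProbabilityMeasure P] {ξ : Ω → TorusDistribution} (hξ : IsWhiteNoise P ξ) {r : ℝ≥0∞}
    (hr : r ≠ ∞) :
    ∃ B : ℝ≥0∞, B ≠ ∞ ∧ ∀ (M : ℝ) (b : Freq → Freq → ℂ), 0 ≤ M →
      (∀ k l, l.bracket ≤ Λ * k.bracket → ‖b k l‖ ≤ M * k.bracket ^ ((1 - α) / 2 - 2)) →
      ∀ S : Finset Freq, eLpNorm (fun ω => D.besovChaos a (2 * α - 2 - s) S b (ξ ω).coeff) r P
        ≤ B * ENNReal.ofReal M := by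
  -- One p large enough both to dominate r and to make the series over blocks converge.
  obtain ⟨p, hp⟩ := exists_nat_gt (max (r.toReal) (3 / (2 * (1 - α))))
  rw [max_lt_iff] at hp
  have hp0 : p ≠ 0 := by
    rintro rfl
    exact absurd hp.1 (by simp)
  have hp3 : 3 < 2 * p * (1 - α) := by
    have h1 := hp.2
    rw [div_lt_iff₀ (by linarith)] at h1
    linarith
  have hrp : r ≤ ((2 * p : ℕ) : ℝ≥0∞) := by
    rw [← ENNReal.ofReal_toReal hr, ← ENNReal.ofReal_natCast]
    refine ENNReal.ofReal_le_ofReal ?_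
    push_cast
    have : (0 : ℝ) ≤ p := by positivity
    linarith [hp.1]
  obtain ⟨B, hB, hBm⟩ := D.exists_lintegral_besovENorm_chaos_le ha hs hΛ hsupp hα hα' hξ hp3
  have h2p : (0 : ℝ) < ((2 * p : ℕ) : ℝ) := by positivity
  refine ⟨B ^ ((2 * p : ℕ) : ℝ)⁻¹, ENNReal.rpow_ne_top_of_nonneg (by positivity) hB,
    fun M b hM hb S => ?_⟩
  refine (eLpNorm_le_eLpNorm_of_exponent_le hrp
    (D.aestronglyMeasurable_besovChaos hξ _ S b)).trans ?_
  rw [eLpNorm_eq_lintegral_rpow_enorm_toReal (by simpa using hp0) (ENNReal.natCast_ne_top _),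
    ENNReal.toReal_natCast, one_div]
  have h1 := ENNReal.rpow_le_rpow (hBm M b hM hb S) (inv_nonneg.2 h2p.le)
  rw [ENNReal.mul_rpow_of_nonneg _ _ (by positivity), ← ENNReal.rpow_natCast, ← ENNReal.rpow_mul,
    mul_inv_cancel₀ h2p.ne', ENNReal.rpow_one] at h1
  refine le_trans (le_of_eq ?_) h1
  simp only [enorm_besovSpace, toDistribution_besovChaos, ENNReal.rpow_natCast]

end DyadicPartition

end

theorem theorem2 (D : DyadicPartition) (χ : Cutoff) (α s : ℝ) (hα : 2 / 3 < α) (hα' : α < 1)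
    (hs : s ≤ 0) (a : Torus2 → Freq → ℂ) (ha : IsSymbol D s 0 a) :
    ∃ c : ℝ → Torus2 → ℂ,
      (∀ ε ∈ Set.Ioc (0 : ℝ) 1, SmoothOnTorus (c ε)) ∧
      ((∃ κ : ℝ, 0 < κ ∧ ∃ R : ℝ, ∀ (x : Torus2) (k : Freq), R ≤ k.len → κ ≤ (a x k).re) →
        Tendsto (fun ε => supENorm (c ε)) (𝓝[>] 0) (𝓝 ∞)) ∧
      ∀ (Ω : Type*) [MeasurableSpace Ω] (P : Measure Ω) [IsProbabilityMeasure P]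
        (ξ : Ω → TorusDistribution), IsWhiteNoise P ξ →
        ∃ (Y : ℝ → Ω → D.BesovSpace (2 * α - 2 - s)) (L : Ω → D.BesovSpace (2 * α - 2 - s)),
          (∀ ε ∈ Set.Ioc (0 : ℝ) 1, ∀ ω,
            (Y ε ω).toDistribution =
              TorusDistribution.ofFun
                (D.resonant
                  (TorusDistribution.ofFun
                    (pseudoDiff a (χ.regularize ε (ξ ω).negInvLaplacian)))
                  (χ.regularize ε (ξ ω)) - c ε)) ∧
          ∀ r : ℝ≥0∞, 1 ≤ r → r ≠ ∞ →
            (∀ ε ∈ Set.Ioc (0 : ℝ) 1, MemLp (Y ε) r P) ∧ MemLp L r P ∧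
              Tendsto (fun ε => eLpNorm (fun ω => Y ε ω - L ω) r P) (𝓝[>] 0) (𝓝 0) := by
  -- The expectation depends on the noise only through its covariance, so it can be fixed before the
  -- probability space.
  refine ⟨D.counterterm a χ, fun ε _ => D.smoothOnTorus_counterterm a χ ε,
    D.tendsto_supENorm_counterterm χ ha, fun Ω _ P _ ξ hξ => ?_⟩
  obtain ⟨Λ, hΛ, hsupp⟩ := D.exists_kernelCoeff_support ha
  set γ : ℝ := 2 * α - 2 - s with hγ
  set θ : ℝ := (1 - α) / 2 with hθ
  have hθ0 : 0 < θ := by rw [hθ]; linarith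
  set Y : ℝ → Ω → D.BesovSpace γ := fun ε ω => D.besovChaos a γ (freqBall (2 / ε))
    (fun k l => (χ.pairWeight ε k l : ℂ)) (ξ ω).coeff with hY
  have hmem : ∀ ε ∈ Set.Ioc (0 : ℝ) 1, ∀ r : ℝ≥0∞, 1 ≤ r → r ≠ ∞ → MemLp (Y ε) r P :=
    fun ε hε r _ hr => by
      obtain ⟨B, hB, hBm⟩ := D.exists_eLpNorm_besovChaos_le ha hs hΛ hsupp
        (by linarith : (0 : ℝ) < α) hα' hξ hr
      exact ⟨D.aestronglyMeasurable_besovChaos hξ γ _ _,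
        (hBm 4 _ (by norm_num) (fun k l _ => Cutoff.norm_pairWeight_le hθ0.le k l) _).trans_lt
          (ENNReal.mul_lt_top hB.lt_top ENNReal.ofReal_lt_top)⟩
  have hrate : ∀ r : ℝ≥0∞, 1 ≤ r → r ≠ ∞ → ∃ B : ℝ≥0∞, B ≠ ∞ ∧ ∀ ε ∈ Set.Ioc (0 : ℝ) 1,
      ∀ δ ∈ Set.Ioc (0 : ℝ) 1, ∀ η : ℝ, ε ≤ η → δ ≤ η →
        eLpNorm (Y ε - Y δ) r P ≤ B * ENNReal.ofReal (η ^ θ) := fun r _ hr => by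
    classical
    obtain ⟨B, hB, hBm⟩ := D.exists_eLpNorm_besovChaos_le ha hs hΛ hsupp
        (by linarith : (0 : ℝ) < α) hα' hξ hr
    refine ⟨B * ENNReal.ofReal (4 * (1 + Λ) ^ θ), ENNReal.mul_ne_top hB ENNReal.ofReal_ne_top,
      fun ε hε δ hδ η hεη hδη => ?_⟩
    have hη : 0 < η := hε.1.trans_le hεη
    have h1 := hBm (4 * (1 + Λ) ^ θ * η ^ θ)
      (fun k l => (χ.pairWeight ε k l : ℂ) - (χ.pairWeight δ k l : ℂ)) (by positivity)
      (fun k l hkl => Cutoff.norm_pairWeight_sub_le hθ0.le hΛ hε.1 hδ.1 hεη hδη hkl)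
      -- Each weight vanishes as soon as one of its frequencies leaves its own ball, so both chaoses
      -- may be summed over the union.
      (freqBall (2 / ε) ∪ freqBall (2 / δ))
    rw [ENNReal.ofReal_mul (by positivity), ← mul_assoc] at h1
    refine le_trans (le_of_eq ?_) h1
    congr 1
    funext ω
    rw [← D.besovChaos_sub, Pi.sub_apply, hY]
    congr 1
    · exact D.besovChaos_eq_of_subset a γ Finset.subset_union_left (fun k l h => by
        rw [Cutoff.pairWeight_eq_zero hε.1 h, Complex.ofReal_zero]) _
    · exact D.besovChaos_eq_of_subset a γ Finset.subset_union_right (fun k l h => by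
        rw [Cutoff.pairWeight_eq_zero hδ.1 h, Complex.ofReal_zero]) _
  obtain ⟨L, hL⟩ := exists_tendsto_eLpNorm_of_rate hθ0 hmem hrate
  refine ⟨Y, L, fun ε hε ω => ?_, fun r hr hr' => ⟨fun ε hε => hmem ε hε r hr hr', hL r hr hr'⟩⟩
  rw [D.ofFun_resonant_sub_counterterm χ ha hε.1, hY, D.toDistribution_besovChaos]
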